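/- Let $n\ge 1$ and let $\mathscr S$ be the class of Schrödinger equations $$\mathcal L_S:\quad i\psi_t+\sum_{a=1}^n\psi_{x_ax_a}+S(t,x,\rho)\psi=0,\qquad \rho:=|\psi|,$$ where $t\in\mathbb R$, $x=(x_1,\dots,x_n)\in\mathbb R^n$, $\psi$ is the unknown complex-valued function of $(t,x)$, and the arbitrary element $S$ runs through the smooth complex-valued functions of $(t,x,\rho)$, defined on open sets of points with $\rho>0$, such that $S_\rho\ne0$ everywhere. Point transformations are $C^\infty$ local diffeomorphisms between open sets; their domains are assumed to be such that the values of $t$ fill an interval and the part of the domain with each fixed $t$ is connected. An admissible transformation of $\mathscr S$ is a triple $(S,\varphi,\tilde S)$, where $\varphi$ is a point transformation in the space of $(t,x,\psi,\psi^*)$ whose domain and range lie where $\mathcal L_S$ and $\mathcal L_{\tilde S}$, respectively, are defined, and whose second-order prolongation maps $\mathcal L_S$ to $\mathcal L_{\tilde S}$, both regarded as submanifolds of the second-order jet space. An equivalence transformation of $\mathscr S$ is a point transformation $\Phi$ in the space with the coordinates $(t,x,\psi,\psi^*,S,S^*)$, $\psi\ne0$, whose components for $t$, $x$ and $\psi$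 depend only on $(t,x,\psi,\psi^*)$ and which (locally, wherever it is defined) maps each equation of the class $\mathscr S$ to an equation of the same class, that is, yields admissible transformations $(S,\pi_*\Phi,\Phi_*S)$; here $\pi$ is the projection to $(t,x,\psi,\psi^*)$. These transformations constitute the equivalence group $G^\sim_{\mathscr S}$. The class $\mathscr S$ is normalized: each admissible transformation $(S,\varphi,\tilde S)$ of $\mathscr S$ is induced by an equivalence transformation $\Phi$ of $\mathscr S$, i.e. $\varphi=\pi_*\Phi$ and $\tilde S=\Phi_*S$. The equivalence group $G^\sim_{\mathscr S}$ consists of the point transformations in the space with the coordinates $(t,x,\psi,\psi^*,S,S^*)$, $\psi\neq0$, that are of the form $$\tilde t=T,\qquad \tilde x_a=|T_t|^{1/2}O^{ab}x_b+\mathcal X^a,$$ $$\tilde\psi=\exp\left(\frac i8\frac{T_{tt}}{|T_t|}x_ax_a+\frac i2\frac{\varepsilon'\mathcal X^b_t}{|T_t|^{1/2}}O^{ba}x_a+i\Sigma+Z\right)\hat\psi,$$ $$\tilde S=\frac{\hat S}{|T_t|}+\frac{2T_{ttt}T_t-3T_{tt}^2}{16\varepsilon'T_t^3}x_ax_a+\frac{\varepsilon'}2\left(\frac{\mathcal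 X^b_t}{T_t}\right)_{t}\frac{O^{ba}x_a}{|T_t|^{1/2}}+\frac{\Sigma_t-iZ_t}{T_t}-\frac{\mathcal X^a_t\mathcal X^a_t+inT_{tt}}{4T_t^2}.$$ Here summation over repeated indices is understood; $T$, $\mathcal X^a$, $Z$ and $\Sigma$ are arbitrary smooth real-valued functions of $t$ (on the interval of values of $t$ in the domain) with $T_t\ne0$; $\varepsilon'=\operatorname{sgn}T_t$; $O=(O^{ab})$ is an arbitrary constant orthogonal $n\times n$ matrix; and $\hat\beta=\beta$ if $T_t>0$, $\hat\beta=\beta^*$ (complex conjugate) if $T_t<0$. In particular, for every open interval $I$ and every choice of such parameters on $I$, these formulas define an equivalence transformation with the domain $\{t\in I,\ \psi\ne0\}$. -/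

import Mathlib

open scoped ContDiff ComplexConjugate Topology

noncomputable section

namespace ModularSchrodinger

/-- Independent variables `(t, x)`. -/
abbrev Base (n : ℕ) := ℝ × (Fin n → ℝ)

/-- Space of variables `(t, x, ψ)`; a complex coordinate `ψ`, regarded as a real two-dimensional one,
stands for the pair `(ψ, ψ*)`. -/
abbrev Vars (n : ℕ) := Base n × ℂ

/-- Joint space of variables and arbitrary element, with coordinates `(t, x, ψ, S)`
(equivalently `(t, x, ψ, ψ*, S, S*)`). -/
abbrev Joint (n : ℕ) := Vars n × ℂ

/-- The point `(t, x, ρ)` with `ρ = |ψ|` that corresponds to `(t, x, ψ)`. -/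
def modPoint {n : ℕ} (v : Vars n) : Base n × ℝ := (v.1, ‖v.2‖)

/-- Arbitrary elements of the class: smooth complex-valued functions `S(t, x, ρ)` with `S_ρ ≠ 0`,
given on an open set of points `(t, x, ρ)` with `ρ > 0`. -/
structure ArbitraryElement (n : ℕ) where
  dom : Set (Base n × ℝ)
  val : Base n × ℝ → ℂ
  isOpen_dom : IsOpen dom
  pos : ∀ q ∈ dom, 0 < q.2
  smooth : ContDiffOn ℝ ∞ val dom
  deriv_ne_zero : ∀ q ∈ dom, deriv (fun r : ℝ => val (q.1, r)) q.2 ≠ 0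

/-- `ψ_t` at the point `p = (t, x)`. -/
def dt {n : ℕ} (u : Base n → ℂ) (p : Base n) : ℂ :=
  fderiv ℝ u p (1, 0)

/-- `ψ_a` at the point `p = (t, x)`. -/
def dx {n : ℕ} (a : Fin n) (u : Base n → ℂ) (p : Base n) : ℂ :=
  fderiv ℝ u p (0, Pi.single a 1)

/-- The function `u` satisfies `i ψ_t + ψ_aa + S(t, x, |ψ|) ψ = 0` at the single point `p`.
This is a condition on the second-order jet of `u` at `p`. -/
def SolvesAt {n : ℕ} (S : ArbitraryElement n) (u : Base n → ℂ) (p : Base n) : Prop :=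
  Complex.I * dt u p + ∑ a, dx a (dx a u) p + S.val (p, ‖u p‖) * u p = 0

/-- Point transformations: local diffeomorphisms of class `C^∞` between open sets.
The domain is of such a shape (the values of `t` form an interval and the part of the domain with
any fixed `t` is connected) that a function on it depending locally only on `t` is a function
of `t`. Every point of an open set has a basis of neighbourhoods of this shape. -/
structure IsPointTransformation {V : Type*} [NormedAddCommGroup V] [NormedSpace ℝ V]
    (time : V → ℝ) (φ : OpenPartialHomeomorph V V) : Prop where
  smooth : ContDiffOn ℝ ∞ φ φ.source
  smooth_symm : ContDiffOn ℝ ∞ φ.symm φ.target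
  time_connected : IsPreconnected (time '' φ.source)
  slice_connected : ∀ t : ℝ, IsPreconnected (φ.source ∩ time ⁻¹' {t})

/-- The coordinate `t` on the space of variables. -/
def varsTime {n : ℕ} (v : Vars n) : ℝ := v.1.1

/-- The coordinate `t` on the joint space. -/
def jointTime {n : ℕ} (w : Joint n) : ℝ := w.1.1.1

/-- `φ` maps the germ at `p` of the graph of `u` into the graph of `u'`. -/
def MapsGraph {n : ℕ} (φ : Vars n → Vars n) (u u' : Base n → ℂ) (p : Base n) : Prop :=
  ∀ᶠ q in 𝓝 p, (φ (q, u q)).2 = u' (φ (q, u q)).1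

/-- Admissible transformations `(S, φ, S')` of the class, i.e. elements of its equivalence groupoid:
`φ` is a point transformation in the space of variables, its domain and range lie where the two
equations are given, and its second prolongation maps the submanifold of the second-order jet space
given by the equation with `S` to the one given by the equation with `S'`. Here second-order jets are
represented by smooth functions: the prolongation of `φ` maps the jet of `u` at `p` to the jet of `u'`
at the image of `p` when `φ` maps the graph of `u` near `p` to that of `u'`. -/
structure IsAdmissible {n : ℕ} (S : ArbitraryElement n)
    (φ : OpenPartialHomeomorph (Vars n) (Vars n)) (S' : ArbitraryElement n) : Prop where
  pointTransformation : IsPointTransformation varsTime φ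
  source_subset : ∀ v ∈ φ.source, modPoint v ∈ S.dom
  target_subset : ∀ v ∈ φ.target, modPoint v ∈ S'.dom
  maps_equation : ∀ (u u' : Base n → ℂ) (p : Base n),
    (p, u p) ∈ φ.source → ContDiffAt ℝ ∞ u p → ContDiffAt ℝ ∞ u' (φ (p, u p)).1 →
    MapsGraph φ u u' p → (SolvesAt S u p ↔ SolvesAt S' u' (φ (p, u p)).1)

/-- `Φ` maps `S` to `S'` over the domain of `φ`: the graph of `S` over `(t, x, ψ)`-points
goes to the graph of `S'`, with `φ` being the action of `Φ` on the variables. -/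
def Induces {n : ℕ} (Φ : OpenPartialHomeomorph (Joint n) (Joint n)) (S : ArbitraryElement n)
    (φ : OpenPartialHomeomorph (Vars n) (Vars n)) (S' : ArbitraryElement n) : Prop :=
  ∀ v ∈ φ.source, (v, S.val (modPoint v)) ∈ Φ.source ∧
    Φ (v, S.val (modPoint v)) = (φ v, S'.val (modPoint (φ v)))

/-- Equivalence transformations of the class, i.e. elements of its (usual) equivalence group:
point transformations in the joint space (over `ψ ≠ 0`) whose components for `(t, x, ψ)` do not
depend on `S`, and which map each equation of the class (where they are defined)
to an equation of the class. -/
structure IsEquivalence {n : ℕ} (Φ : OpenPartialHomeomorph (Joint n) (Joint n)) : Prop where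
  pointTransformation : IsPointTransformation jointTime Φ
  ne_zero : ∀ w ∈ Φ.source, w.1.2 ≠ 0
  projectable : ∃ f : Vars n → Vars n, ∀ w ∈ Φ.source, (Φ w).1 = f w.1
  maps_class : ∀ (S : ArbitraryElement n) (v : Vars n),
    modPoint v ∈ S.dom → (v, S.val (modPoint v)) ∈ Φ.source →
    ∃ (φ : OpenPartialHomeomorph (Vars n) (Vars n)) (S' : ArbitraryElement n),
      v ∈ φ.source ∧ Induces Φ S φ S' ∧ IsAdmissible S φ S'

/-- The class is normalized: every admissible transformation is induced by an equivalence
transformation `Φ`, i.e. it is `(S, π_* Φ, Φ_* S)`. -/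
def IsNormalized (n : ℕ) : Prop :=
  ∀ (S : ArbitraryElement n) (φ : OpenPartialHomeomorph (Vars n) (Vars n))
    (S' : ArbitraryElement n), IsAdmissible S φ S' →
    ∃ Φ : OpenPartialHomeomorph (Joint n) (Joint n), IsEquivalence Φ ∧
      Prod.fst '' Φ.source = φ.source ∧ (∀ w ∈ Φ.source, (Φ w).1 = φ w.1) ∧
      Induces Φ S φ S'

/-- `β ↦ β` or `β ↦ β*`, according to the sign of `τ` (the value of `T_t`). -/
def hat (τ : ℝ) (β : ℂ) : ℂ := if 0 < τ then β else conj β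

/-- The parameters `T`, `O`, `𝒳`, `Σ`, `Z`. -/
structure Params (n : ℕ) where
  T : ℝ → ℝ
  O : Matrix (Fin n) (Fin n) ℝ
  X : Fin n → ℝ → ℝ
  Sig : ℝ → ℝ
  Z : ℝ → ℝ

namespace Params

variable {n : ℕ} (P : Params n)

/-- The parameter functions are smooth on `I`, `T_t ≠ 0` there, and `O` is orthogonal. -/
structure IsValidOn (I : Set ℝ) : Prop where
  smooth_T : ContDiffOn ℝ ∞ P.T I
  deriv_T : ∀ t ∈ I, deriv P.T t ≠ 0
  orthogonal : P.O ∈ Matrix.orthogonalGroup (Fin n) ℝ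
  smooth_X : ∀ a, ContDiffOn ℝ ∞ (P.X a) I
  smooth_Sig : ContDiffOn ℝ ∞ P.Sig I
  smooth_Z : ContDiffOn ℝ ∞ P.Z I

/-- `ε' = sgn T_t`. -/
def eps (t : ℝ) : ℝ := Real.sign (deriv P.T t)

/-- `x`-components `|T_t|^{1/2} O^{ab} x_b + 𝒳^a`. -/
def xMap (t : ℝ) (x : Fin n → ℝ) : Fin n → ℝ :=
  fun a => √|deriv P.T t| * ∑ b, P.O a b * x b + P.X a t

/-- The phase `T_tt x_a x_a / (8 |T_t|) + ε' 𝒳^b_t O^{ba} x_a / (2 |T_t|^{1/2}) + Σ`. -/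
def phase (t : ℝ) (x : Fin n → ℝ) : ℝ :=
  1 / 8 * (iteratedDeriv 2 P.T t / |deriv P.T t|) * ∑ a, x a * x a
    + 1 / 2 * ∑ b, ∑ a, P.eps t * deriv (P.X b) t / √|deriv P.T t| * P.O b a * x a
    + P.Sig t

/-- `ψ`-component. -/
def psiMap (t : ℝ) (x : Fin n → ℝ) (ψ : ℂ) : ℂ :=
  Complex.exp (Complex.I * (P.phase t x : ℂ) + (P.Z t : ℂ)) * hat (deriv P.T t) ψ

/-- `S`-component. -/
def sMap (t : ℝ) (x : Fin n → ℝ) (s : ℂ) : ℂ :=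
  hat (deriv P.T t) s / (|deriv P.T t| : ℝ)
    + (((2 * iteratedDeriv 3 P.T t * deriv P.T t - 3 * iteratedDeriv 2 P.T t ^ 2)
          / (16 * P.eps t * deriv P.T t ^ 3) * ∑ a, x a * x a : ℝ) : ℂ)
    + ((P.eps t / 2 * ∑ b, ∑ a, deriv (fun r => deriv (P.X b) r / deriv P.T r) t
          * (P.O b a * x a) / √|deriv P.T t| : ℝ) : ℂ)
    + (((deriv P.Sig t : ℝ) : ℂ) - Complex.I * ((deriv P.Z t : ℝ) : ℂ)) / ((deriv P.T t : ℝ) : ℂ)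
    - (((∑ a, deriv (P.X a) t * deriv (P.X a) t : ℝ) : ℂ)
          + Complex.I * (n : ℂ) * ((iteratedDeriv 2 P.T t : ℝ) : ℂ)) / (4 * ((deriv P.T t : ℝ) : ℂ) ^ 2)

/-- The transformation of the joint space with parameters `P`. -/
def map (w : Joint n) : Joint n :=
  (((P.T w.1.1.1, P.xMap w.1.1.1 w.1.1.2), P.psiMap w.1.1.1 w.1.1.2 w.1.2),
    P.sMap w.1.1.1 w.1.1.2 w.2)

end Params

end ModularSchrodinger

end

open scoped ContDiff ComplexConjugate Topology

noncomputable section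

namespace ModularSchrodinger

/-! The substance is the determination of all admissible transformations. A second-order jet is
realized by a quadratic polynomial, so `IsAdmissible.jetCondition` turns invariance of the equation
into an algebraic equivalence at each point, with coefficients the first and second derivatives of
the transformation and with free variables ψ_t, ψ_a, ψ_ab. A priori the new t and x may involve ψ;
hence only those jets are tested whose tangent plane is mapped isomorphically to the new base.

Splitting with respect to the free variables gives the determining equations. A trace-free change of
the Hessian keeps a jet on the equation, so its transform must do the same. The choice dt⊗dt
produces a vanishing sum of squares, and the new time depends on t alone. Trading ψ_t against ψ_aa
shows that the spatial Jacobian is conformal with factor |T_t| and that the ψ-derivative commutes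
with i up to sgn T_t, which is the source of the complex conjugation. Conformality must hold for a
whole line of values of ψ_a; its quadratic term makes the new x independent of ψ. Lower-order terms
make the new ψ affine in ψ and prescribe the logarithmic x-gradient of its ψ-coefficient.

To integrate: the conformal factor depends on t only, so x enters affinely, by the argument that
isometries have vanishing Christoffel-type symbols (`BaseDetermined.D2_spatial`). Integrability of
the prescribed logarithmic gradient excludes rotations depending on t (`D2_time_spatial`), so O is
constant. All remaining freedom is a function of t, and the shape of the domain makes these
functions global (`TimeDomain.exists_params`).

A summand D(t,x) of the new ψ is still possible, as for linear equations with their superposition of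
solutions. Here it would force S'(|ζ+d|)(ζ+d) = F(|ζ|)ζ + γ for ζ in an open set, and rotating ζ
shows that this is impossible for d ≠ 0 when S'_ρ ≠ 0 (`eq_zero_of_rotation`). The formula for the
new S then follows by comparing equations.

Conversely, `Params.IsValidOn.transform_identity` says that |T_t| times the new equation is a
nonvanishing factor times the old one, conjugated if T_t < 0. So the stated formulas act on the
whole class, and each admissible transformation extends to an equivalence transformation by letting
S be arbitrary. For a given equivalence transformation, every point of the joint space lies on the
graph of some `linearElement`; the admissible germs obtained in this way satisfy the determining
equations, which are then integrated over the whole domain. -/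

section

/-! ### Second derivatives, prolongation of maps and realization of jets -/

section SecondDerivative

variable {E F G : Type*} [NormedAddCommGroup E] [NormedSpace ℝ E] [NormedAddCommGroup F]
  [NormedSpace ℝ F] [NormedAddCommGroup G] [NormedSpace ℝ G]

/-- The second derivative as a bilinear map. -/
def D2 (f : E → F) (p : E) : E →L[ℝ] E →L[ℝ] F := fderiv ℝ (fderiv ℝ f) p

theorem differentiableAt_fderiv {f : E → F} {p : E} (hf : ContDiffAt ℝ ∞ f p) :
    DifferentiableAt ℝ (fderiv ℝ f) p :=
  (hf.fderiv_right (m := 1) (by norm_cast)).differentiableAt (by simp)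

theorem contDiffAt_fderiv {f : E → F} {p : E} (hf : ContDiffAt ℝ ∞ f p) :
    ContDiffAt ℝ ∞ (fderiv ℝ f) p :=
  hf.fderiv_right (m := ∞) (by norm_cast)

theorem contDiffAt_fderiv_apply {f : E → F} {p : E} (hf : ContDiffAt ℝ ∞ f p) (v : E) :
    ContDiffAt ℝ ∞ (fun q => fderiv ℝ f q v) p :=
  (contDiffAt_fderiv hf).clm_apply contDiffAt_const

theorem diffAt {f : E → F} {p : E} (hf : ContDiffAt ℝ ∞ f p) :
    DifferentiableAt ℝ f p := hf.differentiableAt (by simp)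

theorem eventually_differentiableAt {f : E → F} {p : E} (hf : ContDiffAt ℝ ∞ f p) :
    ∀ᶠ q in 𝓝 p, DifferentiableAt ℝ f q := by
  have h : ContDiffAt ℝ 1 f p := hf.of_le (by norm_cast)
  filter_upwards [h.eventually (by simp)] with q hq
  exact hq.differentiableAt (by simp)

theorem fderiv_fderiv_apply {f : E → F} {p : E} (hf : ContDiffAt ℝ ∞ f p) (v w : E) :
    fderiv ℝ (fun q => fderiv ℝ f q v) p w = D2 f p w v := by
  have h := (differentiableAt_fderiv hf).hasFDerivAt.clm_apply (hasFDerivAt_const v p)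
  rw [h.fderiv]; simp [D2]

theorem D2_symm {f : E → F} {p : E} (hf : ContDiffAt ℝ ∞ f p) (v w : E) :
    D2 f p v w = D2 f p w v := by
  have h : IsSymmSndFDerivAt ℝ f p := hf.isSymmSndFDerivAt (by simp; norm_cast)
  exact h v w

theorem D2_congr {f g : E → F} {p : E} (h : f =ᶠ[𝓝 p] g) : D2 f p = D2 g p := by
  unfold D2
  exact h.fderiv.fderiv_eq

theorem D2_comp {f : F → G} {g : E → F} {p : E} (hf : ContDiffAt ℝ ∞ f (g p))
    (hg : ContDiffAt ℝ ∞ g p) (v w : E) :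
    D2 (fun q => f (g q)) p v w
      = D2 f (g p) (fderiv ℝ g p v) (fderiv ℝ g p w) + fderiv ℝ f (g p) (D2 g p v w) := by
  have h1 : fderiv ℝ (fun q => f (g q)) =ᶠ[𝓝 p]
      fun q => (fderiv ℝ f (g q)).comp (fderiv ℝ g q) := by
    filter_upwards [eventually_differentiableAt hg,
      hg.continuousAt.eventually (eventually_differentiableAt hf)] with q h1 h2
    exact fderiv_fun_comp q h2 h1
  have h2 : HasFDerivAt (fun q => fderiv ℝ f (g q)) ((D2 f (g p)).comp (fderiv ℝ g p)) p :=
    HasFDerivAt.comp p (differentiableAt_fderiv hf).hasFDerivAt (diffAt hg).hasFDerivAt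
  have h3 := h2.clm_comp (differentiableAt_fderiv hg).hasFDerivAt
  unfold D2
  rw [h1.fderiv_eq, h3.fderiv]
  simp [D2, add_comm]

theorem fderiv_comp_apply' {f : F → G} {g : E → F} {p : E} (hf : ContDiffAt ℝ ∞ f (g p))
    (hg : ContDiffAt ℝ ∞ g p) (v : E) :
    fderiv ℝ (fun q => f (g q)) p v = fderiv ℝ f (g p) (fderiv ℝ g p v) := by
  rw [fderiv_fun_comp p (diffAt hf) (diffAt hg)]; rfl

theorem D2_add {f g : E → F} {p : E} (hf : ContDiffAt ℝ ∞ f p) (hg : ContDiffAt ℝ ∞ g p) :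
    D2 (fun q => f q + g q) p = D2 f p + D2 g p := by
  have h1 : fderiv ℝ (fun q => f q + g q) =ᶠ[𝓝 p] fun q => fderiv ℝ f q + fderiv ℝ g q := by
    filter_upwards [eventually_differentiableAt hf, eventually_differentiableAt hg] with q h1 h2
    exact fderiv_fun_add h1 h2
  unfold D2
  rw [h1.fderiv_eq, fderiv_fun_add (differentiableAt_fderiv hf) (differentiableAt_fderiv hg)]

theorem fderiv_prodMk_apply {f : E → F} {g : E → G} {p : E} (hf : DifferentiableAt ℝ f p)
    (hg : DifferentiableAt ℝ g p) (v : E) :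
    fderiv ℝ (fun q => (f q, g q)) p v = (fderiv ℝ f p v, fderiv ℝ g p v) := by
  rw [hf.fderiv_prodMk hg]; rfl

/-- The prolongation of the graph parametrization `q ↦ (q, u q)`. -/
theorem fderiv_graph {u : E → F} {p : E} (hu : ContDiffAt ℝ ∞ u p) (v : E) :
    fderiv ℝ (fun q => (q, u q)) p v = (v, fderiv ℝ u p v) := by
  rw [fderiv_prodMk_apply differentiableAt_fun_id (diffAt hu)]; simp

theorem D2_graph {u : E → F} {p : E} (hu : ContDiffAt ℝ ∞ u p) (v w : E) :
    D2 (fun q => (q, u q)) p v w = (0, D2 u p v w) := by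
  have h1 : fderiv ℝ (fun q => (q, u q)) =ᶠ[𝓝 p]
      fun q => (ContinuousLinearMap.inl ℝ E F)
        + (ContinuousLinearMap.inr ℝ E F).comp (fderiv ℝ u q) := by
    filter_upwards [eventually_differentiableAt hu] with q h1
    ext v
    · simp [fderiv_prodMk_apply differentiableAt_fun_id h1]
    · simp [fderiv_prodMk_apply differentiableAt_fun_id h1]
  have h3 := ((hasFDerivAt_const (ContinuousLinearMap.inr ℝ E F) p).clm_comp
    (differentiableAt_fderiv hu).hasFDerivAt).const_add (ContinuousLinearMap.inl ℝ E F)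
  unfold D2
  rw [h1.fderiv_eq, h3.fderiv]
  simp

/-- The function with the second-order jet `(c, ℓ, Q)` at `p`. -/
def jetFun (p : E) (c : F) (ℓ : E →L[ℝ] F) (Q : E →L[ℝ] E →L[ℝ] F) (q : E) : F :=
  c + ℓ (q - p) + (1 / 2 : ℝ) • Q (q - p) (q - p)

theorem contDiff_jetFun (p : E) (c : F) (ℓ : E →L[ℝ] F) (Q : E →L[ℝ] E →L[ℝ] F) :
    ContDiff ℝ ∞ (jetFun p c ℓ Q) := by
  unfold jetFun
  have h : ContDiff ℝ ∞ (fun q : E => q - p) := by fun_prop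
  exact (contDiff_const.add (ℓ.contDiff.comp h)).add
    (contDiff_const.smul ((Q.contDiff.comp h).clm_apply h))

theorem jetFun_self (p : E) (c : F) (ℓ : E →L[ℝ] F) (Q : E →L[ℝ] E →L[ℝ] F) :
    jetFun p c ℓ Q p = c := by simp [jetFun]

theorem fderiv_jetFun (p : E) (c : F) (ℓ : E →L[ℝ] F) (Q : E →L[ℝ] E →L[ℝ] F)
    (hQ : ∀ v w, Q v w = Q w v) (q : E) :
    fderiv ℝ (jetFun p c ℓ Q) q = ℓ + Q (q - p) := by
  have h : HasFDerivAt (fun q : E => q - p) (ContinuousLinearMap.id ℝ E) q :=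
    (hasFDerivAt_id q).sub_const p
  have h1 : HasFDerivAt (fun q : E => ℓ (q - p)) (ℓ.comp (ContinuousLinearMap.id ℝ E)) q :=
    ℓ.hasFDerivAt.comp q h
  have h2 : HasFDerivAt (fun q : E => Q (q - p)) (Q.comp (ContinuousLinearMap.id ℝ E)) q :=
    Q.hasFDerivAt.comp q h
  have h3 := (h1.const_add c).add ((h2.clm_apply h).const_smul (1 / 2 : ℝ))
  have h4 : HasFDerivAt (jetFun p c ℓ Q) _ q := h3
  rw [h4.fderiv]
  ext v
  simp only [add_apply, smul_apply,
    ContinuousLinearMap.comp_apply, ContinuousLinearMap.id_apply, ContinuousLinearMap.flip_apply]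
  rw [hQ v (q - p), ← two_smul ℝ, smul_smul]; norm_num

theorem D2_jetFun (p : E) (c : F) (ℓ : E →L[ℝ] F) (Q : E →L[ℝ] E →L[ℝ] F)
    (hQ : ∀ v w, Q v w = Q w v) (q : E) :
    D2 (jetFun p c ℓ Q) q = Q := by
  have h : HasFDerivAt (fun q : E => q - p) (ContinuousLinearMap.id ℝ E) q :=
    (hasFDerivAt_id q).sub_const p
  have h2 : HasFDerivAt (fun q : E => Q (q - p)) (Q.comp (ContinuousLinearMap.id ℝ E)) q :=
    Q.hasFDerivAt.comp q h
  unfold D2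
  rw [funext (fderiv_jetFun p c ℓ Q hQ), (h2.const_add ℓ).fderiv]
  rfl

end SecondDerivative

variable {n : ℕ}

/-- The unit vector in the direction of `t`. -/
def et : Base n := (1, 0)

/-- The unit vector in the direction of `x_a`. -/
def ex (a : Fin n) : Base n := (0, Pi.single a 1)

theorem dt_eq (u : Base n → ℂ) (p : Base n) : dt u p = fderiv ℝ u p et := rfl

theorem dx_dx_eq (a : Fin n) {u : Base n → ℂ} {p : Base n} (hu : ContDiffAt ℝ ∞ u p) :
    dx a (dx a u) p = D2 u p (ex a) (ex a) := fderiv_fderiv_apply hu _ _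

theorem base_eq_sum (w : Base n) : w = w.1 • et + ∑ a, w.2 a • ex a := by
  refine Prod.ext ?_ ?_
  · simp [et, ex, Prod.fst_sum]
  · ext b
    simp [et, ex, Prod.snd_sum, Finset.sum_apply, Pi.single_apply]

/-- The first prolongation of a point transformation. -/
theorem MapsGraph.fderiv_eq {f : Vars n → Vars n} {u u' : Base n → ℂ} {p : Base n}
    (hf : ContDiffAt ℝ ∞ f (p, u p)) (hu : ContDiffAt ℝ ∞ u p)
    (hu' : ContDiffAt ℝ ∞ u' (f (p, u p)).1) (h : MapsGraph f u u' p) (w : Base n) :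
    fderiv ℝ u' (f (p, u p)).1 (fderiv ℝ (fun v => (f v).1) (p, u p) (w, fderiv ℝ u p w))
      = fderiv ℝ (fun v => (f v).2) (p, u p) (w, fderiv ℝ u p w) := by
  have hg : ContDiffAt ℝ ∞ (fun q => (q, u q)) p := contDiffAt_id.prodMk hu
  have hY : ContDiffAt ℝ ∞ (fun v => (f v).1) (p, u p) := contDiffAt_fst.comp _ hf
  have hP : ContDiffAt ℝ ∞ (fun v => (f v).2) (p, u p) := contDiffAt_snd.comp _ hf
  have hb : ContDiffAt ℝ ∞ (fun q => (f (q, u q)).1) p :=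
    ContDiffAt.comp (g := fun v => (f v).1) p hY hg
  have e := congrArg (fun L => L w) (Filter.EventuallyEq.fderiv_eq (𝕜 := ℝ) h)
  have e1 := fderiv_comp_apply' (f := fun v => (f v).2) (g := fun q => (q, u q)) hP hg w
  have e2 := fderiv_comp_apply' (f := u') (g := fun q => (f (q, u q)).1) hu' hb w
  have e3 := fderiv_comp_apply' (f := fun v => (f v).1) (g := fun q => (q, u q)) hY hg w
  rw [fderiv_graph hu] at e1 e3
  beta_reduce at e
  rw [e1, e2, e3] at e
  exact e.symm

/-- The second prolongation of a point transformation. -/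
theorem MapsGraph.D2_eq {f : Vars n → Vars n} {u u' : Base n → ℂ} {p : Base n}
    (hf : ContDiffAt ℝ ∞ f (p, u p)) (hu : ContDiffAt ℝ ∞ u p)
    (hu' : ContDiffAt ℝ ∞ u' (f (p, u p)).1) (h : MapsGraph f u u' p) (w z : Base n) :
    D2 u' (f (p, u p)).1 (fderiv ℝ (fun v => (f v).1) (p, u p) (w, fderiv ℝ u p w))
        (fderiv ℝ (fun v => (f v).1) (p, u p) (z, fderiv ℝ u p z))
      + fderiv ℝ u' (f (p, u p)).1
        (D2 (fun v => (f v).1) (p, u p) (w, fderiv ℝ u p w) (z, fderiv ℝ u p z)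
          + fderiv ℝ (fun v => (f v).1) (p, u p) (0, D2 u p w z))
      = D2 (fun v => (f v).2) (p, u p) (w, fderiv ℝ u p w) (z, fderiv ℝ u p z)
          + fderiv ℝ (fun v => (f v).2) (p, u p) (0, D2 u p w z) := by
  have hg : ContDiffAt ℝ ∞ (fun q => (q, u q)) p := contDiffAt_id.prodMk hu
  have hY : ContDiffAt ℝ ∞ (fun v => (f v).1) (p, u p) := contDiffAt_fst.comp _ hf
  have hP : ContDiffAt ℝ ∞ (fun v => (f v).2) (p, u p) := contDiffAt_snd.comp _ hf
  have hb : ContDiffAt ℝ ∞ (fun q => (f (q, u q)).1) p :=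
    ContDiffAt.comp (g := fun v => (f v).1) p hY hg
  have e := congrArg (fun L => L w z) (D2_congr h)
  have e1 := D2_comp (f := fun v => (f v).2) (g := fun q => (q, u q)) hP hg w z
  have e2 := D2_comp (f := u') (g := fun q => (f (q, u q)).1) hu' hb w z
  have e3 := D2_comp (f := fun v => (f v).1) (g := fun q => (q, u q)) hY hg w z
  have e4 := fderiv_comp_apply' (f := fun v => (f v).1) (g := fun q => (q, u q)) hY hg w
  have e5 := fderiv_comp_apply' (f := fun v => (f v).1) (g := fun q => (q, u q)) hY hg z
  rw [D2_graph hu] at e1 e3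
  rw [fderiv_graph hu] at e4 e5
  rw [fderiv_graph hu, fderiv_graph hu] at e1 e3
  beta_reduce at e
  rw [e1, e2, e3, e4, e5] at e
  exact e.symm

/-- A graph that a local diffeomorphism maps transversally is mapped to a graph. -/
theorem exists_mapsGraph {f : Vars n → Vars n} {u : Base n → ℂ} {p : Base n}
    (hf : ContDiffAt ℝ ∞ f (p, u p)) (hu : ContDiffAt ℝ ∞ u p) (B : Base n ≃L[ℝ] Base n)
    (hB : ∀ w, fderiv ℝ (fun v => (f v).1) (p, u p) (w, fderiv ℝ u p w) = B w) :
    ∃ u' : Base n → ℂ, ContDiffAt ℝ ∞ u' (f (p, u p)).1 ∧ MapsGraph f u u' p := by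
  have hg : ContDiffAt ℝ ∞ (fun q => (q, u q)) p := contDiffAt_id.prodMk hu
  have hY : ContDiffAt ℝ ∞ (fun v => (f v).1) (p, u p) := contDiffAt_fst.comp _ hf
  have hP : ContDiffAt ℝ ∞ (fun v => (f v).2) (p, u p) := contDiffAt_snd.comp _ hf
  have hb : ContDiffAt ℝ ∞ (fun q => (f (q, u q)).1) p :=
    ContDiffAt.comp (g := fun v => (f v).1) p hY hg
  have hd : HasFDerivAt (fun q => (f (q, u q)).1) (B : Base n →L[ℝ] Base n) p := by
    have h := (diffAt hb).hasFDerivAt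
    suffices e : fderiv ℝ (fun q => (f (q, u q)).1) p = (B : Base n →L[ℝ] Base n) by rwa [← e]
    refine ContinuousLinearMap.ext fun w => ?_
    rw [fderiv_comp_apply' (f := fun v => (f v).1) (g := fun q => (q, u q)) hY hg w,
      fderiv_graph hu, hB]
    rfl
  -- The inverse function theorem for the base component along the graph; composing the ψ-component
  -- with the local inverse gives the new function.
  have hs := hb.hasStrictFDerivAt' hd (by simp)
  have hi : ContDiffAt ℝ ∞ (hs.localInverse _ _ _) (f (p, u p)).1 :=
    hb.to_localInverse hd (by simp)
  refine ⟨fun q => (f (hs.localInverse _ _ _ q, u (hs.localInverse _ _ _ q))).2, ?_, ?_⟩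
  · have h0 : hs.localInverse _ _ _ (f (p, u p)).1 = p := hs.localInverse_apply_image
    have hPg : ContDiffAt ℝ ∞ (fun q => (f (q, u q)).2) p := ContDiffAt.comp (g := fun v => (f v).2) p hP hg
    rw [← h0] at hPg
    refine ContDiffAt.comp (f := hs.localInverse _ _ _) (g := fun q => (f (q, u q)).2)
      (f (p, u p)).1 ?_ hi
    exact hPg
  · filter_upwards [hs.eventually_left_inverse] with q hq
    rw [hq]

end

/-! ### The equation as a condition on jets, and planes transversal to the projection -/

section

variable {n : ℕ}

/-- The invariance of the equation under the second prolongation of a point transformation, in terms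
of the second-order jet `(Y₁, P₁, Y₂, P₂)` of the transformation at a point. -/
def JetCondition (Y₁ : Vars n →L[ℝ] Base n) (P₁ : Vars n →L[ℝ] ℂ)
    (Y₂ : Vars n →L[ℝ] Vars n →L[ℝ] Base n) (P₂ : Vars n →L[ℝ] Vars n →L[ℝ] ℂ) (k k' : ℂ) : Prop :=
  ∀ (ℓ : Base n →L[ℝ] ℂ) (B : Base n ≃L[ℝ] Base n), (∀ w, Y₁ (w, ℓ w) = B w) →
    ∀ Q : Base n →L[ℝ] Base n →L[ℝ] ℂ, (∀ w z, Q w z = Q z w) →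
    (Complex.I * ℓ et + ∑ a, Q (ex a) (ex a) + k = 0 ↔
      Complex.I * P₁ (B.symm et, ℓ (B.symm et))
        + ∑ a, (P₁ (0, Q (B.symm (ex a)) (B.symm (ex a)))
            - P₁ (B.symm (Y₁ (0, Q (B.symm (ex a)) (B.symm (ex a)))),
                ℓ (B.symm (Y₁ (0, Q (B.symm (ex a)) (B.symm (ex a))))))
          + (P₂ (B.symm (ex a), ℓ (B.symm (ex a))) (B.symm (ex a), ℓ (B.symm (ex a)))
            - P₁ (B.symm (Y₂ (B.symm (ex a), ℓ (B.symm (ex a))) (B.symm (ex a), ℓ (B.symm (ex a)))),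
              ℓ (B.symm (Y₂ (B.symm (ex a), ℓ (B.symm (ex a)))
                (B.symm (ex a), ℓ (B.symm (ex a))))))))
        + k' = 0)

theorem IsAdmissible.contDiffAt {S S' : ArbitraryElement n}
    {φ : OpenPartialHomeomorph (Vars n) (Vars n)} (h : IsAdmissible S φ S') {v : Vars n}
    (hv : v ∈ φ.source) : ContDiffAt ℝ ∞ φ v :=
  (h.pointTransformation.smooth v hv).contDiffAt (φ.open_source.mem_nhds hv)

/-- The quadratic polynomial with jet `(c, ℓ, Q)` is a legitimate test function, and transversality
supplies its image u'. The prolongation formulas, solved for the derivatives of u' by means of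
`B.symm`, rewrite the two equations in terms of the jets alone. -/
theorem IsAdmissible.jetCondition {S S' : ArbitraryElement n}
    {φ : OpenPartialHomeomorph (Vars n) (Vars n)} (h : IsAdmissible S φ S') {v : Vars n}
    (hv : v ∈ φ.source) :
    JetCondition (fderiv ℝ (fun v => (φ v).1) v) (fderiv ℝ (fun v => (φ v).2) v)
      (D2 (fun v => (φ v).1) v) (D2 (fun v => (φ v).2) v)
      (S.val (modPoint v) * v.2) (S'.val (modPoint (φ v)) * (φ v).2) := by
  intro ℓ B hB Q hQ
  obtain ⟨p, c⟩ := v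
  set u := jetFun p c ℓ Q with hu
  have huc : ∀ q, ContDiffAt ℝ ∞ u q := fun q => (contDiff_jetFun p c ℓ Q).contDiffAt
  have hup : u p = c := jetFun_self p c ℓ Q
  have hdu : fderiv ℝ u p = ℓ := by rw [hu, fderiv_jetFun p c ℓ Q hQ]; simp
  have hd2u : D2 u p = Q := D2_jetFun p c ℓ Q hQ p
  have hφ : ContDiffAt ℝ ∞ φ (p, u p) := by rw [hup]; exact h.contDiffAt hv
  obtain ⟨u', hu', hm⟩ := exists_mapsGraph hφ (huc p) B (by rw [hup, hdu]; exact hB)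
  have key := h.maps_equation u u' p (by rwa [hup]) (huc p) hu' hm
  have e1 := MapsGraph.fderiv_eq hφ (huc p) hu' hm
  have e2 := MapsGraph.D2_eq hφ (huc p) hu' hm
  have e0 : (φ (p, u p)).2 = u' (φ (p, u p)).1 := hm.self_of_nhds
  unfold SolvesAt at key
  simp only [dx_dx_eq _ (huc p), dx_dx_eq _ hu', dt_eq] at key
  rw [← e0] at key
  rw [hup] at key e1 e2
  rw [hdu] at key e1 e2
  rw [hd2u] at key e2
  have f1 : ∀ w, fderiv ℝ u' (φ (p, c)).1 w
      = fderiv ℝ (fun v => (φ v).2) (p, c) (B.symm w, ℓ (B.symm w)) := by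
    intro w
    rw [← e1, hB, B.apply_symm_apply]
  have f2 : ∀ w, D2 u' (φ (p, c)).1 w w = fderiv ℝ (fun v => (φ v).2) (p, c)
        (0, Q (B.symm w) (B.symm w))
      - fderiv ℝ u' (φ (p, c)).1 (fderiv ℝ (fun v => (φ v).1) (p, c) (0, Q (B.symm w) (B.symm w)))
      + (D2 (fun v => (φ v).2) (p, c) (B.symm w, ℓ (B.symm w)) (B.symm w, ℓ (B.symm w))
        - fderiv ℝ u' (φ (p, c)).1
          (D2 (fun v => (φ v).1) (p, c) (B.symm w, ℓ (B.symm w)) (B.symm w, ℓ (B.symm w)))) := by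
    intro w
    have := e2 (B.symm w) (B.symm w)
    rw [hB, B.apply_symm_apply, map_add] at this
    linear_combination this
  simp only [f2] at key
  simp only [f1] at key
  exact key

theorem IsAdmissible.fderiv_fst {S S' : ArbitraryElement n}
    {φ : OpenPartialHomeomorph (Vars n) (Vars n)} (h : IsAdmissible S φ S') {v : Vars n}
    (hv : v ∈ φ.source) (z : Vars n) :
    fderiv ℝ (fun v => (φ v).1) v z = (fderiv ℝ φ v z).1 := by
  rw [fderiv.fst (diffAt (h.contDiffAt hv))]; rfl

theorem IsAdmissible.fderiv_snd {S S' : ArbitraryElement n}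
    {φ : OpenPartialHomeomorph (Vars n) (Vars n)} (h : IsAdmissible S φ S') {v : Vars n}
    (hv : v ∈ φ.source) (z : Vars n) :
    fderiv ℝ (fun v => (φ v).2) v z = (fderiv ℝ φ v z).2 := by
  rw [fderiv.snd (diffAt (h.contDiffAt hv))]; rfl

theorem IsAdmissible.fderiv_injective {S S' : ArbitraryElement n}
    {φ : OpenPartialHomeomorph (Vars n) (Vars n)} (h : IsAdmissible S φ S') {v : Vars n}
    (hv : v ∈ φ.source) : Function.Injective (fderiv ℝ φ v) := by
  have h1 := diffAt (h.contDiffAt hv)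
  have h2 : DifferentiableAt ℝ φ.symm (φ v) :=
    diffAt ((h.pointTransformation.smooth_symm _ (φ.map_source hv)).contDiffAt
      (φ.open_target.mem_nhds (φ.map_source hv)))
  have h3 : HasFDerivAt (fun w => φ.symm (φ w)) ((fderiv ℝ φ.symm (φ v)).comp (fderiv ℝ φ v)) v :=
    h2.hasFDerivAt.comp v h1.hasFDerivAt
  have h4 : HasFDerivAt (fun w => φ.symm (φ w)) (ContinuousLinearMap.id ℝ (Vars n)) v := by
    refine (hasFDerivAt_id v).congr_of_eventuallyEq ?_
    filter_upwards [φ.open_source.mem_nhds hv] with w hw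
    exact φ.left_inv hw
  have h5 := h3.unique h4
  exact Function.LeftInverse.injective (g := fderiv ℝ φ.symm (φ v))
    fun z => congrArg (fun L => L z) h5

/-- A surjective linear map from `E × F` to `E` is bijective on
the graph of some linear map `E → F`. -/
theorem exists_transversal_graph {E F : Type*} [NormedAddCommGroup E] [NormedSpace ℝ E]
    [FiniteDimensional ℝ E] [NormedAddCommGroup F] [NormedSpace ℝ F] (Y : E × F →L[ℝ] E)
    (hY : Function.Surjective Y) :
    ∃ (ℓ : E →L[ℝ] F) (B : E ≃L[ℝ] E), ∀ w, Y (w, ℓ w) = B w := by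
  let A₁ : E →ₗ[ℝ] E := (Y : E × F →ₗ[ℝ] E).comp (LinearMap.inl ℝ E F)
  let A₂ : F →ₗ[ℝ] E := (Y : E × F →ₗ[ℝ] E).comp (LinearMap.inr ℝ E F)
  have hY' : ∀ w c, Y (w, c) = A₁ w + A₂ c := by
    intro w c
    simp only [A₁, A₂, LinearMap.comp_apply, LinearMap.inl_apply, LinearMap.inr_apply]
    change _ = Y _ + Y _
    rw [← map_add]; simp
  let R := LinearMap.range A₁
  let N := LinearMap.ker A₁
  have hs : Function.Surjective (R.mkQ.comp A₂) := by
    intro q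
    obtain ⟨e, rfl⟩ := R.mkQ_surjective q
    obtain ⟨⟨w, c⟩, rfl⟩ := hY e
    refine ⟨c, ?_⟩
    rw [hY', map_add, LinearMap.comp_apply]
    have : R.mkQ (A₁ w) = 0 := by
      simp only [Submodule.mkQ_apply, Submodule.Quotient.mk_eq_zero]
      exact ⟨w, rfl⟩
    rw [this, zero_add]
  obtain ⟨s, hs'⟩ := (R.mkQ.comp A₂).exists_rightInverse_of_surjective (LinearMap.range_eq_top.2 hs)
  have hdim : Module.finrank ℝ N = Module.finrank ℝ (E ⧸ R) := by
    have h1 := A₁.finrank_range_add_finrank_ker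
    have h2 := R.finrank_quotient_add_finrank
    simp only [R, N] at *
    omega
  let iso := LinearEquiv.ofFinrankEq _ _ hdim
  obtain ⟨π, hπ⟩ := N.exists_isCompl
  let pr := N.projectionOnto π hπ
  -- The map ℓ vanishes on a complement of ker A₁ and is chosen on ker A₁ so that A₂ ∘ ℓ fills the
  -- cokernel of A₁. If `B w = 0`, reduction modulo the range kills the ker A₁ part of w, and then
  -- A₁ w = 0 kills the rest.
  let ℓ : E →ₗ[ℝ] F := s.comp ((iso : N →ₗ[ℝ] E ⧸ R).comp pr)
  let B : E →ₗ[ℝ] E := A₁ + A₂.comp ℓ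
  have hinj : Function.Injective B := by
    rw [injective_iff_map_eq_zero]
    intro w hw
    have h1 : R.mkQ (B w) = iso (pr w) := by
      have : R.mkQ (A₁ w) = 0 := by
        simp only [Submodule.mkQ_apply, Submodule.Quotient.mk_eq_zero]
        exact ⟨w, rfl⟩
      have h2 := congrArg (fun L => L (iso (pr w))) hs'
      simp only [LinearMap.comp_apply, LinearMap.id_apply] at h2
      simp only [B, LinearMap.add_apply, map_add, this, zero_add]
      exact h2
    rw [hw, map_zero] at h1
    have h2 : pr w = 0 := by simpa using h1.symm
    have h3 : A₁ w = 0 := by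
      have : B w = A₁ w := by simp [B, ℓ, h2]
      rw [← this, hw]
    have h4 : pr w = ⟨w, h3⟩ := Submodule.projectionOnto_apply_left hπ ⟨w, h3⟩
    rw [h2] at h4
    exact (congrArg Subtype.val h4).symm
  let Be : E ≃ₗ[ℝ] E := LinearEquiv.ofInjectiveEndo B hinj
  refine ⟨LinearMap.toContinuousLinearMap ℓ, Be.toContinuousLinearEquiv, fun w => ?_⟩
  rw [hY']
  simp [Be, B]

/-- The linear form `dt`. -/
def dtForm : Base n →L[ℝ] ℝ := ContinuousLinearMap.fst ℝ ℝ (Fin n → ℝ)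

/-- The linear form `dx_b`. -/
def dxForm (b : Fin n) : Base n →L[ℝ] ℝ :=
  (ContinuousLinearMap.proj b).comp (ContinuousLinearMap.snd ℝ ℝ (Fin n → ℝ))

@[simp] theorem dtForm_apply (w : Base n) : dtForm w = w.1 := rfl
@[simp] theorem dxForm_apply (b : Fin n) (w : Base n) : dxForm b w = w.2 b := rfl

/-- The bilinear form `c α ⊗ β`. -/
def tensorForm (α β : Base n →L[ℝ] ℝ) (c : ℂ) : Base n →L[ℝ] Base n →L[ℝ] ℂ :=
  α.smulRight (β.smulRight c)

@[simp] theorem tensorForm_apply (α β : Base n →L[ℝ] ℝ) (c : ℂ) (w z : Base n) :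
    tensorForm α β c w z = (α w * β z : ℝ) • c := by
  simp [tensorForm, mul_smul, -Complex.real_smul]

end

/-! ### Leading derivatives: the new time involves neither x nor ψ -/

section

variable {n : ℕ}

/-- The first derivatives of the transformed function. -/
def pushForm (P₁ : Vars n →L[ℝ] ℂ) (ℓ : Base n →L[ℝ] ℂ) (B : Base n ≃L[ℝ] Base n) :
    Base n →L[ℝ] ℂ :=
  P₁.comp ((B.symm : Base n →L[ℝ] Base n).prod (ℓ.comp (B.symm : Base n →L[ℝ] Base n)))

/-- The coefficient with which the leading derivatives are transformed. -/
def vertMap (Y₁ : Vars n →L[ℝ] Base n) (P₁ : Vars n →L[ℝ] ℂ) (ℓ : Base n →L[ℝ] ℂ)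
    (B : Base n ≃L[ℝ] Base n) : ℂ →L[ℝ] ℂ :=
  (P₁ - (pushForm P₁ ℓ B).comp Y₁).comp (ContinuousLinearMap.inr ℝ (Base n) ℂ)

section

variable {Y₁ : Vars n →L[ℝ] Base n} {P₁ : Vars n →L[ℝ] ℂ}
  {Y₂ : Vars n →L[ℝ] Vars n →L[ℝ] Base n} {P₂ : Vars n →L[ℝ] Vars n →L[ℝ] ℂ} {k k' : ℂ}
  {ℓ : Base n →L[ℝ] ℂ} {B : Base n ≃L[ℝ] Base n}

theorem pushForm_apply (w : Base n) : pushForm P₁ ℓ B w = P₁ (B.symm w, ℓ (B.symm w)) := rfl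

theorem vertMap_apply (c : ℂ) :
    vertMap Y₁ P₁ ℓ B c = P₁ (0, c) - pushForm P₁ ℓ B (Y₁ (0, c)) := rfl

theorem JetCondition.iff (hJ : JetCondition Y₁ P₁ Y₂ P₂ k k') (hB : ∀ w, Y₁ (w, ℓ w) = B w)
    (Q : Base n →L[ℝ] Base n →L[ℝ] ℂ) (hQ : ∀ w z, Q w z = Q z w) :
    Complex.I * ℓ et + ∑ a, Q (ex a) (ex a) + k = 0 ↔
      Complex.I * pushForm P₁ ℓ B et
        + ∑ a, (vertMap Y₁ P₁ ℓ B (Q (B.symm (ex a)) (B.symm (ex a)))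
          + (P₂ (B.symm (ex a), ℓ (B.symm (ex a))) (B.symm (ex a), ℓ (B.symm (ex a)))
            - pushForm P₁ ℓ B
              (Y₂ (B.symm (ex a), ℓ (B.symm (ex a))) (B.symm (ex a), ℓ (B.symm (ex a))))))
        + k' = 0 := hJ ℓ B hB Q hQ

/-- If the symbol kills c, then `(0, c)` and the vector of the transversal plane over `B.symm (Y₁
(0, c))` have the same image under the injective pair of derivatives. So they coincide, the base
part is zero, and c = ℓ 0 = 0. -/
theorem vertMap_eq_zero (hinj : ∀ z, Y₁ z = 0 → P₁ z = 0 → z = 0)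
    (hB : ∀ w, Y₁ (w, ℓ w) = B w) {c : ℂ} (hc : vertMap Y₁ P₁ ℓ B c = 0) : c = 0 := by
  rw [vertMap_apply, pushForm_apply] at hc
  set w := B.symm (Y₁ (0, c)) with hw
  have h1 : Y₁ (w, ℓ w) = Y₁ (0, c) := by rw [hB, hw, B.apply_symm_apply]
  have h := hinj ((0, c) - (w, ℓ w)) (by rw [map_sub, h1, sub_self]) (by rw [map_sub, hc])
  rw [sub_eq_zero] at h
  have h2 := congrArg Prod.fst h
  have h3 := congrArg Prod.snd h
  simp only at h2 h3
  rw [h3, ← h2, map_zero]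

theorem sum_tensorForm_dx (b : Fin n) (c : ℂ) :
    ∑ a, tensorForm (dxForm b) (dxForm b) c (ex a) (ex a) = c := by
  simp [ex, Pi.single_apply]

/-- Adding a trace-free R to the Hessian leaves the source equation satisfied and changes the target
equation by exactly this sum. -/
theorem JetCondition.sum_vertMap_eq_zero (hn : 1 ≤ n) (hJ : JetCondition Y₁ P₁ Y₂ P₂ k k')
    (hB : ∀ w, Y₁ (w, ℓ w) = B w) (R : Base n →L[ℝ] Base n →L[ℝ] ℂ)
    (hR : ∀ w z, R w z = R z w) (h0 : ∑ a, R (ex a) (ex a) = 0) :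
    ∑ a, vertMap Y₁ P₁ ℓ B (R (B.symm (ex a)) (B.symm (ex a))) = 0 := by
  let b : Fin n := ⟨0, hn⟩
  -- A reference jet on the source equation over the given ℓ: the single entry ψ_bb balances all
  -- other terms. At least one spatial variable is needed for this.
  let Q := tensorForm (dxForm b) (dxForm b) (-(Complex.I * ℓ et + k))
  have hQ : ∀ w z, Q w z = Q z w := fun w z => by simp [Q, mul_comm]
  have e1 := (hJ.iff hB Q hQ).1 (by rw [sum_tensorForm_dx]; ring)
  have e2 := (hJ.iff hB (Q + R) (fun w z => by
    rw [add_apply, add_apply, add_apply, add_apply, hQ, hR])).1 (by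
      simp only [add_apply, Finset.sum_add_distrib, h0]
      rw [sum_tensorForm_dx]; ring)
  simp only [add_apply, map_add, Finset.sum_add_distrib] at e1 e2 ⊢
  linear_combination e2 - e1

/-- The form dt⊗dt has no spatial trace. Its transform contributes the sum of squares of the numbers
in question times `vertMap 1`, which is nonzero. -/
theorem JetCondition.symm_ex_fst (hn : 1 ≤ n) (hJ : JetCondition Y₁ P₁ Y₂ P₂ k k')
    (hinj : ∀ z, Y₁ z = 0 → P₁ z = 0 → z = 0)
    (hB : ∀ w, Y₁ (w, ℓ w) = B w) (a : Fin n) : (B.symm (ex a)).1 = 0 := by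
  have h := hJ.sum_vertMap_eq_zero hn hB (tensorForm dtForm dtForm 1)
    (fun w z => by simp [mul_comm]) (by simp [ex])
  simp only [tensorForm_apply, map_smul, ← Finset.sum_smul, dtForm_apply] at h
  rcases smul_eq_zero.1 h with h | h
  · have := (Finset.sum_eq_zero_iff_of_nonneg (fun a _ => mul_self_nonneg _)).1 h a
      (Finset.mem_univ a)
    exact mul_self_eq_zero.1 this
  · exact absurd (vertMap_eq_zero hinj hB h) one_ne_zero

theorem JetCondition.symm_fst (hn : 1 ≤ n) (hJ : JetCondition Y₁ P₁ Y₂ P₂ k k')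
    (hinj : ∀ z, Y₁ z = 0 → P₁ z = 0 → z = 0)
    (hB : ∀ w, Y₁ (w, ℓ w) = B w) {w : Base n} (hw : w.1 = 0) : (B.symm w).1 = 0 := by
  rw [base_eq_sum w, hw]
  simp [Prod.fst_sum, hJ.symm_ex_fst hn hinj hB]

/-- The inverse of B maps the hyperplane dt = 0 into itself injectively, hence onto itself by
dimension, so B preserves it too. -/
theorem JetCondition.equiv_fst (hn : 1 ≤ n) (hJ : JetCondition Y₁ P₁ Y₂ P₂ k k')
    (hinj : ∀ z, Y₁ z = 0 → P₁ z = 0 → z = 0)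
    (hB : ∀ w, Y₁ (w, ℓ w) = B w) {w : Base n} (hw : w.1 = 0) : (B w).1 = 0 := by
  let H : Submodule ℝ (Base n) := LinearMap.ker (dtForm : Base n →L[ℝ] ℝ).toLinearMap
  have hH : ∀ z, z ∈ H ↔ z.1 = 0 := fun z => Iff.rfl
  let N : H →ₗ[ℝ] H := (B.symm.toLinearEquiv : Base n →ₗ[ℝ] Base n).restrict
    (p := H) (q := H) fun z hz => hJ.symm_fst hn hinj hB hz
  have hNinj : Function.Injective N := by
    intro z z' h
    exact Subtype.ext (B.symm.injective (congrArg Subtype.val h))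
  obtain ⟨z, hz⟩ := (LinearMap.injective_iff_surjective.1 hNinj) ⟨w, hw⟩
  have h1 : B.symm z.1 = w := congrArg Subtype.val hz
  rw [← h1, B.apply_symm_apply]
  exact z.2

/-- Small perturbations of a transversal plane are transversal. -/
theorem eventually_transversal (hB : ∀ w, Y₁ (w, ℓ w) = B w) (m : Base n →L[ℝ] ℂ) :
    ∀ᶠ s : ℝ in 𝓝 0, ∃ B' : Base n ≃L[ℝ] Base n, ∀ w, Y₁ (w, (ℓ + s • m) w) = B' w := by
  let L : Base n →L[ℝ] Base n := Y₁.comp ((ContinuousLinearMap.inr ℝ (Base n) ℂ).comp m)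
  have hc : Filter.Tendsto (fun s : ℝ => (B : Base n →L[ℝ] Base n) + s • L) (𝓝 0)
      (𝓝 (B : Base n →L[ℝ] Base n)) := by
    have : Continuous (fun s : ℝ => (B : Base n →L[ℝ] Base n) + s • L) := by fun_prop
    simpa using this.tendsto 0
  filter_upwards [hc.eventually (ContinuousLinearEquiv.nhds B)] with s hs
  obtain ⟨B', hB'⟩ := hs
  refine ⟨B', fun w => ?_⟩
  have h := congrArg (fun L => L w) hB'
  simp only [ContinuousLinearEquiv.coe_coe, add_apply, smul_apply] at h
  rw [h, ← hB]
  simp only [L, ContinuousLinearMap.comp_apply, ContinuousLinearMap.inr_apply, add_apply,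
    smul_apply, ← map_smul, ← map_add, Prod.smul_mk, Prod.mk_add_mk, smul_zero, add_zero]

/-- A property of all transversal planes that is affine in the plane does not depend on it. -/
theorem JetCondition.fst_eq_zero (hn : 1 ≤ n) (hJ : JetCondition Y₁ P₁ Y₂ P₂ k k')
    (hinj : ∀ z, Y₁ z = 0 → P₁ z = 0 → z = 0) (hsurj : Function.Surjective Y₁)
    (w : Base n) (hw : w.1 = 0) (c : ℂ) : (Y₁ (w, c)).1 = 0 := by
  obtain ⟨ℓ, B, hB⟩ := exists_transversal_graph Y₁ hsurj
  have h0 : ∀ w : Base n, w.1 = 0 → (Y₁ (w, ℓ w)).1 = 0 := fun w hw => by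
    rw [hB]; exact hJ.equiv_fst hn hinj hB hw
  have h1 : ∀ c : ℂ, (Y₁ (0, c)).1 = 0 := by
    intro c
    let b : Fin n := ⟨0, hn⟩
    -- For small s ≠ 0 the plane of ℓ + s c dx_b is still transversal. The time component vanishes
    -- on the lifts of `ex b` to both planes, and these lifts differ by `s • (0, c)`.
    have h := eventually_transversal hB ((dxForm b).smulRight c)
    have h2 : ∀ᶠ s : ℝ in 𝓝[≠] 0, s ≠ 0 := eventually_mem_nhdsWithin
    obtain ⟨s, ⟨B', hB'⟩, hs⟩ := ((h.filter_mono nhdsWithin_le_nhds).and h2).exists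
    have e1 : (Y₁ (ex b, (ℓ + s • (dxForm b).smulRight c) (ex b))).1 = 0 := by
      rw [hB']; exact hJ.equiv_fst hn hinj hB' (by simp [ex])
    have e2 := h0 (ex b) (by simp [ex])
    have e3 : ((ex b, (ℓ + s • (dxForm b).smulRight c) (ex b)) : Vars n)
        = (ex b, ℓ (ex b)) + s • (0, c) := by
      ext <;> simp [ex]
    rw [e3, map_add, map_smul, Prod.fst_add, e2, Prod.smul_fst, zero_add, smul_eq_mul] at e1
    exact (mul_eq_zero.1 e1).resolve_left hs
  have e : ((w, c) : Vars n) = (w, ℓ w) + (0, c - ℓ w) := by ext <;> simp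
  rw [e, map_add, Prod.fst_add, h0 w hw, h1, add_zero]

end

end

/-! ### Conformality of the spatial Jacobian and independence of the new x from ψ -/

section

variable {n : ℕ}

/-- The form `ℓ + z dt`. -/
def shearForm (ℓ : Base n →L[ℝ] ℂ) (z : ℂ) : Base n →L[ℝ] ℂ := ℓ + dtForm.smulRight z

theorem shearForm_apply (ℓ : Base n →L[ℝ] ℂ) (z : ℂ) (w : Base n) :
    shearForm ℓ z w = ℓ w + w.1 • z := rfl

section

variable {Y₁ : Vars n →L[ℝ] Base n} {P₁ : Vars n →L[ℝ] ℂ}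
  {Y₂ : Vars n →L[ℝ] Vars n →L[ℝ] Base n} {P₂ : Vars n →L[ℝ] Vars n →L[ℝ] ℂ} {k k' : ℂ}
  {ℓ : Base n →L[ℝ] ℂ} {B : Base n ≃L[ℝ] Base n}

theorem fst_apply_eq (hfst : ∀ w : Base n, w.1 = 0 → ∀ c, (Y₁ (w, c)).1 = 0) (w : Base n) (c : ℂ) :
    (Y₁ (w, c)).1 = w.1 * (Y₁ (et, 0)).1 := by
  have e : ((w, c) : Vars n) = w.1 • (et, 0) + (w - w.1 • et, c) := by ext <;> simp
  rw [e, map_add, map_smul, Prod.fst_add, hfst _ (by simp [et])]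
  simp [et]

theorem fst_et_ne_zero (hfst : ∀ w : Base n, w.1 = 0 → ∀ c, (Y₁ (w, c)).1 = 0)
    (hsurj : Function.Surjective Y₁) : (Y₁ (et, 0)).1 ≠ 0 := by
  intro h
  obtain ⟨⟨w, c⟩, hw⟩ := hsurj et
  have := fst_apply_eq hfst w c
  rw [hw, h, mul_zero] at this
  simp [et] at this

theorem symm_fst_eq (hfst : ∀ w : Base n, w.1 = 0 → ∀ c, (Y₁ (w, c)).1 = 0)
    (hτ : (Y₁ (et, 0)).1 ≠ 0)
    (hB : ∀ w, Y₁ (w, ℓ w) = B w) (w : Base n) : (B.symm w).1 = w.1 / (Y₁ (et, 0)).1 := by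
  have h := fst_apply_eq hfst (B.symm w) (ℓ (B.symm w))
  rw [hB, B.apply_symm_apply] at h
  rw [h]; field_simp

/-- Changing the `t`-derivative does not affect transversality. -/
theorem exists_shear (hfst : ∀ w : Base n, w.1 = 0 → ∀ c, (Y₁ (w, c)).1 = 0)
    (hτ : (Y₁ (et, 0)).1 ≠ 0) (hB : ∀ w, Y₁ (w, ℓ w) = B w) (z : ℂ) :
    ∃ B' : Base n ≃L[ℝ] Base n, (∀ w, Y₁ (w, (shearForm ℓ z) w) = B' w) ∧
      ∀ w, B'.symm w = B.symm w - (B.symm w).1 • B.symm (Y₁ (0, z)) := by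
  set m := B.symm (Y₁ (0, z)) with hm
  have hm1 : m.1 = 0 := by
    rw [hm, symm_fst_eq hfst hτ hB, hfst 0 rfl, zero_div]
  let F : Base n →L[ℝ] Base n :=
    (B : Base n →L[ℝ] Base n) + dtForm.smulRight (Y₁ (0, z))
  let G : Base n →L[ℝ] Base n :=
    (B.symm : Base n →L[ℝ] Base n) - (dtForm.comp (B.symm : Base n →L[ℝ] Base n)).smulRight m
  have hF : ∀ w, F w = B w + w.1 • Y₁ (0, z) := fun w => rfl
  have hG : ∀ w, G w = B.symm w - (B.symm w).1 • m := fun w => rfl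
  have hBm : B m = Y₁ (0, z) := by rw [hm, B.apply_symm_apply]
  have h1 : Function.LeftInverse G F := by
    intro w
    have : B.symm (F w) = w + w.1 • m := by
      rw [hF, map_add, map_smul, B.symm_apply_apply]
    rw [hG, this, Prod.fst_add, Prod.smul_fst, hm1]; simp
  have h2 : Function.RightInverse G F := by
    intro w
    rw [hF, hG, map_sub, map_smul, hBm, B.apply_symm_apply, Prod.fst_sub, Prod.smul_fst, hm1]; simp
  refine ⟨ContinuousLinearEquiv.equivOfInverse F G h1 h2, fun w => ?_, fun w => hG w⟩
  change _ = F w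
  rw [hF, ← hB, ← map_smul, ← map_add, shearForm_apply]
  simp

/-- The linear part of the jet condition. -/
theorem JetCondition.linear (hn : 1 ≤ n) (hJ : JetCondition Y₁ P₁ Y₂ P₂ k k')
    (hfst : ∀ w : Base n, w.1 = 0 → ∀ c, (Y₁ (w, c)).1 = 0)
    (hτ : (Y₁ (et, 0)).1 ≠ 0)
    (hY₂ : ∀ w w' : Base n, w.1 = 0 → w'.1 = 0 → ∀ c c', (Y₂ (w, c) (w', c')).1 = 0)
    (hB : ∀ w, Y₁ (w, ℓ w) = B w) (z : ℂ)
    (R : Base n →L[ℝ] Base n →L[ℝ] ℂ) (hR : ∀ w z, R w z = R z w)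
    (h0 : Complex.I * z + ∑ a, R (ex a) (ex a) = 0) :
    Complex.I * ((Y₁ (et, 0)).1⁻¹ • vertMap Y₁ P₁ ℓ B z)
      + ∑ a, vertMap Y₁ P₁ ℓ B (R (B.symm (ex a)) (B.symm (ex a))) = 0 := by
  obtain ⟨B', hB', hs⟩ := exists_shear hfst hτ hB z
  let b : Fin n := ⟨0, hn⟩
  let Q := tensorForm (dxForm b) (dxForm b) (-(Complex.I * ℓ et + k))
  have hQ : ∀ w z, Q w z = Q z w := fun w z => by simp [Q, mul_comm]
  have hlet : (shearForm ℓ z) et = ℓ et + z := by simp [shearForm_apply, et]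
  have e1 := (hJ.iff hB Q hQ).1 (by rw [sum_tensorForm_dx]; ring)
  have e2 := (hJ.iff hB' (Q + R) (fun w z => by
    rw [add_apply, add_apply, add_apply, add_apply, hQ, hR])).1 (by
      simp only [add_apply Q R, add_apply (Q _), Finset.sum_add_distrib]
      rw [sum_tensorForm_dx, hlet]; linear_combination h0)
  -- The shear by z dt changes nothing over directions with dt = 0. Hence the symbol and, thanks to
  -- `hY₂`, all quadratic terms are the same for both jets; only the pushed-forward time derivative
  -- changes, by the symbol of z over T_t.
  have hs0 : ∀ w : Base n, w.1 = 0 → B'.symm w = B.symm w := by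
    intro w hw
    rw [hs, symm_fst_eq hfst hτ hB, hw]; simp
  have hl0 : ∀ w : Base n, w.1 = 0 → (shearForm ℓ z) w = ℓ w := by
    intro w hw; simp [shearForm_apply, hw]
  have hN0 : ∀ w : Base n, w.1 = 0 → (B.symm w).1 = 0 := by
    intro w hw; rw [symm_fst_eq hfst hτ hB, hw, zero_div]
  have hpush : ∀ w : Base n, w.1 = 0 →
      pushForm P₁ (shearForm ℓ z) B' w = pushForm P₁ ℓ B w := by
    intro w hw
    rw [pushForm_apply, pushForm_apply, hs0 w hw, hl0 _ (hN0 w hw)]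
  have hvert : ∀ c, vertMap Y₁ P₁ (shearForm ℓ z) B' c = vertMap Y₁ P₁ ℓ B c := by
    intro c
    rw [vertMap_apply, vertMap_apply, hpush _ (hfst 0 rfl c)]
  have hex : ∀ a : Fin n, (ex a : Base n).1 = 0 := fun a => rfl
  have hpt : ∀ w, pushForm P₁ (shearForm ℓ z) B' w
      = pushForm P₁ ℓ B w + (w.1 * (Y₁ (et, 0)).1⁻¹) • vertMap Y₁ P₁ ℓ B z := by
    intro w
    have h1 : (B.symm w).1 = w.1 * (Y₁ (et, 0)).1⁻¹ := symm_fst_eq hfst hτ hB w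
    have h2 : (B.symm (Y₁ (0, z))).1 = 0 := hN0 _ (hfst 0 rfl z)
    rw [vertMap_apply, pushForm_apply, pushForm_apply, pushForm_apply, ← h1, ← map_sub, ← map_smul,
      ← map_add, hs]
    congr 1
    rw [shearForm_apply]
    ext
    · simp; ring
    · simp; ring
    · simp [h2]; ring
  have hK : ∀ a, pushForm P₁ (shearForm ℓ z) B'
        (Y₂ (B.symm (ex a), ℓ (B.symm (ex a))) (B.symm (ex a), ℓ (B.symm (ex a))))
      = pushForm P₁ ℓ B
        (Y₂ (B.symm (ex a), ℓ (B.symm (ex a))) (B.symm (ex a), ℓ (B.symm (ex a)))) := fun a =>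
    hpush _ (hY₂ _ _ (hN0 _ (hex a)) (hN0 _ (hex a)) _ _)
  simp only [hs0 _ (hex _), hl0 _ (hN0 _ (hex _)), hvert, hK, hpt et] at e2
  simp only [add_apply, map_add, Finset.sum_add_distrib] at e1 e2 ⊢
  have : (et : Base n).1 = 1 := rfl
  rw [this, one_mul] at e2
  linear_combination e2 - e1

/-- A change of ψ_t by z is compensated in the source equation by a change of ψ_bb by −iz; the
target equation must be compensated as well. -/
theorem JetCondition.commute_aux (hn : 1 ≤ n) (hJ : JetCondition Y₁ P₁ Y₂ P₂ k k')
    (hfst : ∀ w : Base n, w.1 = 0 → ∀ c, (Y₁ (w, c)).1 = 0)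
    (hτ : (Y₁ (et, 0)).1 ≠ 0)
    (hY₂ : ∀ w w' : Base n, w.1 = 0 → w'.1 = 0 → ∀ c c', (Y₂ (w, c) (w', c')).1 = 0)
    (hB : ∀ w, Y₁ (w, ℓ w) = B w) (b : Fin n) (z : ℂ) :
    Complex.I * vertMap Y₁ P₁ ℓ B z
      = ((Y₁ (et, 0)).1 * ∑ a, (B.symm (ex a)).2 b * (B.symm (ex a)).2 b)
        • vertMap Y₁ P₁ ℓ B (Complex.I * z) := by
  have h := hJ.linear hn hfst hτ hY₂ hB z (tensorForm (dxForm b) (dxForm b) (-(Complex.I * z)))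
    (fun w z => by simp [mul_comm]) (by rw [sum_tensorForm_dx]; ring)
  simp only [tensorForm_apply, map_smul, dxForm_apply, map_neg, smul_neg] at h
  rw [Finset.sum_neg_distrib, ← Finset.sum_smul] at h
  rw [mul_smul, ← sub_eq_zero]
  have h2 : Complex.I * vertMap Y₁ P₁ ℓ B z - (Y₁ (et, 0)).1 •
        (∑ a, (B.symm (ex a)).2 b * (B.symm (ex a)).2 b) • vertMap Y₁ P₁ ℓ B (Complex.I * z)
      = (Y₁ (et, 0)).1 • (Complex.I * ((Y₁ (et, 0)).1⁻¹ • vertMap Y₁ P₁ ℓ B z)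
        + -((∑ a, (B.symm (ex a)).2 b * (B.symm (ex a)).2 b)
          • vertMap Y₁ P₁ ℓ B (Complex.I * z))) := by
    rw [smul_add, mul_smul_comm, smul_inv_smul₀ hτ, smul_neg, sub_eq_add_neg]
  rw [h2, h, smul_zero]

/-- Applying the relation twice, to 1 and then to i, gives −A 1 = −(τs)² A 1. Thus τs = ±1, and s ≥
0 makes the sign that of τ. -/
theorem eq_sign_of_commute {A : ℂ →L[ℝ] ℂ} (hA : ∀ c, A c = 0 → c = 0) {τ s : ℝ} (hs : 0 ≤ s)
    (h : ∀ z, Complex.I * A z = (τ * s) • A (Complex.I * z)) :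
    s = |τ|⁻¹ ∧ τ * s = Real.sign τ := by
  have h1 : (1 - (τ * s) ^ 2) • A 1 = 0 := by
    have e1 := h 1
    have e2 := h (Complex.I * 1)
    rw [← mul_assoc, Complex.I_mul_I, neg_one_mul, map_neg] at e2
    have e3 : Complex.I * (Complex.I * A 1) = -A 1 := by
      rw [← mul_assoc, Complex.I_mul_I, neg_one_mul]
    rw [e1, mul_smul_comm, e2] at e3
    simp only [Complex.real_smul] at e3 ⊢
    push_cast at e3 ⊢
    linear_combination e3
  have h2 : (τ * s) ^ 2 = 1 := by
    rcases smul_eq_zero.1 h1 with h1 | h1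
    · linarith
    · exact absurd (hA 1 h1) one_ne_zero
  have hτ : τ ≠ 0 := by rintro rfl; norm_num at h2
  have h3 : |τ| * s = 1 := by
    have : (|τ| * s) ^ 2 = 1 := by rw [mul_pow, sq_abs, ← mul_pow, h2]
    nlinarith [mul_nonneg (abs_nonneg τ) hs]
  have h4 : s = |τ|⁻¹ := eq_inv_of_mul_eq_one_right h3
  refine ⟨h4, ?_⟩
  rcases lt_or_gt_of_ne hτ with h | h
  · rw [Real.sign_of_neg h, h4, abs_of_neg h]; field_simp
  · rw [Real.sign_of_pos h, h4, abs_of_pos h]; field_simp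

/-- Diagonal entries come from trading ψ_t against ψ_bb. Off-diagonal ones come from the trace-free
form dx_b dx_c + dx_c dx_b, whose transform is a multiple of the nonzero `vertMap 1`. -/
theorem JetCondition.conformal (hn : 1 ≤ n) (hJ : JetCondition Y₁ P₁ Y₂ P₂ k k')
    (hinj : ∀ z, Y₁ z = 0 → P₁ z = 0 → z = 0)
    (hfst : ∀ w : Base n, w.1 = 0 → ∀ c, (Y₁ (w, c)).1 = 0)
    (hτ : (Y₁ (et, 0)).1 ≠ 0)
    (hY₂ : ∀ w w' : Base n, w.1 = 0 → w'.1 = 0 → ∀ c c', (Y₂ (w, c) (w', c')).1 = 0)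
    (hB : ∀ w, Y₁ (w, ℓ w) = B w) :
    (∀ z, Complex.I * vertMap Y₁ P₁ ℓ B z
      = Real.sign (Y₁ (et, 0)).1 • vertMap Y₁ P₁ ℓ B (Complex.I * z)) ∧
    ∀ b c, ∑ a, (B.symm (ex a)).2 b * (B.symm (ex a)).2 c
      = if b = c then |(Y₁ (et, 0)).1|⁻¹ else 0 := by
  have hA : ∀ c, vertMap Y₁ P₁ ℓ B c = 0 → c = 0 := fun c => vertMap_eq_zero hinj hB
  have h := fun b => eq_sign_of_commute hA (Finset.sum_nonneg fun a _ => mul_self_nonneg _)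
    (hJ.commute_aux hn hfst hτ hY₂ hB b)
  refine ⟨fun z => ?_, fun b c => ?_⟩
  · rw [hJ.commute_aux hn hfst hτ hY₂ hB ⟨0, hn⟩, (h _).2]
  · split_ifs with hbc
    · subst hbc; exact (h b).1
    · have := hJ.sum_vertMap_eq_zero hn hB
        (tensorForm (dxForm b) (dxForm c) 1 + tensorForm (dxForm c) (dxForm b) 1)
        (fun w z => by simp only [add_apply, tensorForm_apply, dxForm_apply]; rw [add_comm,
          mul_comm (w.2 c), mul_comm (w.2 b)])
        (by
          simp only [add_apply, tensorForm_apply, dxForm_apply, ← add_smul, ← Finset.sum_smul]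
          convert zero_smul ℝ (1 : ℂ)
          refine Finset.sum_eq_zero fun a _ => ?_
          by_cases h1 : b = a
          · have : c ≠ a := fun h => hbc (h1.trans h.symm)
            simp [ex, Pi.single_apply, this]
          · simp [ex, Pi.single_apply, h1])
      simp only [add_apply, tensorForm_apply, dxForm_apply, ← add_smul, map_smul,
        ← Finset.sum_smul] at this
      rcases smul_eq_zero.1 this with h1 | h1
      · have h2 : ∑ a, (B.symm (ex a)).2 b * (B.symm (ex a)).2 c
            = 1 / 2 * ∑ a, ((B.symm (ex a)).2 b * (B.symm (ex a)).2 c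
              + (B.symm (ex a)).2 c * (B.symm (ex a)).2 b) := by
          rw [Finset.mul_sum]
          exact Finset.sum_congr rfl fun a _ => by ring
        rw [h2, h1, mul_zero]
      · exact absurd (hA 1 h1) one_ne_zero

/-- The spatial part of `B` is a conformal matrix. -/
theorem JetCondition.gram (hn : 1 ≤ n) (hJ : JetCondition Y₁ P₁ Y₂ P₂ k k')
    (hinj : ∀ z, Y₁ z = 0 → P₁ z = 0 → z = 0)
    (hfst : ∀ w : Base n, w.1 = 0 → ∀ c, (Y₁ (w, c)).1 = 0)
    (hτ : (Y₁ (et, 0)).1 ≠ 0)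
    (hY₂ : ∀ w w' : Base n, w.1 = 0 → w'.1 = 0 → ∀ c c', (Y₂ (w, c) (w', c')).1 = 0)
    (hB : ∀ w, Y₁ (w, ℓ w) = B w) :
    (∀ a c, ∑ b, (B (ex a)).2 b * (B (ex c)).2 b = if a = c then |(Y₁ (et, 0)).1| else 0) ∧
    ∀ a b, (B.symm (ex b)).2 a = |(Y₁ (et, 0)).1|⁻¹ * (B (ex a)).2 b := by
  set τ := (Y₁ (et, 0)).1
  have hτ' : |τ| ≠ 0 := abs_ne_zero.2 hτ
  -- Since `B.symm` preserves dt = 0, the spatial blocks M of B and N of `B.symm` are inverse to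
  -- each other. With N Nᵀ = |τ|⁻¹ this yields Nᵀ = |τ|⁻¹ M and MᵀM = |τ|.
  let N : Matrix (Fin n) (Fin n) ℝ := Matrix.of fun b a => (B.symm (ex a)).2 b
  let M : Matrix (Fin n) (Fin n) ℝ := Matrix.of fun b a => (B (ex a)).2 b
  have hM : ∀ b a, M b a = (B (ex a)).2 b := fun _ _ => rfl
  have hN : ∀ b a, N b a = (B.symm (ex a)).2 b := fun _ _ => rfl
  have h1 : N * N.transpose = |τ|⁻¹ • (1 : Matrix (Fin n) (Fin n) ℝ) := by
    ext b c
    rw [Matrix.mul_apply]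
    simp only [hN, Matrix.transpose_apply]
    rw [(hJ.conformal hn hinj hfst hτ hY₂ hB).2 b c, Matrix.smul_apply, Matrix.one_apply]
    simp [τ]
  have h2 : M * N = 1 := by
    ext b c
    rw [Matrix.mul_apply]
    have e := congrArg (fun w : Base n => w.2 b) (B.apply_symm_apply (ex c))
    beta_reduce at e
    have e0 : (B.symm (ex c)).1 = 0 := by rw [symm_fst_eq hfst hτ hB]; simp [ex]
    rw [base_eq_sum (B.symm (ex c)), e0, zero_smul, zero_add, map_sum] at e
    simp only [map_smul, Prod.snd_sum, Prod.smul_snd, Finset.sum_apply, Pi.smul_apply,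
      smul_eq_mul] at e
    simp only [hN, hM]
    rw [Matrix.one_apply]
    simp only [ex, Pi.single_apply] at e ⊢
    rw [← e]
    exact Finset.sum_congr rfl fun a _ => mul_comm _ _
  have h3 : N.transpose = |τ|⁻¹ • M := by
    have : M * (N * N.transpose) = N.transpose := by rw [← Matrix.mul_assoc, h2, one_mul]
    rw [← this, h1, Matrix.mul_smul, mul_one]
  have h4 : M = |τ| • N.transpose := by rw [h3, smul_smul, mul_inv_cancel₀ hτ', one_smul]
  have h5 : M.transpose * M = |τ| • (1 : Matrix (Fin n) (Fin n) ℝ) := by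
    rw [h4, Matrix.transpose_smul, Matrix.transpose_transpose, Matrix.smul_mul, Matrix.mul_smul,
      h1, smul_smul, smul_smul, mul_assoc, mul_inv_cancel₀ hτ', mul_one]
  refine ⟨fun a c => ?_, fun a b => ?_⟩
  · have := congrFun (congrFun h5 a) c
    rw [Matrix.mul_apply, Matrix.smul_apply, Matrix.one_apply] at this
    simpa [hM] using this
  · exact congrFun (congrFun h3 b) a

/-- The spatial length of the image of `ex a` is the same, |T_t|^{1/2}, for all transversal planes.
Comparing the planes of ℓ and ℓ ± s c dx_a, the second difference of the squared length is 2s² times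
the squared spatial length of `Y₁ (0, c)`, which therefore vanishes. -/
theorem JetCondition.vertical_eq_zero (hn : 1 ≤ n) (hJ : JetCondition Y₁ P₁ Y₂ P₂ k k')
    (hinj : ∀ z, Y₁ z = 0 → P₁ z = 0 → z = 0) (hsurj : Function.Surjective Y₁)
    (hY₂ : ∀ w w' : Base n, w.1 = 0 → w'.1 = 0 → ∀ c c', (Y₂ (w, c) (w', c')).1 = 0) (c : ℂ) :
    Y₁ (0, c) = 0 := by
  have hfst : ∀ w : Base n, w.1 = 0 → ∀ c, (Y₁ (w, c)).1 = 0 :=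
    fun w hw c => hJ.fst_eq_zero hn hinj hsurj w hw c
  have hτ := fst_et_ne_zero hfst hsurj
  obtain ⟨ℓ, B, hB⟩ := exists_transversal_graph Y₁ hsurj
  let a : Fin n := ⟨0, hn⟩
  have ev := eventually_transversal hB ((dxForm a).smulRight c)
  have ev' : ∀ᶠ s : ℝ in 𝓝 0, ∃ B' : Base n ≃L[ℝ] Base n,
      ∀ w, Y₁ (w, (ℓ + (-s) • (dxForm a).smulRight c) w) = B' w := by
    have : Filter.Tendsto (fun s : ℝ => -s) (𝓝 0) (𝓝 0) := by
      simpa using (continuous_neg (G := ℝ)).tendsto 0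
    exact this.eventually ev
  have h2 : ∀ᶠ s : ℝ in 𝓝[≠] 0, s ≠ 0 := eventually_mem_nhdsWithin
  obtain ⟨s, ⟨⟨B₁, hB₁⟩, ⟨B₂, hB₂⟩⟩, hs⟩ :=
    (((ev.and ev').filter_mono nhdsWithin_le_nhds).and h2).exists
  have key : ∀ (r : ℝ) (B' : Base n ≃L[ℝ] Base n),
      (∀ w, Y₁ (w, (ℓ + r • (dxForm a).smulRight c) w) = B' w) →
      ∑ b, ((B (ex a)).2 b + r * (Y₁ (0, c)).2 b) * ((B (ex a)).2 b + r * (Y₁ (0, c)).2 b)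
        = |(Y₁ (et, 0)).1| := by
    intro r B' hB'
    have h := (hJ.gram hn hinj hfst hτ hY₂ hB').1 a a
    rw [if_pos rfl] at h
    rw [← h]
    refine Finset.sum_congr rfl fun b _ => ?_
    have e3 : ((ex a, (ℓ + r • (dxForm a).smulRight c) (ex a)) : Vars n)
        = (ex a, ℓ (ex a)) + r • (0, c) := by
      ext <;> simp [ex]
    have e4 : (B' (ex a)).2 b = (B (ex a)).2 b + r * (Y₁ (0, c)).2 b := by
      rw [← hB', e3, map_add, map_smul, hB]; simp
    rw [e4]
  have k0 := (hJ.gram hn hinj hfst hτ hY₂ hB).1 a a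
  rw [if_pos rfl] at k0
  have k1 := key s B₁ hB₁
  have k2 := key (-s) B₂ hB₂
  have k3 : ∑ b, ((Y₁ (0, c)).2 b * (Y₁ (0, c)).2 b) * (2 * s ^ 2) = 0 := by
    have : ∑ b, ((Y₁ (0, c)).2 b * (Y₁ (0, c)).2 b) * (2 * s ^ 2)
        = ∑ b, ((B (ex a)).2 b + s * (Y₁ (0, c)).2 b) * ((B (ex a)).2 b + s * (Y₁ (0, c)).2 b)
          + ∑ b, ((B (ex a)).2 b + (-s) * (Y₁ (0, c)).2 b)
            * ((B (ex a)).2 b + (-s) * (Y₁ (0, c)).2 b)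
          - (∑ b, (B (ex a)).2 b * (B (ex a)).2 b + ∑ b, (B (ex a)).2 b * (B (ex a)).2 b) := by
      rw [← Finset.sum_add_distrib, ← Finset.sum_add_distrib, ← Finset.sum_sub_distrib]
      exact Finset.sum_congr rfl fun b _ => by ring
    rw [this, k0, k1, k2]; ring
  rw [← Finset.sum_mul] at k3
  have k4 := (mul_eq_zero.1 k3).resolve_right (by positivity)
  refine Prod.ext (hfst 0 rfl c) (funext fun b => ?_)
  exact mul_self_eq_zero.1 ((Finset.sum_eq_zero_iff_of_nonneg
    (fun b _ => mul_self_nonneg _)).1 k4 b (Finset.mem_univ b))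

end

end

/-! ### Lower-order terms: powers of ψ_a -/

section

variable {n : ℕ}

section

variable {Y₁ : Vars n →L[ℝ] Base n} {P₁ : Vars n →L[ℝ] ℂ}
  {Y₂ : Vars n →L[ℝ] Vars n →L[ℝ] Base n} {P₂ : Vars n →L[ℝ] Vars n →L[ℝ] ℂ} {k k' : ℂ}

theorem exists_base_equiv (hsurj : Function.Surjective Y₁) (hv : ∀ c, Y₁ (0, c) = 0) :
    ∃ B : Base n ≃L[ℝ] Base n, ∀ w c, Y₁ (w, c) = B w := by
  have h : ∀ w c c', Y₁ (w, c) = Y₁ (w, c') := by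
    intro w c c'
    have : ((w, c) : Vars n) = (w, c') + (0, c - c') := by ext <;> simp
    rw [this, map_add, hv, add_zero]
  obtain ⟨ℓ, B, hB⟩ := exists_transversal_graph Y₁ hsurj
  exact ⟨B, fun w c => by rw [← hB]; exact h _ _ _⟩

theorem vertMap_of_vertical {ℓ : Base n →L[ℝ] ℂ} {B : Base n ≃L[ℝ] Base n}
    (hv : ∀ c, Y₁ (0, c) = 0) (c : ℂ) : vertMap Y₁ P₁ ℓ B c = P₁ (0, c) := by
  rw [vertMap_apply, hv, map_zero, sub_zero]

theorem eq_zero_of_quadratic {c₀ c₁ c₂ : ℂ}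
    (h : ∀ s : ℝ, c₀ + s • c₁ + (s * s) • c₂ = 0) : c₁ = 0 ∧ c₂ = 0 := by
  have h0 := h 0
  have h1 := h 1
  have h2 := h (-1)
  simp only [Complex.real_smul] at h0 h1 h2
  push_cast at h0 h1 h2
  have h3 : c₀ = 0 := by linear_combination h0
  subst h3
  constructor
  · linear_combination (h1 - h2) / 2
  · linear_combination (h1 + h2) / 2

/-- The coefficients of the jet condition at the first and second powers of `ψ_a`. -/
theorem JetCondition.coefficients (hn : 1 ≤ n) (hJ : JetCondition Y₁ P₁ Y₂ P₂ k k')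
    (hinj : ∀ z, Y₁ z = 0 → P₁ z = 0 → z = 0) (hsurj : Function.Surjective Y₁)
    (hfst : ∀ w : Base n, w.1 = 0 → ∀ c, (Y₁ (w, c)).1 = 0)
    (hv : ∀ c, Y₁ (0, c) = 0)
    (hY₂ : ∀ w w' : Base n, w.1 = 0 → w'.1 = 0 → ∀ c c', Y₂ (w, c) (w', c') = 0)
    (hP₂ : ∀ z z', P₂ z z' = P₂ z' z) (a : Fin n) (c : ℂ) :
    2 * P₂ (ex a, 0) (0, c)
      = Complex.I / ((Y₁ (et, 0)).1 : ℂ)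
        * ((∑ b, (Y₁ (ex a, 0)).2 b * (Y₁ (et, 0)).2 b : ℝ) : ℂ) * P₁ (0, c) ∧
    P₂ (0, c) (0, c) = 0 := by
  have hτ := fst_et_ne_zero hfst hsurj
  obtain ⟨B, hB⟩ := exists_base_equiv hsurj hv
  have hY₂' : ∀ w w' : Base n, w.1 = 0 → w'.1 = 0 → ∀ c c', (Y₂ (w, c) (w', c')).1 = 0 :=
    fun w w' hw hw' c c' => by rw [hY₂ w w' hw hw']; rfl
  have hB0 : ∀ w, Y₁ (w, (0 : Base n →L[ℝ] ℂ) w) = B w := fun w => hB w _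
  obtain ⟨g1, g2⟩ := hJ.gram hn hinj hfst hτ hY₂' hB0
  have g3 := (hJ.conformal hn hinj hfst hτ hY₂' hB0).2
  set τ := (Y₁ (et, 0)).1 with hτdef
  have hN0 : ∀ d : Fin n, (B.symm (ex d)).1 = 0 := fun d => by
    rw [symm_fst_eq hfst hτ hB0]; simp [ex]
  let b₀ : Fin n := ⟨0, hn⟩
  -- For ℓ = s c dx_a one has ℓ(`et`) = 0, so the same Q puts the jet on the source equation for
  -- every s. As B no longer depends on ℓ, the target equation is a polynomial of degree two in s,
  -- and its coefficients of s and s² vanish.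
  let Q := tensorForm (dxForm b₀) (dxForm b₀) (-k)
  have hQ : ∀ w z, Q w z = Q z w := fun w z => by simp [Q, mul_comm]
  have key : ∀ s : ℝ, (Complex.I * P₁ (B.symm et, 0)
        + ∑ d, (P₁ (0, Q (B.symm (ex d)) (B.symm (ex d)))
          + P₂ (B.symm (ex d), 0) (B.symm (ex d), 0)) + k')
      + s • (Complex.I * ((B.symm et).2 a • P₁ (0, c))
        + ∑ d, (2 * (B.symm (ex d)).2 a) • P₂ (B.symm (ex d), 0) (0, c))
      + (s * s) • ∑ d, ((B.symm (ex d)).2 a * (B.symm (ex d)).2 a) • P₂ (0, c) (0, c) = 0 := by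
    intro s
    let ℓ : Base n →L[ℝ] ℂ := (dxForm a).smulRight (s • c)
    have hℓ : ∀ w, ((w, ℓ w) : Vars n) = (w, 0) + (s * w.2 a) • (0, c) := by
      intro w
      refine Prod.ext ?_ ?_
      · simp
      · simp [ℓ]; ring
    have hlet : ℓ et = 0 := by simp [ℓ, et]
    have h := (hJ.iff (ℓ := ℓ) (B := B) (fun w => hB w _) Q hQ).1 (by
      rw [sum_tensorForm_dx, hlet]; ring)
    simp only [vertMap_of_vertical hv, hY₂ _ _ (hN0 _) (hN0 _), map_zero, sub_zero,
      pushForm_apply] at h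
    have hd : ∀ d, P₂ (B.symm (ex d), ℓ (B.symm (ex d))) (B.symm (ex d), ℓ (B.symm (ex d)))
        = P₂ (B.symm (ex d), 0) (B.symm (ex d), 0)
          + s • ((2 * (B.symm (ex d)).2 a) • P₂ (B.symm (ex d), 0) (0, c))
          + (s * s) • (((B.symm (ex d)).2 a * (B.symm (ex d)).2 a) • P₂ (0, c) (0, c)) := by
      intro d
      rw [hℓ]
      simp only [map_add, map_smul, add_apply, smul_apply, hP₂ (0, c) (B.symm (ex _), 0)]
      simp only [Complex.real_smul]
      push_cast
      ring
    refine Eq.trans ?_ h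
    simp only [hd]
    rw [hℓ, map_add, map_smul]
    simp only [Finset.sum_add_distrib, ← Finset.smul_sum]
    simp only [Complex.real_smul]
    push_cast
    ring
  obtain ⟨k1, k2⟩ := eq_zero_of_quadratic key
  have hlam : |τ|⁻¹ ≠ 0 := inv_ne_zero (abs_ne_zero.2 hτ)
  constructor
  · have s1 : ∑ d, (2 * (B.symm (ex d)).2 a) • P₂ (B.symm (ex d), 0) (0, c)
        = (2 * |τ|⁻¹) • P₂ (ex a, 0) (0, c) := by
      have e : ∑ d, (2 * (B.symm (ex d)).2 a) • ((B.symm (ex d), 0) : Vars n)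
          = (2 * |τ|⁻¹) • (ex a, 0) := by
        refine Prod.ext (Prod.ext ?_ (funext fun b => ?_)) ?_
        · have hea : (ex a : Base n).1 = 0 := rfl
          simp [Prod.fst_sum, hN0, hea]
        · simp only [Prod.fst_sum, Prod.snd_sum, Finset.sum_apply, Prod.smul_fst, Prod.smul_snd,
            Pi.smul_apply, smul_eq_mul]
          simp only [mul_assoc, ← Finset.mul_sum, g3 a b]
          by_cases hab : a = b
          · subst hab; simp [ex, τ]
          · simp [ex, hab, Ne.symm hab]
        · simp [Prod.snd_sum]
      have := congrArg (fun z => P₂ z (0, c)) e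
      simpa only [map_sum, map_smul, sum_apply, smul_apply] using this
    -- Apply `B.symm` to the expansion of `B et` in the standard basis; on spatial vectors `B.symm`
    -- is the rescaled transpose of B.
    have s2 : (B.symm et).2 a = -(τ⁻¹ * |τ|⁻¹) * ∑ b, (Y₁ (ex a, 0)).2 b * (Y₁ (et, 0)).2 b := by
      have e1 : B et = τ • et + ∑ b, (Y₁ (et, 0)).2 b • ex b := by
        rw [hτdef, hB et 0]; exact base_eq_sum _
      have e2 := congrArg (fun w => (B.symm w).2 a) e1
      beta_reduce at e2
      rw [B.symm_apply_apply, map_add, map_smul, map_sum] at e2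
      simp only [map_smul, Prod.snd_add, Prod.snd_sum, Prod.smul_snd, Finset.sum_apply,
        Pi.add_apply, Pi.smul_apply, smul_eq_mul, g2] at e2
      have e3 : (et : Base n).2 a = 0 := rfl
      rw [e3] at e2
      have e4 : ∑ b, (Y₁ (ex a, 0)).2 b * (Y₁ (et, 0)).2 b
          = |τ| * ∑ b, (Y₁ (et, 0)).2 b * (|τ|⁻¹ * (B (ex a)).2 b) := by
        rw [Finset.mul_sum]
        refine Finset.sum_congr rfl fun b _ => ?_
        rw [hB (ex a)]
        field_simp
      rw [e4]
      generalize ∑ b, (Y₁ (et, 0)).2 b * (|τ|⁻¹ * (B (ex a)).2 b) = W at e2 ⊢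
      have hτ' : |τ| ≠ 0 := abs_ne_zero.2 hτ
      have e5 : (B.symm et).2 a = -W / τ := by
        rw [eq_div_iff hτ]; linarith
      rw [e5]
      field_simp
    rw [s1, s2] at k1
    simp only [Complex.real_smul] at k1
    have hτc : (τ : ℂ) ≠ 0 := by exact_mod_cast hτ
    have hτc' : ((|τ| : ℝ) : ℂ) ≠ 0 := by exact_mod_cast abs_ne_zero.2 hτ
    push_cast at k1 ⊢
    field_simp at k1 ⊢
    linear_combination k1
  · rw [← Finset.sum_smul, g3 a a, if_pos rfl] at k2
    exact (smul_eq_zero.1 k2).resolve_left hlam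

end

end

/-! ### Determining equations on the domain of an admissible transformation -/

section

variable {n : ℕ}

/-- The components for `(t, x)` of a transformation. -/
def baseComp (f : Vars n → Vars n) (v : Vars n) : Base n := (f v).1

/-- The component for `ψ` of a transformation. -/
def psiComp (f : Vars n → Vars n) (v : Vars n) : ℂ := (f v).2

theorem contDiffAt_baseComp {f : Vars n → Vars n} {v : Vars n} (h : ContDiffAt ℝ ∞ f v) :
    ContDiffAt ℝ ∞ (baseComp f) v := contDiffAt_fst.comp v h

theorem contDiffAt_psiComp {f : Vars n → Vars n} {v : Vars n} (h : ContDiffAt ℝ ∞ f v) :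
    ContDiffAt ℝ ∞ (psiComp f) v := contDiffAt_snd.comp v h

/-- The derivative of the new time with respect to the old one. -/
def tau (f : Vars n → Vars n) (v : Vars n) : ℝ := (fderiv ℝ (baseComp f) v (et, 0)).1

/-- The spatial part of the Jacobian matrix. -/
def jac (f : Vars n → Vars n) (v : Vars n) (b a : Fin n) : ℝ :=
  (fderiv ℝ (baseComp f) v (ex a, 0)).2 b

/-- The determining equations for the components `(t, x)` of a transformation. -/
structure BaseDetermined (f : Vars n → Vars n) (v : Vars n) : Prop where
  smooth : ContDiffAt ℝ ∞ f v
  fst_spatial : ∀ w : Base n, w.1 = 0 → ∀ c, (fderiv ℝ (baseComp f) v (w, c)).1 = 0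
  tau_ne : tau f v ≠ 0
  vertical : ∀ c, fderiv ℝ (baseComp f) v (0, c) = 0
  gram : ∀ a c, ∑ b, jac f v b a * jac f v b c = if a = c then |tau f v| else 0

/-- The determining equations for the component `ψ` of a transformation. -/
structure PsiDetermined (f : Vars n → Vars n) (v : Vars n) : Prop where
  commute : ∀ z, Complex.I * fderiv ℝ (psiComp f) v (0, z)
    = Real.sign (tau f v) • fderiv ℝ (psiComp f) v (0, Complex.I * z)
  ne_zero : ∀ c, fderiv ℝ (psiComp f) v (0, c) = 0 → c = 0
  mixed : ∀ a c, 2 * D2 (psiComp f) v (ex a, 0) (0, c)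
    = Complex.I / (tau f v : ℂ)
      * ((∑ b, jac f v b a * (fderiv ℝ (baseComp f) v (et, 0)).2 b : ℝ) : ℂ)
      * fderiv ℝ (psiComp f) v (0, c)
  quad : ∀ c c', D2 (psiComp f) v (0, c) (0, c') = 0

section

variable {E F G : Type*} [NormedAddCommGroup E] [NormedSpace ℝ E] [NormedAddCommGroup F]
  [NormedSpace ℝ F] [NormedAddCommGroup G] [NormedSpace ℝ G]

theorem hasFDerivAt_fderiv_apply {f : E → F} {p : E} (hf : ContDiffAt ℝ ∞ f p) (L : F →L[ℝ] G)
    (w : E) : HasFDerivAt (fun q => L (fderiv ℝ f q w)) (L.comp ((D2 f p).flip w)) p := by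
  have h := (differentiableAt_fderiv hf).hasFDerivAt.clm_apply (hasFDerivAt_const w p)
  have h2 := L.hasFDerivAt.comp p h
  refine h2.congr_fderiv ?_
  ext z
  simp [D2]

/-- A first-order equation that holds near a point may be differentiated. -/
theorem D2_eq_zero_of_eventually {f : E → F} {p : E} (hf : ContDiffAt ℝ ∞ f p) (L : F →L[ℝ] G)
    (w : E) (h : ∀ᶠ q in 𝓝 p, L (fderiv ℝ f q w) = 0) (z : E) : L (D2 f p z w) = 0 := by
  have h1 := hasFDerivAt_fderiv_apply hf L w
  have h2 : HasFDerivAt (fun q => L (fderiv ℝ f q w)) (0 : E →L[ℝ] G) p :=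
    (hasFDerivAt_const (0 : G) p).congr_of_eventuallyEq h
  have := congrArg (fun K => K z) (h1.unique h2)
  simpa using this

end

/-- A matrix with MᵀM = κ ≠ 0 is invertible, so a vector orthogonal to all its columns is zero. -/
theorem eq_zero_of_gram {m : Fin n → Fin n → ℝ} {κ : ℝ} (hκ : κ ≠ 0)
    (hm : ∀ a c, ∑ b, m b a * m b c = if a = c then κ else 0) {y : Fin n → ℝ}
    (hy : ∀ c, ∑ b, y b * m b c = 0) : y = 0 := by
  let M : Matrix (Fin n) (Fin n) ℝ := Matrix.of m
  have h1 : (κ⁻¹ • M.transpose) * M = 1 := by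
    ext a c
    rw [Matrix.smul_mul, Matrix.smul_apply, Matrix.mul_apply, Matrix.one_apply]
    have := hm a c
    simp only [M, Matrix.transpose_apply, Matrix.of_apply, smul_eq_mul] at this ⊢
    rw [this]
    split_ifs
    · exact inv_mul_cancel₀ hκ
    · simp
  have h2 := mul_eq_one_comm.1 h1
  have h3 : Matrix.vecMul y M = 0 := by
    ext c
    simpa [Matrix.vecMul, dotProduct, M] using hy c
  rw [← Matrix.vecMul_one y, ← h2, ← Matrix.vecMul_vecMul, h3, Matrix.zero_vecMul]

theorem BaseDetermined.tau_D2_spatial {f : Vars n → Vars n} {v : Vars n}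
    (h : ∀ᶠ q in 𝓝 v, BaseDetermined f q) (z : Vars n) (w : Base n) (hw : w.1 = 0) (c : ℂ) :
    (D2 (baseComp f) v z (w, c)).1 = 0 :=
  D2_eq_zero_of_eventually (contDiffAt_baseComp h.self_of_nhds.smooth) dtForm (w, c)
    (h.mono fun _ hq => hq.fst_spatial w hw c) z

theorem BaseDetermined.D2_vertical {f : Vars n → Vars n} {v : Vars n}
    (h : ∀ᶠ q in 𝓝 v, BaseDetermined f q) (z : Vars n) (c : ℂ) :
    D2 (baseComp f) v z (0, c) = 0 :=
  D2_eq_zero_of_eventually (contDiffAt_baseComp h.self_of_nhds.smooth)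
    (ContinuousLinearMap.id ℝ (Base n)) (0, c) (h.mono fun _ hq => hq.vertical c) z

theorem hasFDerivAt_jac {f : Vars n → Vars n} {v : Vars n} (hf : ContDiffAt ℝ ∞ f v) (b a : Fin n) :
    HasFDerivAt (fun q => jac f q b a) ((dxForm b).comp ((D2 (baseComp f) v).flip (ex a, 0))) v :=
  hasFDerivAt_fderiv_apply (contDiffAt_baseComp hf) (dxForm b) (ex a, 0)

theorem hasFDerivAt_tau {f : Vars n → Vars n} {v : Vars n} (hf : ContDiffAt ℝ ∞ f v) :
    HasFDerivAt (tau f) (dtForm.comp ((D2 (baseComp f) v).flip (et, 0))) v :=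
  hasFDerivAt_fderiv_apply (contDiffAt_baseComp hf) dtForm (et, 0)

theorem hasFDerivAt_abs_tau {f : Vars n → Vars n} {v : Vars n} (hf : ContDiffAt ℝ ∞ f v)
    (h0 : tau f v ≠ 0) : HasFDerivAt (fun q => |tau f q|)
      (Real.sign (tau f v) • dtForm.comp ((D2 (baseComp f) v).flip (et, 0))) v := by
  have h := (hasDerivAt_abs h0).comp_hasFDerivAt v (hasFDerivAt_tau hf)
  have e : ((SignType.sign (tau f v) : SignType) : ℝ) = Real.sign (tau f v) := by
    rcases lt_or_gt_of_ne h0 with h | h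
    · simp [Real.sign_of_neg h, h]
    · simp [Real.sign_of_pos h, h]
  rw [e] at h
  exact h

theorem BaseDetermined.gram_deriv {f : Vars n → Vars n} {v : Vars n}
    (h : ∀ᶠ q in 𝓝 v, BaseDetermined f q) (z : Vars n) (a c : Fin n) :
    ∑ b, ((D2 (baseComp f) v z (ex a, 0)).2 b * jac f v b c
        + jac f v b a * (D2 (baseComp f) v z (ex c, 0)).2 b)
      = if a = c then Real.sign (tau f v) * (D2 (baseComp f) v z (et, 0)).1 else 0 := by
  have hv := h.self_of_nhds
  have h1 : HasFDerivAt (fun q => ∑ b, jac f q b a * jac f q b c) _ v :=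
    HasFDerivAt.fun_sum fun b _ => (hasFDerivAt_jac hv.smooth b a).mul (hasFDerivAt_jac hv.smooth b c)
  have h2 : HasFDerivAt (fun q => if a = c then |tau f q| else 0)
      (if a = c then (Real.sign (tau f v) • dtForm.comp ((D2 (baseComp f) v).flip (et, 0)))
        else (0 : Vars n →L[ℝ] ℝ)) v := by
    split_ifs
    · exact hasFDerivAt_abs_tau hv.smooth hv.tau_ne
    · exact hasFDerivAt_const _ _
  have h3 := h2.congr_of_eventuallyEq (h.mono fun q hq => hq.gram a c)
  have e := congrArg (fun K => K z) (h1.unique h3)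
  simp only [sum_apply, add_apply, smul_apply, ContinuousLinearMap.comp_apply,
    ContinuousLinearMap.flip_apply, dxForm_apply, smul_eq_mul] at e
  calc _ = _ := Finset.sum_congr rfl fun b _ => by ring
    _ = _ := e
    _ = _ := by split_ifs <;> simp

/-- The spatial components are affine in `x`. -/
theorem BaseDetermined.D2_spatial {f : Vars n → Vars n} {v : Vars n}
    (h : ∀ᶠ q in 𝓝 v, BaseDetermined f q) (w w' : Base n) (hw : w.1 = 0) (hw' : w'.1 = 0)
    (c c' : ℂ) : D2 (baseComp f) v (w, c) (w', c') = 0 := by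
  have hv := h.self_of_nhds
  have hsm := contDiffAt_baseComp hv.smooth
  have hz : ∀ z c, D2 (baseComp f) v z (0, c) = 0 := fun z c => D2_vertical h z c
  have hz' : ∀ z c, D2 (baseComp f) v (0, c) z = 0 := fun z c => by
    rw [D2_symm hsm]; exact hz z c
  -- These play the role of Christoffel symbols of the first kind. They are symmetric in the first
  -- two indices, and antisymmetric in the last two because the Gram matrix |T_t| δ does not vary in
  -- x; both symmetries together force zero.
  let Gam : Fin n → Fin n → Fin n → ℝ := fun d a c =>
    ∑ b, (D2 (baseComp f) v (ex d, 0) (ex a, 0)).2 b * jac f v b c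
  have s1 : ∀ d a c, Gam d a c = Gam a d c := fun d a c => by
    simp only [Gam, D2_symm hsm (ex d, 0) (ex a, 0)]
  have s2 : ∀ d a c, Gam d a c + Gam d c a = 0 := fun d a c => by
    have e := gram_deriv h (ex d, 0) a c
    rw [Finset.sum_add_distrib] at e
    have e1 : (D2 (baseComp f) v (ex d, 0) (et, 0)).1 = 0 := by
      rw [D2_symm hsm]; exact tau_D2_spatial h _ _ rfl _
    rw [e1, mul_zero, ite_self] at e
    rw [← e]
    congr 1
    exact Finset.sum_congr rfl fun b _ => mul_comm _ _
  have s3 : ∀ d a c, Gam d a c = 0 := fun d a c => by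
    have := s2 d a c
    have := s2 c d a
    have := s2 a c d
    rw [s1 c d a, s1 a c d] at *
    rw [s1 c a d, s1 d c a, s1 d a c] at *
    linarith [s1 d c a, s1 a d c, s1 a c d]
  have s4 : ∀ d a, D2 (baseComp f) v (ex d, 0) (ex a, 0) = 0 := fun d a =>
    Prod.ext (tau_D2_spatial h _ _ rfl _)
      (eq_zero_of_gram (abs_ne_zero.2 hv.tau_ne) hv.gram (s3 d a))
  have e : ∀ (w : Base n) (c : ℂ), w.1 = 0 →
      ((w, c) : Vars n) = ∑ a, w.2 a • ((ex a, 0) : Vars n) + (0, c) := by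
    intro w c hw
    have := base_eq_sum w
    rw [hw, zero_smul, zero_add] at this
    refine Prod.ext ?_ ?_
    · rw [Prod.fst_add, Prod.fst_sum]; simpa using this
    · simp [Prod.snd_sum]
  rw [e w c hw, e w' c' hw']
  simp only [map_add, map_sum, map_smul, add_apply, sum_apply, smul_apply, hz, hz', s4, smul_zero,
    Finset.sum_const_zero, add_zero]

theorem IsAdmissible.injective_pair {S S' : ArbitraryElement n}
    {φ : OpenPartialHomeomorph (Vars n) (Vars n)} (h : IsAdmissible S φ S') {v : Vars n}
    (hv : v ∈ φ.source) (z : Vars n) (h1 : fderiv ℝ (baseComp φ) v z = 0)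
    (h2 : fderiv ℝ (psiComp φ) v z = 0) : z = 0 := by
  have e1 := h.fderiv_fst hv z
  have e2 := h.fderiv_snd hv z
  refine (injective_iff_map_eq_zero _).1 (h.fderiv_injective hv) z (Prod.ext ?_ ?_)
  · rw [← e1]; exact h1
  · rw [← e2]; exact h2

theorem IsAdmissible.surjective_fst {S S' : ArbitraryElement n}
    {φ : OpenPartialHomeomorph (Vars n) (Vars n)} (h : IsAdmissible S φ S') {v : Vars n}
    (hv : v ∈ φ.source) : Function.Surjective (fderiv ℝ (baseComp φ) v) := by
  intro w
  obtain ⟨z, hz⟩ := (LinearMap.injective_iff_surjective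
    (f := (fderiv ℝ φ v : Vars n →ₗ[ℝ] Vars n))).1 (h.fderiv_injective hv) (w, 0)
  refine ⟨z, ?_⟩
  have e1 := h.fderiv_fst hv z
  refine e1.trans ?_
  exact congrArg Prod.fst hz

/-- The order is essential. That the new time involves only t is first proved at every point of the
open source and then differentiated; the resulting vanishing of second derivatives of T in the
directions of x and ψ is what conformality and independence of ψ require. -/
theorem IsAdmissible.baseDetermined {S S' : ArbitraryElement n}
    {φ : OpenPartialHomeomorph (Vars n) (Vars n)} (h : IsAdmissible S φ S') (hn : 1 ≤ n) {v : Vars n}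
    (hv : v ∈ φ.source) : BaseDetermined φ v := by
  have hfst : ∀ v ∈ φ.source, ∀ w : Base n, w.1 = 0 → ∀ c,
      (fderiv ℝ (baseComp φ) v (w, c)).1 = 0 := fun v hv w hw c =>
    (h.jetCondition hv).fst_eq_zero hn (h.injective_pair hv) (h.surjective_fst hv) w hw c
  have hJ : JetCondition (fderiv ℝ (baseComp φ) v) (fderiv ℝ (psiComp φ) v) (D2 (baseComp φ) v)
      (D2 (psiComp φ) v) _ _ := h.jetCondition hv
  have hτ := fst_et_ne_zero (hfst v hv) (h.surjective_fst hv)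
  have hY₂ : ∀ w w' : Base n, w.1 = 0 → w'.1 = 0 → ∀ c c',
      (D2 (baseComp φ) v (w, c) (w', c')).1 = 0 := by
    intro w w' hw hw' c c'
    refine D2_eq_zero_of_eventually (contDiffAt_baseComp (h.contDiffAt hv)) dtForm (w', c') ?_ (w, c)
    filter_upwards [φ.open_source.mem_nhds hv] with q hq
    exact hfst q hq w' hw' c'
  have hvert := hJ.vertical_eq_zero hn (h.injective_pair hv) (h.surjective_fst hv) hY₂
  obtain ⟨B, hB⟩ := exists_base_equiv (h.surjective_fst hv) hvert
  have hB0 : ∀ w, fderiv ℝ (baseComp φ) v (w, (0 : Base n →L[ℝ] ℂ) w) = B w := fun w => hB w _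
  refine ⟨h.contDiffAt hv, hfst v hv, hτ, hvert, fun a c => ?_⟩
  have g := (hJ.gram hn (h.injective_pair hv) (hfst v hv) hτ hY₂ hB0).1 a c
  simp only [jac, hB]
  exact g

/-- The equations for the (t,x)-components hold near each point, so `BaseDetermined.D2_spatial`
removes the second derivatives of these components along directions with dt = 0, and the
coefficients of powers of ψ_a involve the ψ-component only. -/
theorem IsAdmissible.psiDetermined {S S' : ArbitraryElement n}
    {φ : OpenPartialHomeomorph (Vars n) (Vars n)} (h : IsAdmissible S φ S') (hn : 1 ≤ n) {v : Vars n}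
    (hv : v ∈ φ.source) : PsiDetermined φ v := by
  have hb := h.baseDetermined hn hv
  have hev : ∀ᶠ q in 𝓝 v, BaseDetermined φ q := by
    filter_upwards [φ.open_source.mem_nhds hv] with q hq
    exact h.baseDetermined hn hq
  have hJ : JetCondition (fderiv ℝ (baseComp φ) v) (fderiv ℝ (psiComp φ) v) (D2 (baseComp φ) v)
      (D2 (psiComp φ) v) _ _ := h.jetCondition hv
  have hY₂ := BaseDetermined.D2_spatial hev
  have hsymm := D2_symm (contDiffAt_psiComp (h.contDiffAt hv))
  obtain ⟨B, hB⟩ := exists_base_equiv (h.surjective_fst hv) hb.vertical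
  have hB0 : ∀ w, fderiv ℝ (baseComp φ) v (w, (0 : Base n →L[ℝ] ℂ) w) = B w := fun w => hB w _
  have hco := hJ.coefficients hn (h.injective_pair hv) (h.surjective_fst hv) hb.fst_spatial
    hb.vertical hY₂ hsymm
  have hconf := (hJ.conformal hn (h.injective_pair hv) hb.fst_spatial hb.tau_ne
    (fun w w' hw hw' c c' => by
      have := hY₂ w w' hw hw' c c'
      exact congrArg Prod.fst this) hB0).1
  refine ⟨fun z => ?_, fun c hc => ?_, fun a c => (hco a c).1, fun c c' => ?_⟩
  · have := hconf z
    rw [vertMap_of_vertical hb.vertical, vertMap_of_vertical hb.vertical] at this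
    exact this
  · have := h.injective_pair hv (0, c) (hb.vertical c) hc
    exact congrArg Prod.snd this
  · let a : Fin n := ⟨0, hn⟩
    -- Polarization of the vanishing quadratic form in the ψ-directions.
    have e1 := (hco a c).2
    have e2 := (hco a c').2
    have e3 := (hco a (c + c')).2
    have e4 : ((0, c + c') : Vars n) = (0, c) + (0, c') := by simp
    rw [e4] at e3
    simp only [map_add, add_apply] at e3
    have e5 := hsymm (0, c') (0, c)
    linear_combination (e3 - e1 - e2 - e5) / 2

end

/-! ### The parametrized transformations: conjugation, phase and action on (t, x) -/

section

variable {n : ℕ}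

theorem hasFDerivAt_time {F : Type*} [NormedAddCommGroup F] [NormedSpace ℝ F] {g : ℝ → F} {g' : F}
    {q : Base n} (h : HasDerivAt g g' q.1) :
    HasFDerivAt (fun q : Base n => g q.1) (dtForm.smulRight g') q :=
  (h.hasFDerivAt.comp q (dtForm (n := n)).hasFDerivAt).congr_fderiv (by ext <;> simp)

theorem contDiffAt_deriv {F : Type*} [NormedAddCommGroup F] [NormedSpace ℝ F] {g : ℝ → F} {t : ℝ}
    (h : ContDiffAt ℝ ∞ g t) : ContDiffAt ℝ ∞ (deriv g) t :=
  contDiffAt_fderiv_apply h 1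

theorem hasDerivAt_deriv {F : Type*} [NormedAddCommGroup F] [NormedSpace ℝ F] {g : ℝ → F} {t : ℝ}
    (h : ContDiffAt ℝ ∞ g t) : HasDerivAt g (deriv g t) t :=
  (diffAt h).hasDerivAt

/-- The map `β ↦ β` or `β ↦ β*` as a real-linear map. -/
def hatL (τ : ℝ) : ℂ →L[ℝ] ℂ :=
  if 0 < τ then ContinuousLinearMap.id ℝ ℂ else (Complex.conjCLE : ℂ →L[ℝ] ℂ)

theorem hatL_apply (τ : ℝ) (z : ℂ) : hatL τ z = hat τ z := by
  unfold hatL hat; split_ifs <;> rfl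

theorem hat_mul (τ : ℝ) (z w : ℂ) : hat τ (z * w) = hat τ z * hat τ w := by
  unfold hat; split_ifs <;> simp

theorem hat_add (τ : ℝ) (z w : ℂ) : hat τ (z + w) = hat τ z + hat τ w := by
  unfold hat; split_ifs <;> simp

theorem hat_hat (τ : ℝ) (z : ℂ) : hat τ (hat τ z) = z := by
  unfold hat; split_ifs <;> simp

theorem hat_ofReal (τ : ℝ) (r : ℝ) : hat τ (r : ℂ) = r := by
  unfold hat; split_ifs <;> simp

theorem norm_hat (τ : ℝ) (z : ℂ) : ‖hat τ z‖ = ‖z‖ := by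
  unfold hat; split_ifs <;> simp

theorem hat_I {τ : ℝ} (h : τ ≠ 0) : hat τ Complex.I = Real.sign τ * Complex.I := by
  unfold hat
  rcases lt_or_gt_of_ne h with h | h
  · simp [Real.sign_of_neg h, not_lt.2 h.le]
  · simp [Real.sign_of_pos h, h]

theorem hat_eq_zero {τ : ℝ} {z : ℂ} : hat τ z = 0 ↔ z = 0 := by
  unfold hat; split_ifs <;> simp

theorem sign_mul_self {τ : ℝ} (h : τ ≠ 0) : Real.sign τ * Real.sign τ = 1 := by
  rcases lt_or_gt_of_ne h with h | h
  · simp [Real.sign_of_neg h]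
  · simp [Real.sign_of_pos h]

theorem abs_eq_sign_mul (τ : ℝ) : |τ| = Real.sign τ * τ := by
  rcases lt_trichotomy τ 0 with h | h | h
  · simp [Real.sign_of_neg h, abs_of_neg h]
  · simp [h]
  · simp [Real.sign_of_pos h, abs_of_pos h]

namespace Params

variable {P : Params n} {I : Set ℝ} {t : ℝ}

/-- The coefficient of `x_a x_a` in the phase. -/
def quadCoef (P : Params n) (t : ℝ) : ℝ := 1 / 8 * (iteratedDeriv 2 P.T t / |deriv P.T t|)

/-- The coefficient of `x_a` in the phase. -/
def linCoef (P : Params n) (a : Fin n) (t : ℝ) : ℝ :=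
  1 / 2 * ∑ b, P.eps t * deriv (P.X b) t / √|deriv P.T t| * P.O b a

theorem phase_eq (P : Params n) (t : ℝ) (x : Fin n → ℝ) :
    P.phase t x = P.quadCoef t * ∑ a, x a * x a + ∑ a, P.linCoef a t * x a + P.Sig t := by
  unfold phase quadCoef linCoef
  rw [Finset.sum_comm]
  simp only [Finset.mul_sum, Finset.sum_mul]
  congr 2
  exact Finset.sum_congr rfl fun a _ => Finset.sum_congr rfl fun b _ => by ring

/-- The factor `|T_t|^{1/2}`. -/
def scale (P : Params n) (t : ℝ) : ℝ := √|deriv P.T t|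

namespace IsValidOn

variable (hP : P.IsValidOn I) (hI : IsOpen I) (ht : t ∈ I)
include hP hI ht

theorem contDiffAt_T : ContDiffAt ℝ ∞ P.T t := (hP.smooth_T t ht).contDiffAt (hI.mem_nhds ht)

theorem contDiffAt_X (a : Fin n) : ContDiffAt ℝ ∞ (P.X a) t :=
  (hP.smooth_X a t ht).contDiffAt (hI.mem_nhds ht)

theorem contDiffAt_Sig : ContDiffAt ℝ ∞ P.Sig t := (hP.smooth_Sig t ht).contDiffAt (hI.mem_nhds ht)

theorem contDiffAt_Z : ContDiffAt ℝ ∞ P.Z t := (hP.smooth_Z t ht).contDiffAt (hI.mem_nhds ht)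

omit hI in
theorem abs_pos : 0 < |deriv P.T t| := _root_.abs_pos.2 (hP.deriv_T t ht)

omit hI in
theorem scale_pos : 0 < P.scale t := Real.sqrt_pos.2 (hP.abs_pos ht)

omit hP hI ht in
theorem scale_sq : P.scale t * P.scale t = |deriv P.T t| := Real.mul_self_sqrt (abs_nonneg _)

theorem eventually_sign : ∀ᶠ s in 𝓝 t, Real.sign (deriv P.T s) = Real.sign (deriv P.T t) ∧
    (0 < deriv P.T s ↔ 0 < deriv P.T t) := by
  have hc : ContinuousAt (deriv P.T) t := (contDiffAt_deriv (hP.contDiffAt_T hI ht)).continuousAt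
  rcases lt_or_gt_of_ne (hP.deriv_T t ht) with h | h
  · filter_upwards [hc.eventually (gt_mem_nhds h)] with s hs
    rw [Real.sign_of_neg h, Real.sign_of_neg hs]
    exact ⟨rfl, iff_of_false hs.not_gt h.not_gt⟩
  · filter_upwards [hc.eventually (lt_mem_nhds h)] with s hs
    rw [Real.sign_of_pos h, Real.sign_of_pos hs]
    exact ⟨rfl, iff_of_true hs h⟩

theorem eventually_hat : ∀ᶠ s in 𝓝 t, hat (deriv P.T s) = hat (deriv P.T t) := by
  filter_upwards [hP.eventually_sign hI ht] with s hs
  funext z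
  simp only [hat, hs.2]

theorem eventually_eps : P.eps =ᶠ[𝓝 t] fun _ => P.eps t := by
  filter_upwards [hP.eventually_sign hI ht] with s hs
  exact hs.1

theorem contDiffAt_abs : ContDiffAt ℝ ∞ (fun s => |deriv P.T s|) t :=
  (contDiffAt_deriv (hP.contDiffAt_T hI ht)).abs (hP.deriv_T t ht)

theorem contDiffAt_scale : ContDiffAt ℝ ∞ P.scale t :=
  (hP.contDiffAt_abs hI ht).sqrt (hP.abs_pos ht).ne'

theorem contDiffAt_eps : ContDiffAt ℝ ∞ P.eps t :=
  contDiffAt_const.congr_of_eventuallyEq (hP.eventually_eps hI ht)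

theorem contDiffAt_quadCoef : ContDiffAt ℝ ∞ P.quadCoef t := by
  unfold quadCoef
  simp only [iteratedDeriv_succ, iteratedDeriv_zero]
  exact contDiffAt_const.mul ((contDiffAt_deriv (contDiffAt_deriv (hP.contDiffAt_T hI ht))).div
    (hP.contDiffAt_abs hI ht) (hP.abs_pos ht).ne')

theorem contDiffAt_linCoef (a : Fin n) : ContDiffAt ℝ ∞ (P.linCoef a) t := by
  unfold linCoef
  refine contDiffAt_const.mul (ContDiffAt.sum fun b _ => ?_)
  exact (((hP.contDiffAt_eps hI ht).mul (contDiffAt_deriv (hP.contDiffAt_X hI ht b))).div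
    (hP.contDiffAt_scale hI ht) (hP.scale_pos ht).ne').mul contDiffAt_const

theorem contDiffAt_phase (x : Fin n → ℝ) :
    ContDiffAt ℝ ∞ (fun q : Base n => P.phase q.1 q.2) (t, x) := by
  simp only [phase_eq]
  have h1 : ∀ g : ℝ → ℝ, ContDiffAt ℝ ∞ g t → ContDiffAt ℝ ∞ (fun q : Base n => g q.1) (t, x) :=
    fun g hg => ContDiffAt.comp (g := g) (t, x) hg contDiffAt_fst
  have h2 : ∀ a, ContDiffAt ℝ ∞ (fun q : Base n => q.2 a) (t, x) :=
    fun a => (dxForm a).contDiff.contDiffAt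
  exact (((h1 _ (hP.contDiffAt_quadCoef hI ht)).mul
    (ContDiffAt.sum fun a _ => (h2 a).mul (h2 a))).add
    (ContDiffAt.sum fun a _ => (h1 _ (hP.contDiffAt_linCoef hI ht a)).mul (h2 a))).add
    (h1 _ (hP.contDiffAt_Sig hI ht))

theorem hasFDerivAt_phase (x : Fin n → ℝ) :
    HasFDerivAt (fun q : Base n => P.phase q.1 q.2)
      (dtForm.smulRight (deriv P.quadCoef t * ∑ a, x a * x a + ∑ a, deriv (P.linCoef a) t * x a
          + deriv P.Sig t)
        + ∑ a, (2 * P.quadCoef t * x a + P.linCoef a t) • dxForm a) (t, x) := by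
  simp only [phase_eq]
  have h1 : ∀ g : ℝ → ℝ, ContDiffAt ℝ ∞ g t →
      HasFDerivAt (fun q : Base n => g q.1) (dtForm.smulRight (deriv g t)) (t, x) :=
    fun g hg => hasFDerivAt_time (q := (t, x)) (hasDerivAt_deriv hg)
  have h2 : ∀ a, HasFDerivAt (fun q : Base n => q.2 a) (dxForm a) (t, x) :=
    fun a => (dxForm a).hasFDerivAt
  have h := (((h1 _ (hP.contDiffAt_quadCoef hI ht)).mul
    (HasFDerivAt.fun_sum (u := Finset.univ) fun a _ => (h2 a).mul (h2 a))).add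
    (HasFDerivAt.fun_sum (u := Finset.univ)
      fun a _ => (h1 _ (hP.contDiffAt_linCoef hI ht a)).mul (h2 a))).add
    (h1 _ (hP.contDiffAt_Sig hI ht))
  refine h.congr_fderiv ?_
  refine ContinuousLinearMap.ext fun z => ?_
  simp only [add_apply, smul_apply, sum_apply, ContinuousLinearMap.smulRight_apply, dtForm_apply,
    dxForm_apply, smul_eq_mul, Pi.mul_apply]
  simp only [mul_add, add_mul, Finset.mul_sum, Finset.sum_mul, Finset.sum_add_distrib]
  have e1 : ∑ a, 2 * P.quadCoef t * x a * z.2 a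
      = ∑ a, P.quadCoef t * (x a * z.2 a) + ∑ a, P.quadCoef t * (x a * z.2 a) := by
    rw [← Finset.sum_add_distrib]; exact Finset.sum_congr rfl fun a _ => by ring
  have e2 : ∑ a, x a * (z.1 * deriv (P.linCoef a) t) = ∑ a, z.1 * (deriv (P.linCoef a) t * x a) :=
    Finset.sum_congr rfl fun a _ => by ring
  have e3 : ∑ a, x a * x a * (z.1 * deriv P.quadCoef t)
      = ∑ a, z.1 * (deriv P.quadCoef t * (x a * x a)) :=
    Finset.sum_congr rfl fun a _ => by ring
  rw [e1, e2, e3]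
  ring

theorem hasDerivAt_scale :
    HasDerivAt P.scale (P.eps t * iteratedDeriv 2 P.T t / (2 * P.scale t)) t := by
  have hT := hasDerivAt_deriv (contDiffAt_deriv (hP.contDiffAt_T hI ht))
  have h1 : HasDerivAt (fun s => |deriv P.T s|) (P.eps t * deriv (deriv P.T) t) t := by
    have h2 := (hT.const_mul (P.eps t))
    refine h2.congr_of_eventuallyEq ?_
    filter_upwards [hP.eventually_eps hI ht] with s hs
    rw [abs_eq_sign_mul, ← hs]; rfl
  have := h1.sqrt (hP.abs_pos ht).ne'
  simp only [iteratedDeriv_succ, iteratedDeriv_zero]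
  exact this

end IsValidOn

/-- The action on the independent variables. -/
def baseMap (P : Params n) (q : Base n) : Base n := (P.T q.1, P.xMap q.1 q.2)

namespace IsValidOn

variable (hP : P.IsValidOn I) (hI : IsOpen I) (ht : t ∈ I)
include hP hI ht

theorem contDiffAt_xMap (x : Fin n → ℝ) (b : Fin n) :
    ContDiffAt ℝ ∞ (fun q : Base n => P.xMap q.1 q.2 b) (t, x) := by
  have h1 : ∀ g : ℝ → ℝ, ContDiffAt ℝ ∞ g t → ContDiffAt ℝ ∞ (fun q : Base n => g q.1) (t, x) :=
    fun g hg => ContDiffAt.comp (g := g) (t, x) hg contDiffAt_fst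
  have h2 : ∀ a, ContDiffAt ℝ ∞ (fun q : Base n => q.2 a) (t, x) :=
    fun a => (dxForm a).contDiff.contDiffAt
  exact ((h1 _ (hP.contDiffAt_scale hI ht)).mul
    (ContDiffAt.sum fun a _ => contDiffAt_const.mul (h2 a))).add (h1 _ (hP.contDiffAt_X hI ht b))

theorem contDiffAt_baseMap (x : Fin n → ℝ) : ContDiffAt ℝ ∞ P.baseMap (t, x) := by
  have h1 : ContDiffAt ℝ ∞ (fun q : Base n => P.T q.1) (t, x) :=
    ContDiffAt.comp (g := P.T) (t, x) (hP.contDiffAt_T hI ht) contDiffAt_fst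
  exact h1.prodMk (contDiffAt_pi.2 fun b => hP.contDiffAt_xMap hI ht x b)

theorem hasFDerivAt_xMap (x : Fin n → ℝ) (b : Fin n) :
    HasFDerivAt (fun q : Base n => P.xMap q.1 q.2 b)
      (dtForm.smulRight (P.eps t * iteratedDeriv 2 P.T t / (2 * P.scale t) * ∑ a, P.O b a * x a
          + deriv (P.X b) t) + ∑ a, (P.scale t * P.O b a) • dxForm a) (t, x) := by
  have h1 : ∀ (g : ℝ → ℝ) (g' : ℝ), HasDerivAt g g' t →
      HasFDerivAt (fun q : Base n => g q.1) (dtForm.smulRight g') (t, x) :=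
    fun g g' hg => hasFDerivAt_time (q := (t, x)) hg
  have h2 : ∀ a, HasFDerivAt (fun q : Base n => q.2 a) (dxForm a) (t, x) :=
    fun a => (dxForm a).hasFDerivAt
  have h := ((h1 _ _ (hP.hasDerivAt_scale hI ht)).mul
    (HasFDerivAt.fun_sum (u := Finset.univ) fun a _ => (h2 a).const_mul (P.O b a))).add
    (h1 _ _ (hasDerivAt_deriv (hP.contDiffAt_X hI ht b)))
  refine HasFDerivAt.congr_fderiv (f := fun q : Base n => P.xMap q.1 q.2 b) h ?_
  refine ContinuousLinearMap.ext fun z => ?_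
  simp only [add_apply, smul_apply, sum_apply, ContinuousLinearMap.smulRight_apply, dtForm_apply,
    dxForm_apply, smul_eq_mul]
  simp only [mul_add, Finset.mul_sum, Finset.sum_mul, mul_assoc]
  have e : ∑ a, P.O b a * (x a * (z.1 * (P.eps t * iteratedDeriv 2 P.T t / (2 * P.scale t))))
      = ∑ a, z.1 * (P.eps t * iteratedDeriv 2 P.T t / (2 * P.scale t) * (P.O b a * x a)) :=
    Finset.sum_congr rfl fun a _ => by ring
  rw [e]
  ring

theorem fderiv_baseMap_fst (x : Fin n → ℝ) (z : Base n) :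
    (fderiv ℝ P.baseMap (t, x) z).1 = z.1 * deriv P.T t := by
  have h1 : HasFDerivAt (fun q : Base n => (P.baseMap q).1) (dtForm.smulRight (deriv P.T t)) (t, x) :=
    hasFDerivAt_time (q := (t, x)) (hasDerivAt_deriv (hP.contDiffAt_T hI ht))
  have h2 := (dtForm (n := n)).hasFDerivAt.comp (t, x)
    (diffAt (hP.contDiffAt_baseMap hI ht x)).hasFDerivAt
  have := congrArg (fun K => K z) (h2.unique h1)
  simpa using this

theorem fderiv_baseMap_snd (x : Fin n → ℝ) (z : Base n) (b : Fin n) :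
    (fderiv ℝ P.baseMap (t, x) z).2 b
      = z.1 * (P.eps t * iteratedDeriv 2 P.T t / (2 * P.scale t) * ∑ a, P.O b a * x a
          + deriv (P.X b) t) + ∑ a, P.scale t * P.O b a * z.2 a := by
  have h2 := (dxForm b).hasFDerivAt.comp (t, x)
    (diffAt (hP.contDiffAt_baseMap hI ht x)).hasFDerivAt
  have := congrArg (fun K => K z) (h2.unique (hP.hasFDerivAt_xMap hI ht x b))
  simpa [smul_eq_mul] using this

theorem fderiv_baseMap_ex (x : Fin n → ℝ) (a : Fin n) :
    fderiv ℝ P.baseMap (t, x) (ex a) = P.scale t • ∑ b, P.O b a • ex b := by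
  refine Prod.ext ?_ (funext fun b => ?_)
  · rw [hP.fderiv_baseMap_fst hI ht]; simp [ex, Prod.fst_sum]
  · rw [hP.fderiv_baseMap_snd hI ht]
    simp [ex, Prod.snd_sum, Finset.sum_apply, Pi.single_apply]

theorem D2_baseMap_ex (x : Fin n → ℝ) (a : Fin n) : D2 P.baseMap (t, x) (ex a) (ex a) = 0 := by
  rw [← fderiv_fderiv_apply (hP.contDiffAt_baseMap hI ht x)]
  have h1 : (fun q => fderiv ℝ P.baseMap q (ex a)) =ᶠ[𝓝 (t, x)]
      fun q => P.scale q.1 • ∑ b, P.O b a • ex b := by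
    have : ∀ᶠ q : Base n in 𝓝 (t, x), q.1 ∈ I :=
      continuousAt_fst.eventually (hI.mem_nhds ht)
    filter_upwards [this] with q hq
    exact hP.fderiv_baseMap_ex hI hq q.2 a
  rw [h1.fderiv_eq]
  have h2 := (hasFDerivAt_time (n := n) (q := (t, x)) (hP.hasDerivAt_scale hI ht)).smul_const
    (∑ b, P.O b a • (ex b : Base n))
  rw [h2.fderiv]
  simp [ex]

end IsValidOn

end Params

end

/-! ### Orthogonality relations and the S-component in terms of the phase -/

section

variable {n : ℕ}

namespace Params

variable {P : Params n} {I : Set ℝ} {t : ℝ}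

theorem IsValidOn.sum_row (hP : P.IsValidOn I) (b c : Fin n) :
    ∑ a, P.O b a * P.O c a = if b = c then 1 else 0 := by
  have h := congrFun (congrFun ((Matrix.mem_orthogonalGroup_iff (Fin n) ℝ).1 hP.orthogonal) b) c
  simpa [Matrix.mul_apply, Matrix.star_apply, Matrix.one_apply] using h

theorem IsValidOn.sum_col (hP : P.IsValidOn I) (a c : Fin n) :
    ∑ b, P.O b a * P.O b c = if a = c then 1 else 0 := by
  have h := congrFun (congrFun ((Matrix.mem_orthogonalGroup_iff' (Fin n) ℝ).1 hP.orthogonal) a) c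
  simpa [Matrix.mul_apply, Matrix.star_apply, Matrix.one_apply] using h

theorem IsValidOn.sum_transpose_mul (hP : P.IsValidOn I) (x : Fin n → ℝ) (a : Fin n) :
    ∑ b, P.O b a * ∑ c, P.O b c * x c = x a := by
  simp only [Finset.mul_sum]
  rw [Finset.sum_comm]
  simp only [← mul_assoc, ← Finset.sum_mul, hP.sum_col]
  simp

theorem IsValidOn.sum_mul_transpose {F : Type*} [AddCommGroup F] [Module ℝ F] (hP : P.IsValidOn I)
    (x : Fin n → F) (b : Fin n) : ∑ a, P.O b a • ∑ c, P.O c a • x c = x b := by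
  simp only [Finset.smul_sum]
  rw [Finset.sum_comm]
  simp only [smul_smul, ← Finset.sum_smul, hP.sum_row]
  simp

theorem IsValidOn.sum_norm_transpose (hP : P.IsValidOn I) (y : Fin n → ℝ) :
    ∑ a, (∑ b, P.O b a * y b) * (∑ b, P.O b a * y b) = ∑ b, y b * y b := by
  have h := hP.sum_mul_transpose y
  calc ∑ a, (∑ b, P.O b a * y b) * (∑ b, P.O b a * y b)
      = ∑ a, ∑ b, y b * (P.O b a * ∑ c, P.O c a * y c) := by
        refine Finset.sum_congr rfl fun a _ => ?_
        rw [Finset.sum_mul]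
        exact Finset.sum_congr rfl fun b _ => by ring
    _ = ∑ b, y b * ∑ a, P.O b a • ∑ c, P.O c a • y c := by
        rw [Finset.sum_comm]
        simp only [Finset.mul_sum, smul_eq_mul]
    _ = _ := by simp only [h]

section

variable (hP : P.IsValidOn I) (hI : IsOpen I) (ht : t ∈ I)
include hP hI ht

theorem IsValidOn.deriv_quadCoef : deriv P.quadCoef t
    = P.eps t * (iteratedDeriv 3 P.T t * deriv P.T t - iteratedDeriv 2 P.T t ^ 2)
      / (8 * deriv P.T t ^ 2) := by
  have hT := hP.contDiffAt_T hI ht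
  have h1 := hasDerivAt_deriv (contDiffAt_deriv hT)
  have h2 := hasDerivAt_deriv (contDiffAt_deriv (contDiffAt_deriv hT))
  have hne := hP.deriv_T t ht
  have hq : P.quadCoef =ᶠ[𝓝 t] fun s => P.eps t / 8 * (deriv (deriv P.T) s / deriv P.T s) := by
    filter_upwards [hP.eventually_eps hI ht, hI.mem_nhds ht] with s hs hsI
    have hne' := hP.deriv_T s hsI
    have h3 : P.eps t * P.eps t = 1 := sign_mul_self hne
    have h4 : |deriv P.T s| = P.eps t * deriv P.T s := by rw [← hs]; exact abs_eq_sign_mul _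
    have h5 : P.eps t ≠ 0 := by intro h; rw [h] at h3; norm_num at h3
    simp only [quadCoef, iteratedDeriv_succ, iteratedDeriv_zero, h4]
    field_simp
    linear_combination -(deriv (deriv P.T) s) * h3
  rw [hq.deriv_eq, ((h2.fun_div h1 hne).const_mul (P.eps t / 8)).deriv]
  simp only [iteratedDeriv_succ, iteratedDeriv_zero]
  field_simp

theorem IsValidOn.deriv_linCoef (a : Fin n) : deriv (P.linCoef a) t
    = 1 / 2 * ∑ b, P.eps t * (deriv (deriv (P.X b)) t / P.scale t
      - deriv (P.X b) t * (P.eps t * iteratedDeriv 2 P.T t / (2 * P.scale t)) / P.scale t ^ 2)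
        * P.O b a := by
  have hr := hP.hasDerivAt_scale hI ht
  have hne := (hP.scale_pos ht).ne'
  have hq : P.linCoef a =ᶠ[𝓝 t] fun s => 1 / 2 * ∑ b, P.eps t * (deriv (P.X b) s / P.scale s)
      * P.O b a := by
    filter_upwards [hP.eventually_eps hI ht] with s hs
    simp only [linCoef, hs, scale, mul_div_assoc]
  have hd : HasDerivAt (fun s => 1 / 2 * ∑ b, P.eps t * (deriv (P.X b) s / P.scale s)
      * P.O b a) (1 / 2 * ∑ b, P.eps t * ((deriv (deriv (P.X b)) t * P.scale t
        - deriv (P.X b) t * (P.eps t * iteratedDeriv 2 P.T t / (2 * P.scale t))) / P.scale t ^ 2)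
        * P.O b a) t :=
    (HasDerivAt.fun_sum fun b _ => (((hasDerivAt_deriv (contDiffAt_deriv
      (hP.contDiffAt_X hI ht b))).div hr hne).const_mul (P.eps t)).mul_const (P.O b a)).const_mul _
  rw [hq.deriv_eq, hd.deriv]
  congr 1
  refine Finset.sum_congr rfl fun b _ => ?_
  field_simp

theorem IsValidOn.deriv_div (b : Fin n) : deriv (fun r => deriv (P.X b) r / deriv P.T r) t
    = (deriv (deriv (P.X b)) t * deriv P.T t - deriv (P.X b) t * iteratedDeriv 2 P.T t)
      / deriv P.T t ^ 2 := by
  have h1 := hasDerivAt_deriv (contDiffAt_deriv (hP.contDiffAt_T hI ht))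
  have h2 := hasDerivAt_deriv (contDiffAt_deriv (hP.contDiffAt_X hI ht b))
  simp only [iteratedDeriv_succ, iteratedDeriv_zero]
  exact (h2.div h1 (hP.deriv_T t ht)).deriv

/-- The right-hand side is ε' times the t-derivative of the phase minus the square of its
x-gradient, which is the real potential generated by a phase factor. Comparison of the coefficients
of x_a x_a, of x_a and of 1 gives the Schwarzian-type term, the derivative of 𝒳_t/T_t, and the
remainder. -/
theorem IsValidOn.sMap_real_identity (x : Fin n → ℝ) :
    |deriv P.T t| * ((2 * iteratedDeriv 3 P.T t * deriv P.T t - 3 * iteratedDeriv 2 P.T t ^ 2)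
          / (16 * P.eps t * deriv P.T t ^ 3) * ∑ a, x a * x a
        + P.eps t / 2 * ∑ b, ∑ a, deriv (fun r => deriv (P.X b) r / deriv P.T r) t
          * (P.O b a * x a) / √|deriv P.T t|
        + deriv P.Sig t / deriv P.T t
        - (∑ a, deriv (P.X a) t * deriv (P.X a) t) / (4 * deriv P.T t ^ 2))
      = P.eps t * (deriv P.quadCoef t * ∑ a, x a * x a + ∑ a, deriv (P.linCoef a) t * x a
          + deriv P.Sig t)
        - ∑ a, (2 * P.quadCoef t * x a + P.linCoef a t) * (2 * P.quadCoef t * x a + P.linCoef a t) := by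
  have hne := hP.deriv_T t ht
  have hee : P.eps t * P.eps t = 1 := sign_mul_self hne
  have he0 : P.eps t ≠ 0 := by intro h; rw [h] at hee; norm_num at hee
  have habs : |deriv P.T t| = P.eps t * deriv P.T t := abs_eq_sign_mul _
  have hr0 := (hP.scale_pos ht).ne'
  have hrr : P.scale t * P.scale t = P.eps t * deriv P.T t := by rw [← habs]; exact scale_sq
  have hlin : ∀ a, P.linCoef a t
      = P.eps t / (2 * P.scale t) * ∑ b, P.O b a * deriv (P.X b) t := by
    intro a
    rw [linCoef, Finset.mul_sum, Finset.mul_sum]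
    refine Finset.sum_congr rfl fun b _ => ?_
    change 1 / 2 * (P.eps t * deriv (P.X b) t / P.scale t * P.O b a) = _
    field_simp
  have hsq : ∑ a, P.linCoef a t * P.linCoef a t
      = (∑ b, deriv (P.X b) t * deriv (P.X b) t) / (4 * (P.eps t * deriv P.T t)) := by
    have e : ∀ a, P.linCoef a t * P.linCoef a t = 1 / (4 * (P.eps t * deriv P.T t))
        * ((∑ b, P.O b a * deriv (P.X b) t) * (∑ b, P.O b a * deriv (P.X b) t)) := by
      intro a
      rw [hlin, ← hrr]
      field_simp
      linear_combination 4 * (∑ b, P.O b a * deriv (P.X b) t) ^ 2 * hee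
    simp only [e]
    rw [← Finset.mul_sum, hP.sum_norm_transpose]
    ring
  have hexp : ∑ a, (2 * P.quadCoef t * x a + P.linCoef a t) * (2 * P.quadCoef t * x a + P.linCoef a t)
      = 4 * P.quadCoef t ^ 2 * ∑ a, x a * x a + ∑ a, 4 * P.quadCoef t * P.linCoef a t * x a
        + ∑ a, P.linCoef a t * P.linCoef a t := by
    rw [Finset.mul_sum, ← Finset.sum_add_distrib, ← Finset.sum_add_distrib]
    exact Finset.sum_congr rfl fun a _ => by ring
  have hqc : P.quadCoef t = P.eps t * iteratedDeriv 2 P.T t / (8 * deriv P.T t) := by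
    rw [quadCoef, habs]
    field_simp
    linear_combination -(iteratedDeriv 2 P.T t) * hee
  have hl : |deriv P.T t| * (P.eps t / 2 * ∑ b, ∑ a,
        deriv (fun r => deriv (P.X b) r / deriv P.T r) t * (P.O b a * x a) / √|deriv P.T t|)
      = P.eps t * (∑ a, deriv (P.linCoef a) t * x a)
        - ∑ a, 4 * P.quadCoef t * P.linCoef a t * x a := by
    rw [Finset.sum_comm, Finset.mul_sum, Finset.mul_sum, Finset.mul_sum, ← Finset.sum_sub_distrib]
    refine Finset.sum_congr rfl fun a _ => ?_
    rw [hP.deriv_linCoef hI ht, hlin]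
    simp only [hP.deriv_div hI ht, hqc, habs]
    rw [← habs]
    change |deriv P.T t| * (P.eps t / 2 * ∑ b, _ / P.scale t) = _
    rw [habs]
    simp only [Finset.mul_sum, Finset.sum_mul]
    rw [← Finset.sum_sub_distrib]
    refine Finset.sum_congr rfl fun b _ => ?_
    rw [pow_two (P.scale t), hrr]
    generalize deriv P.T t = τ at *
    generalize P.eps t = ε at *
    generalize P.scale t = r at *
    field_simp
    generalize deriv (deriv (P.X b)) t = X2
    generalize deriv (P.X b) t = X1
    generalize iteratedDeriv 2 P.T t = T2
    ring
  rw [hexp, hsq, mul_sub, mul_add, mul_add, hl, hP.deriv_quadCoef hI ht, hqc, habs]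
  have hE : ∀ T2 T3 X xx Sg ε τ : ℝ, ε * ε = 1 → ε ≠ 0 → τ ≠ 0 → ∀ L M : ℝ,
      ε * τ * ((2 * T3 * τ - 3 * T2 ^ 2) / (16 * ε * τ ^ 3) * xx) + (ε * L - M)
        + ε * τ * (Sg / τ) - ε * τ * (X / (4 * τ ^ 2))
      = ε * (ε * (T3 * τ - T2 ^ 2) / (8 * τ ^ 2) * xx + L + Sg)
        - (4 * (ε * T2 / (8 * τ)) ^ 2 * xx + M + X / (4 * (ε * τ))) := by
    intro T2 T3 X xx Sg ε τ h1 h2 h3 L M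
    have e1 : ε * τ * ((2 * T3 * τ - 3 * T2 ^ 2) / (16 * ε * τ ^ 3) * xx)
        = (2 * T3 * τ - 3 * T2 ^ 2) / (16 * τ ^ 2) * xx := by field_simp
    have e2 : ε * (ε * (T3 * τ - T2 ^ 2) / (8 * τ ^ 2) * xx)
        = (T3 * τ - T2 ^ 2) / (8 * τ ^ 2) * xx := by
      linear_combination (T3 * τ - T2 ^ 2) / (8 * τ ^ 2) * xx * h1
    have e3 : 4 * (ε * T2 / (8 * τ)) ^ 2 * xx = T2 ^ 2 / (16 * τ ^ 2) * xx := by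
      field_simp
      linear_combination 64 * xx * T2 ^ 2 * h1
    have e4 : X / (4 * (ε * τ)) = ε * τ * (X / (4 * τ ^ 2)) := by
      field_simp
      linear_combination -X * h1
    rw [mul_add, mul_add, e1, e2, e3, e4]
    field_simp
    ring
  exact hE _ _ _ _ _ _ _ hee he0 hne _ _

/-- This is the shape in which the S-component occurs when the equation is transformed: ε' phase_t −
|∇phase|² as real part, and as imaginary part −ε' Z_t minus the Laplacian of the phase. -/
theorem IsValidOn.abs_mul_sMap (x : Fin n → ℝ) (s : ℂ) :
    (|deriv P.T t| : ℝ) * P.sMap t x s = hat (deriv P.T t) s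
      + ((P.eps t * (deriv P.quadCoef t * ∑ a, x a * x a + ∑ a, deriv (P.linCoef a) t * x a
          + deriv P.Sig t)
        - ∑ a, (2 * P.quadCoef t * x a + P.linCoef a t) * (2 * P.quadCoef t * x a + P.linCoef a t)
        : ℝ) : ℂ)
      - Complex.I * (P.eps t * deriv P.Z t : ℝ) - Complex.I * n * (2 * P.quadCoef t : ℝ) := by
  rw [← hP.sMap_real_identity hI ht x]
  have hne := hP.deriv_T t ht
  have habs := (hP.abs_pos ht).ne'
  have hee : P.eps t * P.eps t = 1 := sign_mul_self hne
  have habs' : |deriv P.T t| = P.eps t * deriv P.T t := abs_eq_sign_mul _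
  have h1 : (|deriv P.T t| : ℝ) * (hat (deriv P.T t) s / (|deriv P.T t| : ℝ)) = hat (deriv P.T t) s := by
    have : ((|deriv P.T t| : ℝ) : ℂ) ≠ 0 := by exact_mod_cast habs
    field_simp
  have h2 : (P.eps t * deriv P.Z t : ℝ) = |deriv P.T t| * (deriv P.Z t / deriv P.T t) := by
    rw [habs']; field_simp
  have h3 : 2 * P.quadCoef t = |deriv P.T t| * (iteratedDeriv 2 P.T t / (4 * deriv P.T t ^ 2)) := by
    rw [quadCoef]
    have : |deriv P.T t| * |deriv P.T t| = deriv P.T t ^ 2 := by rw [abs_mul_abs_self]; ring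
    field_simp
    rw [← this]; field_simp; ring
  rw [h2, h3, sMap]
  have hc : ((deriv P.T t : ℝ) : ℂ) ≠ 0 := by exact_mod_cast hne
  rw [mul_sub, mul_add, mul_add, mul_add, h1]
  push_cast
  ring

end

end Params

end

/-! ### Transformation of the equation under the parametrized transformations -/

section

variable {n : ℕ}

section

variable {E : Type*} [NormedAddCommGroup E] [NormedSpace ℝ E]

theorem hasFDerivAt_exp_mul {G w : E → ℂ} {G' w' : E →L[ℝ] ℂ} {q : E}
    (hG : HasFDerivAt G G' q) (hw : HasFDerivAt w w' q) :
    HasFDerivAt (fun q => Complex.exp (G q) * w q)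
      (Complex.exp (G q) • (w q • G' + w')) q := by
  refine (hG.cexp.mul hw).congr_fderiv ?_
  refine ContinuousLinearMap.ext fun z => ?_
  simp only [add_apply, smul_apply, smul_eq_mul]
  ring

theorem fderiv_exp_mul {G w : E → ℂ} {q : E}
    (hG : DifferentiableAt ℝ G q) (hw : DifferentiableAt ℝ w q) (z : E) :
    fderiv ℝ (fun q => Complex.exp (G q) * w q) q z
      = Complex.exp (G q) * (w q * fderiv ℝ G q z + fderiv ℝ w q z) := by
  rw [(hasFDerivAt_exp_mul hG.hasFDerivAt hw.hasFDerivAt).fderiv]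
  simp only [smul_apply, add_apply, smul_eq_mul]

theorem D2_exp_mul {G w : E → ℂ} {p : E} (hG : ContDiffAt ℝ ∞ G p) (hw : ContDiffAt ℝ ∞ w p)
    (z : E) :
    D2 (fun q => Complex.exp (G q) * w q) p z z
      = Complex.exp (G p) * (w p * fderiv ℝ G p z ^ 2 + 2 * fderiv ℝ G p z * fderiv ℝ w p z
        + w p * D2 G p z z + D2 w p z z) := by
  have hW : ContDiffAt ℝ ∞ (fun q => Complex.exp (G q) * w q) p := hG.cexp.mul hw
  rw [← fderiv_fderiv_apply hW]
  have h1 : (fun q => fderiv ℝ (fun q => Complex.exp (G q) * w q) q z) =ᶠ[𝓝 p]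
      fun q => Complex.exp (G q) * (w q * fderiv ℝ G q z + fderiv ℝ w q z) := by
    filter_upwards [eventually_differentiableAt hG, eventually_differentiableAt hw] with q h1 h2
    exact fderiv_exp_mul h1 h2 z
  have hGz := diffAt (contDiffAt_fderiv_apply hG z)
  have hwz := diffAt (contDiffAt_fderiv_apply hw z)
  have h2 : DifferentiableAt ℝ (fun q => w q * fderiv ℝ G q z + fderiv ℝ w q z) p :=
    ((diffAt hw).fun_mul hGz).add hwz
  rw [h1.fderiv_eq, fderiv_exp_mul (diffAt hG) h2, fderiv_fun_add ((diffAt hw).fun_mul hGz) hwz,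
    fderiv_fun_mul (diffAt hw) hGz]
  simp only [add_apply, smul_apply, smul_eq_mul, fderiv_fderiv_apply hG, fderiv_fderiv_apply hw]
  ring

theorem fderiv_clm_comp {F : Type*} [NormedAddCommGroup F] [NormedSpace ℝ F] {u : E → ℂ} {q : E}
    (L : ℂ →L[ℝ] F) (hu : DifferentiableAt ℝ u q) (z : E) :
    fderiv ℝ (fun q => L (u q)) q z = L (fderiv ℝ u q z) := by
  have : HasFDerivAt (fun q => L (u q)) (L.comp (fderiv ℝ u q)) q :=
    L.hasFDerivAt.comp q hu.hasFDerivAt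
  rw [this.fderiv]; rfl

theorem D2_clm_comp {u : E → ℂ} {p : E} (L : ℂ →L[ℝ] ℂ) (hu : ContDiffAt ℝ ∞ u p) (z : E) :
    D2 (fun q => L (u q)) p z z = L (D2 u p z z) := by
  have hL : ContDiffAt ℝ ∞ (fun q => L (u q)) p :=
    ContDiffAt.comp (g := L) p L.contDiff.contDiffAt hu
  rw [← fderiv_fderiv_apply hL, ← fderiv_fderiv_apply hu,
    ← fderiv_clm_comp L (diffAt (contDiffAt_fderiv_apply hu z))]
  refine congrArg (fun K : E →L[ℝ] ℂ => K z) (Filter.EventuallyEq.fderiv_eq ?_)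
  filter_upwards [eventually_differentiableAt hu] with q hq
  exact fderiv_clm_comp L hq z

end

namespace Params

variable {P : Params n} {I : Set ℝ} {t : ℝ}

/-- The exponent in the `ψ`-component. -/
def expo (P : Params n) (q : Base n) : ℂ := Complex.I * (P.phase q.1 q.2 : ℂ) + (P.Z q.1 : ℂ)

section

variable (hP : P.IsValidOn I) (hI : IsOpen I) (ht : t ∈ I)
include hP hI ht

theorem IsValidOn.contDiffAt_expo (x : Fin n → ℝ) : ContDiffAt ℝ ∞ P.expo (t, x) := by
  have h1 : ContDiffAt ℝ ∞ (fun q : Base n => P.Z q.1) (t, x) :=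
    ContDiffAt.comp (g := P.Z) (t, x) (hP.contDiffAt_Z hI ht) contDiffAt_fst
  have h2 : ∀ g : Base n → ℝ, ContDiffAt ℝ ∞ g (t, x) →
      ContDiffAt ℝ ∞ (fun q => ((g q : ℝ) : ℂ)) (t, x) := fun g hg =>
    Complex.ofRealCLM.contDiff.contDiffAt.comp (t, x) hg
  exact (contDiffAt_const.mul (h2 _ (hP.contDiffAt_phase hI ht x))).add (h2 _ h1)

theorem IsValidOn.fderiv_expo (x : Fin n → ℝ) (z : Base n) : fderiv ℝ P.expo (t, x) z
    = Complex.I * ((z.1 * (deriv P.quadCoef t * ∑ a, x a * x a + ∑ a, deriv (P.linCoef a) t * x a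
          + deriv P.Sig t) + ∑ a, (2 * P.quadCoef t * x a + P.linCoef a t) * z.2 a : ℝ) : ℂ)
      + ((z.1 * deriv P.Z t : ℝ) : ℂ) := by
  have h1 := hasFDerivAt_time (n := n) (q := (t, x)) (hasDerivAt_deriv (hP.contDiffAt_Z hI ht))
  have h2 := hP.hasFDerivAt_phase hI ht x
  have h3 := ((Complex.ofRealCLM.hasFDerivAt.comp (t, x) h2).const_mul Complex.I).add
    (Complex.ofRealCLM.hasFDerivAt.comp (t, x) h1)
  have h4 : HasFDerivAt P.expo _ (t, x) := h3
  rw [h4.fderiv]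
  simp only [add_apply, smul_apply, sum_apply, ContinuousLinearMap.comp_apply,
    ContinuousLinearMap.smulRight_apply, Complex.ofRealCLM_apply, dtForm_apply, dxForm_apply,
    smul_eq_mul]

theorem IsValidOn.fderiv_expo_ex (x : Fin n → ℝ) (a : Fin n) : fderiv ℝ P.expo (t, x) (ex a)
    = Complex.I * ((2 * P.quadCoef t * x a + P.linCoef a t : ℝ) : ℂ) := by
  rw [hP.fderiv_expo hI ht]
  simp [ex, Pi.single_apply]

theorem IsValidOn.fderiv_expo_et (x : Fin n → ℝ) : fderiv ℝ P.expo (t, x) et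
    = Complex.I * ((deriv P.quadCoef t * ∑ a, x a * x a + ∑ a, deriv (P.linCoef a) t * x a
          + deriv P.Sig t : ℝ) : ℂ) + ((deriv P.Z t : ℝ) : ℂ) := by
  rw [hP.fderiv_expo hI ht]
  simp [et]

theorem IsValidOn.D2_expo_ex (x : Fin n → ℝ) (a : Fin n) : D2 P.expo (t, x) (ex a) (ex a)
    = Complex.I * ((2 * P.quadCoef t : ℝ) : ℂ) := by
  rw [← fderiv_fderiv_apply (hP.contDiffAt_expo hI ht x)]
  have h1 : (fun q => fderiv ℝ P.expo q (ex a)) =ᶠ[𝓝 (t, x)]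
      fun q => Complex.I * ((2 * P.quadCoef q.1 * q.2 a + P.linCoef a q.1 : ℝ) : ℂ) := by
    have : ∀ᶠ q : Base n in 𝓝 (t, x), q.1 ∈ I :=
      continuousAt_fst.eventually (hI.mem_nhds ht)
    filter_upwards [this] with q hq
    exact hP.fderiv_expo_ex hI hq q.2 a
  have hq := hasFDerivAt_time (n := n) (q := (t, x))
    (hasDerivAt_deriv (hP.contDiffAt_quadCoef hI ht))
  have hl := hasFDerivAt_time (n := n) (q := (t, x))
    (hasDerivAt_deriv (hP.contDiffAt_linCoef hI ht a))
  have hx : HasFDerivAt (fun q : Base n => q.2 a) (dxForm a) (t, x) := (dxForm a).hasFDerivAt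
  have h2 : HasFDerivAt (fun q : Base n => 2 * P.quadCoef q.1 * q.2 a + P.linCoef a q.1) _ (t, x) :=
    ((hq.const_mul 2).mul hx).add hl
  have h3 : HasFDerivAt (fun q : Base n =>
      Complex.I * ((2 * P.quadCoef q.1 * q.2 a + P.linCoef a q.1 : ℝ) : ℂ)) _ (t, x) :=
    (Complex.ofRealCLM.hasFDerivAt.comp (t, x) h2).const_mul Complex.I
  rw [h1.fderiv_eq, h3.fderiv]
  simp [ex]

omit hI in
-- The phase is chosen for this: its gradient is half the (signed, rescaled) velocity of the new
-- spatial variables. It makes the convective terms from the t-derivative cancel the cross terms of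
-- the Laplacian.
theorem IsValidOn.gradient_identity (x : Fin n → ℝ) (a : Fin n) :
    P.eps t * ((P.scale t)⁻¹ * (P.eps t * iteratedDeriv 2 P.T t / (2 * P.scale t) * x a
        + ∑ b, P.O b a * deriv (P.X b) t))
      = 2 * (2 * P.quadCoef t * x a + P.linCoef a t) := by
  have hee : P.eps t * P.eps t = 1 := sign_mul_self (hP.deriv_T t ht)
  have hr0 := (hP.scale_pos ht).ne'
  have hrr : P.scale t * P.scale t = |deriv P.T t| := scale_sq
  have e1 : P.linCoef a t = P.eps t / (2 * P.scale t) * ∑ b, P.O b a * deriv (P.X b) t := by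
    rw [linCoef, Finset.mul_sum, Finset.mul_sum]
    refine Finset.sum_congr rfl fun b _ => ?_
    change 1 / 2 * (P.eps t * deriv (P.X b) t / P.scale t * P.O b a) = _
    field_simp
  rw [e1, quadCoef, ← hrr]
  field_simp
  linear_combination 8 * iteratedDeriv 2 P.T t * x a * hee

/-- The transformation of the differential part of the equation. -/
theorem IsValidOn.transform_identity {u u' : Base n → ℂ} {x : Fin n → ℝ}
    (hu : ContDiffAt ℝ ∞ u (t, x)) (hu' : ContDiffAt ℝ ∞ u' (P.baseMap (t, x)))
    (h : ∀ᶠ q in 𝓝 ((t, x) : Base n), u' (P.baseMap q) = P.psiMap q.1 q.2 (u q)) (s : ℂ) :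
    ((|deriv P.T t| : ℝ) : ℂ) * (Complex.I * dt u' (P.baseMap (t, x))
        + ∑ a, dx a (dx a u') (P.baseMap (t, x)) + P.sMap t x s * u' (P.baseMap (t, x)))
      = Complex.exp (P.expo (t, x)) * hat (deriv P.T t)
        (Complex.I * dt u (t, x) + ∑ a, dx a (dx a u) (t, x) + s * u (t, x)) := by
  have hne := hP.deriv_T t ht
  have hee : P.eps t * P.eps t = 1 := sign_mul_self hne
  have habs : |deriv P.T t| = P.eps t * deriv P.T t := abs_eq_sign_mul _
  have hr0 := (hP.scale_pos ht).ne'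
  have hrr : P.scale t * P.scale t = |deriv P.T t| := scale_sq
  set L := hatL (deriv P.T t) with hL
  set G := P.expo with hG
  have hGs := hP.contDiffAt_expo hI ht x
  have hb := hP.contDiffAt_baseMap hI ht x
  have hLs : ContDiffAt ℝ ∞ (fun q => L (u q)) (t, x) :=
    ContDiffAt.comp (g := L) (t, x) L.contDiff.contDiffAt hu
  have hW : (fun q => u' (P.baseMap q)) =ᶠ[𝓝 ((t, x) : Base n)]
      fun q => Complex.exp (G q) * L (u q) := by
    have : ∀ᶠ q : Base n in 𝓝 (t, x), hat (deriv P.T q.1) = hat (deriv P.T t) :=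
      (continuousAt_fst (p := ((t, x) : Base n))).eventually (hP.eventually_hat hI ht)
    filter_upwards [h, this] with q hq hq'
    rw [hq, psiMap, hq', hL, hatL_apply]
    rfl
  have h0 : u' (P.baseMap (t, x)) = Complex.exp (G (t, x)) * L (u (t, x)) := hW.self_of_nhds
  -- first derivatives
  have c1 : ∀ z, fderiv ℝ u' (P.baseMap (t, x)) (fderiv ℝ P.baseMap (t, x) z)
      = Complex.exp (G (t, x)) * (L (u (t, x)) * fderiv ℝ G (t, x) z + L (fderiv ℝ u (t, x) z)) := by
    intro z
    rw [← fderiv_comp_apply' hu' hb, hW.fderiv_eq, fderiv_exp_mul (diffAt hGs) (diffAt hLs),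
      fderiv_clm_comp L (diffAt hu)]
  have c2 : ∀ a, D2 u' (P.baseMap (t, x)) (fderiv ℝ P.baseMap (t, x) (ex a))
        (fderiv ℝ P.baseMap (t, x) (ex a))
      = Complex.exp (G (t, x)) * (L (u (t, x)) * fderiv ℝ G (t, x) (ex a) ^ 2
        + 2 * fderiv ℝ G (t, x) (ex a) * L (fderiv ℝ u (t, x) (ex a))
        + L (u (t, x)) * D2 G (t, x) (ex a) (ex a) + L (D2 u (t, x) (ex a) (ex a))) := by
    intro a
    have e := D2_comp hu' hb (ex a) (ex a)
    rw [hP.D2_baseMap_ex hI ht, map_zero, add_zero] at e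
    rw [← e, D2_congr hW, D2_exp_mul hGs hLs, fderiv_clm_comp L (diffAt hu), D2_clm_comp L hu]
  -- the Laplacian
  have c3 : ∑ a, D2 u' (P.baseMap (t, x)) (fderiv ℝ P.baseMap (t, x) (ex a))
        (fderiv ℝ P.baseMap (t, x) (ex a))
      = |deriv P.T t| • ∑ b, D2 u' (P.baseMap (t, x)) (ex b) (ex b) := by
    have e : ∀ a, D2 u' (P.baseMap (t, x)) (fderiv ℝ P.baseMap (t, x) (ex a))
          (fderiv ℝ P.baseMap (t, x) (ex a))
        = |deriv P.T t| • ∑ b, ∑ c, (P.O b a * P.O c a)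
          • D2 u' (P.baseMap (t, x)) (ex c) (ex b) := by
      intro a
      rw [hP.fderiv_baseMap_ex hI ht]
      simp only [map_smul, map_sum, smul_apply, sum_apply, Finset.smul_sum, smul_smul]
      refine Finset.sum_congr rfl fun b _ => Finset.sum_congr rfl fun c _ => ?_
      congr 1
      rw [← hrr]; ring
    simp only [e]
    rw [← Finset.smul_sum, Finset.sum_comm]
    congr 1
    refine Finset.sum_congr rfl fun b _ => ?_
    rw [Finset.sum_comm]
    simp only [← Finset.sum_smul, hP.sum_row]
    simp
  set γ : Fin n → ℝ := fun a => P.eps t * iteratedDeriv 2 P.T t / (2 * P.scale t) * x a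
    + ∑ b, P.O b a * deriv (P.X b) t with hγ
  -- The new t-direction is reached by correcting the image of `et` with images of the spatial
  -- vectors; this yields the new t-derivative from the derivatives along the images.
  have c4 : fderiv ℝ P.baseMap (t, x) et = deriv P.T t • et
      + (P.scale t)⁻¹ • ∑ a, γ a • fderiv ℝ P.baseMap (t, x) (ex a) := by
    refine Prod.ext ?_ (funext fun b => ?_)
    · simp only [Prod.fst_add, Prod.smul_fst, Prod.fst_sum, hP.fderiv_baseMap_fst hI ht]
      simp [et, ex]
    · simp only [Prod.snd_add, Prod.smul_snd, Prod.snd_sum, Pi.add_apply, Pi.smul_apply,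
        Finset.sum_apply, hP.fderiv_baseMap_snd hI ht]
      have e := hP.sum_mul_transpose (fun b => deriv (P.X b) t) b
      simp only [smul_eq_mul] at e
      have e2 : ∑ a, P.O b a * γ a = P.eps t * iteratedDeriv 2 P.T t / (2 * P.scale t)
          * ∑ a, P.O b a * x a + deriv (P.X b) t := by
        simp only [hγ, mul_add, Finset.sum_add_distrib, e]
        rw [Finset.mul_sum]
        congr 1
        exact Finset.sum_congr rfl fun a _ => by ring
      rw [← e2]
      simp only [et, ex, Pi.single_apply, smul_eq_mul, Pi.zero_apply, mul_zero, zero_mul, one_mul,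
        mul_ite, mul_one, Finset.sum_ite_eq', Finset.mem_univ, if_true, Finset.sum_const_zero,
        zero_add, add_zero, Finset.mul_sum]
      refine Finset.sum_congr rfl fun a _ => ?_
      field_simp
  have c5 : ∀ a, Complex.I * ((P.eps t * ((P.scale t)⁻¹ * γ a) : ℝ) : ℂ)
      = 2 * fderiv ℝ G (t, x) (ex a) := by
    intro a
    rw [hP.fderiv_expo_ex hI ht]
    have e : P.eps t * ((P.scale t)⁻¹ * γ a) = 2 * (2 * P.quadCoef t * x a + P.linCoef a t) :=
      hP.gradient_identity ht x a
    rw [e]; push_cast; ring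
  have c6 : ((deriv P.T t : ℝ) : ℂ) * fderiv ℝ u' (P.baseMap (t, x)) et
      = Complex.exp (G (t, x)) * (L (u (t, x)) * fderiv ℝ G (t, x) et + L (fderiv ℝ u (t, x) et))
        - ∑ a, (((P.scale t)⁻¹ * γ a : ℝ) : ℂ) * (Complex.exp (G (t, x))
          * (L (u (t, x)) * fderiv ℝ G (t, x) (ex a) + L (fderiv ℝ u (t, x) (ex a)))) := by
    have e := c1 et
    rw [c4, map_add, map_smul, map_smul, map_sum] at e
    simp only [map_smul, c1, Finset.smul_sum, smul_smul] at e
    rw [← e]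
    simp only [Complex.real_smul]
    ring
  -- The correction terms of the t-derivative now equal the cross terms ∇G·∇u of the Laplacian plus
  -- twice the |∇G|² term, so the first cancels and the second changes sign.
  have c7 : Complex.I * P.eps t * ∑ a, (((P.scale t)⁻¹ * γ a : ℝ) : ℂ) * (Complex.exp (G (t, x))
          * (L (u (t, x)) * fderiv ℝ G (t, x) (ex a) + L (fderiv ℝ u (t, x) (ex a))))
      = Complex.exp (G (t, x)) * (2 * L (u (t, x)) * ∑ a, fderiv ℝ G (t, x) (ex a) ^ 2
        + 2 * ∑ a, fderiv ℝ G (t, x) (ex a) * L (fderiv ℝ u (t, x) (ex a))) := by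
    rw [Finset.mul_sum, mul_add, Finset.mul_sum, Finset.mul_sum, Finset.mul_sum, Finset.mul_sum,
      ← Finset.sum_add_distrib]
    refine Finset.sum_congr rfl fun a _ => ?_
    have e := c5 a
    push_cast at e ⊢
    linear_combination (Complex.exp (G (t, x))
      * (L (u (t, x)) * fderiv ℝ G (t, x) (ex a) + L (fderiv ℝ u (t, x) (ex a)))) * e
  have c8 : ∑ a, D2 u' (P.baseMap (t, x)) (fderiv ℝ P.baseMap (t, x) (ex a))
        (fderiv ℝ P.baseMap (t, x) (ex a))
      = Complex.exp (G (t, x)) * (L (u (t, x)) * ∑ a, fderiv ℝ G (t, x) (ex a) ^ 2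
        + 2 * ∑ a, fderiv ℝ G (t, x) (ex a) * L (fderiv ℝ u (t, x) (ex a))
        + L (u (t, x)) * ∑ a, D2 G (t, x) (ex a) (ex a) + ∑ a, L (D2 u (t, x) (ex a) (ex a))) := by
    simp only [c2]
    rw [← Finset.mul_sum]
    simp only [Finset.sum_add_distrib, Finset.mul_sum, mul_assoc]
  rw [c3] at c8
  have c9 := hP.abs_mul_sMap hI ht x s
  have d1 := hP.fderiv_expo_et hI ht x
  have d2 : ∑ a, fderiv ℝ G (t, x) (ex a) ^ 2 = -((∑ a, (2 * P.quadCoef t * x a + P.linCoef a t)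
      * (2 * P.quadCoef t * x a + P.linCoef a t) : ℝ) : ℂ) := by
    simp only [hG, hP.fderiv_expo_ex hI ht]
    push_cast
    rw [← Finset.sum_neg_distrib]
    refine Finset.sum_congr rfl fun a _ => ?_
    rw [mul_pow, Complex.I_sq]; ring
  have d3 : ∑ a, D2 G (t, x) (ex a) (ex a) = Complex.I * n * ((2 * P.quadCoef t : ℝ) : ℂ) := by
    simp only [hG, hP.D2_expo_ex hI ht]
    simp
    ring
  simp only [dx_dx_eq _ hu, dx_dx_eq _ hu', dt_eq]
  have d4 : hat (deriv P.T t) (Complex.I * fderiv ℝ u (t, x) et + ∑ a, D2 u (t, x) (ex a) (ex a)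
        + s * u (t, x))
      = P.eps t * Complex.I * L (fderiv ℝ u (t, x) et) + ∑ a, L (D2 u (t, x) (ex a) (ex a))
        + hat (deriv P.T t) s * L (u (t, x)) := by
    rw [hat_add, hat_add, hat_mul, hat_mul, hat_I hne, ← hatL_apply _ (∑ a, _), map_sum, hL]
    simp only [hatL_apply]
    rfl
  rw [d4, h0]
  rw [← hG] at d1
  rw [d1] at c6
  rw [d2] at c7 c8
  rw [d3, Complex.real_smul] at c8
  have habs' : ((|deriv P.T t| : ℝ) : ℂ) = P.eps t * ((deriv P.T t : ℝ) : ℂ) := by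
    rw [habs]; push_cast; ring
  push_cast at c6 c7 c8 c9 ⊢
  rw [habs'] at *
  generalize Complex.exp (G (t, x)) = Ex at *
  linear_combination Complex.I * P.eps t * c6 - c7 + c8 + Ex * L (u (t, x)) * c9
    + (Ex * L (u (t, x)) * P.eps t * (((deriv P.quadCoef t : ℝ) : ℂ) * ∑ a, (x a : ℂ) * x a
      + ∑ a, ((deriv (P.linCoef a) t : ℝ) : ℂ) * x a + ((deriv P.Sig t : ℝ) : ℂ))) * Complex.I_mul_I

end

end Params

end

/-! ### Functions of t on domains with connected time slices -/

section

variable {n : ℕ}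

/-- Open sets with an interval of values of `t` and connected slices of constant `t`. -/
structure TimeDomain (U : Set (Vars n)) : Prop where
  isOpen : IsOpen U
  time_connected : IsPreconnected (varsTime '' U)
  slice_connected : ∀ t : ℝ, IsPreconnected (U ∩ varsTime ⁻¹' {t})

/-- The line through `v` in the direction of `t`. -/
def timeLine (v : Vars n) (s : ℝ) : Vars n := ((s, v.1.2), v.2)

theorem contDiff_timeLine (v : Vars n) : ContDiff ℝ ∞ (timeLine v) := by
  unfold timeLine; fun_prop

theorem hasDerivAt_timeLine (v : Vars n) (s : ℝ) : HasDerivAt (timeLine v) (et, 0) s :=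
  ((hasDerivAt_id s).prodMk (hasDerivAt_const s v.1.2)).prodMk (hasDerivAt_const s v.2)

theorem eventually_timeLine_mem {U : Set (Vars n)} (hU : IsOpen U) {v : Vars n} (hv : v ∈ U) :
    ∀ᶠ s in 𝓝 (varsTime v), timeLine v s ∈ U :=
  (contDiff_timeLine v).continuous.continuousAt.eventually (hU.mem_nhds hv)

theorem isOpen_time_image {U : Set (Vars n)} (hU : IsOpen U) : IsOpen (varsTime '' U) := by
  rw [isOpen_iff_mem_nhds]
  rintro _ ⟨v, hv, rfl⟩
  filter_upwards [eventually_timeLine_mem hU hv] with s hs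
  exact ⟨_, hs, rfl⟩

section

variable {F : Type*} [NormedAddCommGroup F] [NormedSpace ℝ F] {U : Set (Vars n)}

/-- On a fixed slice the derivative of g in the coordinates (x, ψ) vanishes, and the slice is open
in those coordinates and connected. -/
theorem TimeDomain.eq_of_time_eq (hU : TimeDomain U) {g : Vars n → F}
    (hg : ∀ v ∈ U, DifferentiableAt ℝ g v)
    (h0 : ∀ v ∈ U, ∀ w : Base n, w.1 = 0 → ∀ c, fderiv ℝ g v (w, c) = 0) {v v' : Vars n}
    (hv : v ∈ U) (hv' : v' ∈ U) (h : varsTime v = varsTime v') : g v = g v' := by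
  let j : (Fin n → ℝ) × ℂ → Vars n := fun y => ((varsTime v, y.1), y.2)
  have hj : Continuous j := by fun_prop
  have hjd : ∀ y, HasFDerivAt j (((ContinuousLinearMap.inr ℝ ℝ (Fin n → ℝ)).comp
      (ContinuousLinearMap.fst ℝ (Fin n → ℝ) ℂ)).prod (ContinuousLinearMap.snd ℝ (Fin n → ℝ) ℂ)) y := by
    intro y
    refine HasFDerivAt.prodMk ?_ hasFDerivAt_snd
    exact ((hasFDerivAt_const (varsTime v) y).prodMk hasFDerivAt_fst).congr_fderiv (by ext <;> simp)
  have hpre : IsPreconnected (j ⁻¹' U) := by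
    have e : j ⁻¹' U = (fun v : Vars n => (v.1.2, v.2)) '' (U ∩ varsTime ⁻¹' {varsTime v}) := by
      ext y
      constructor
      · intro hy
        exact ⟨j y, ⟨hy, rfl⟩, rfl⟩
      · rintro ⟨z, ⟨hz, hz'⟩, rfl⟩
        have : j (z.1.2, z.2) = z := by
          have hz'' : z.1.1 = varsTime v := hz'
          simp only [j, ← hz'']
        simpa only [Set.mem_preimage, this] using hz
    rw [e]
    exact (hU.slice_connected _).image _ (by fun_prop)
  have hc : ∀ y ∈ j ⁻¹' U, HasFDerivAt (fun y => g (j y)) ((fderiv ℝ g (j y)).comp _) y :=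
    fun y hy => (hg _ hy).hasFDerivAt.comp y (hjd y)
  have key := (hU.isOpen.preimage hj).is_const_of_fderiv_eq_zero (𝕜 := ℝ) hpre
    (f := fun y => g (j y)) (fun y hy => (hc y hy).differentiableAt.differentiableWithinAt)
    (fun y hy => by
      rw [(hc y hy).fderiv]
      ext z
      · exact h0 _ hy _ rfl _
      · exact h0 _ hy _ rfl _)
    (x := (v.1.2, v.2)) (y := (v'.1.2, v'.2)) hv (by
      have : j (v'.1.2, v'.2) = v' := by
        have h' : v'.1.1 = varsTime v := h.symm
        simp only [j, ← h']
      rw [Set.mem_preimage, this]; exact hv')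
  have e : j (v'.1.2, v'.2) = v' := by
    have h' : v'.1.1 = varsTime v := h.symm
    simp only [j, ← h']
  rw [← e]
  exact key

/-- A function that locally depends only on `t` is a function of `t`. -/
theorem TimeDomain.exists_time_function (hU : TimeDomain U) {g : Vars n → F}
    (hg : ∀ v ∈ U, ContDiffAt ℝ ∞ g v)
    (h0 : ∀ v ∈ U, ∀ w : Base n, w.1 = 0 → ∀ c, fderiv ℝ g v (w, c) = 0) :
    ∃ G : ℝ → F, ContDiffOn ℝ ∞ G (varsTime '' U) ∧ (∀ v ∈ U, g v = G (varsTime v)) ∧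
      ∀ v ∈ U, HasDerivAt G (fderiv ℝ g v (et, 0)) (varsTime v) := by
  classical
  -- The chosen point of the slice is immaterial by `TimeDomain.eq_of_time_eq`. Near a time G agrees
  -- with g along a line in the t-direction, which gives smoothness and the derivative.
  let G : ℝ → F := fun t => if h : ∃ v ∈ U, varsTime v = t then g h.choose else 0
  have hG : ∀ v ∈ U, g v = G (varsTime v) := by
    intro v hv
    have h : ∃ w ∈ U, varsTime w = varsTime v := ⟨v, hv, rfl⟩
    simp only [G, dif_pos h]
    exact hU.eq_of_time_eq (fun v hv => diffAt (hg v hv)) h0 hv h.choose_spec.1 h.choose_spec.2.symm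
  have hev : ∀ v ∈ U, G =ᶠ[𝓝 (varsTime v)] fun s => g (timeLine v s) := by
    intro v hv
    filter_upwards [eventually_timeLine_mem hU.isOpen hv] with s hs
    exact (hG _ hs).symm
  refine ⟨G, ?_, hG, fun v hv => ?_⟩
  · rintro _ ⟨v, hv, rfl⟩
    refine ContDiffAt.contDiffWithinAt (ContDiffAt.congr_of_eventuallyEq ?_ (hev v hv))
    exact ContDiffAt.comp (g := g) (varsTime v) (hg v hv) (contDiff_timeLine v).contDiffAt
  · refine HasDerivAt.congr_of_eventuallyEq ?_ (hev v hv)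
    exact HasFDerivAt.comp_hasDerivAt (l := g) (varsTime v) (diffAt (hg v hv)).hasFDerivAt
      (hasDerivAt_timeLine v _)

/-- Connected slices reduce g to a function of t, which has zero derivative on an interval. In this
way the matrix O becomes one constant for the whole domain. -/
theorem TimeDomain.eq_of_fderiv_eq_zero (hU : TimeDomain U) {g : Vars n → F}
    (hg : ∀ v ∈ U, ContDiffAt ℝ ∞ g v) (h0 : ∀ v ∈ U, fderiv ℝ g v = 0) {v v' : Vars n}
    (hv : v ∈ U) (hv' : v' ∈ U) : g v = g v' := by
  obtain ⟨G, hG, hGv, hd⟩ := hU.exists_time_function hg (fun v hv w _ c => by rw [h0 v hv]; rfl)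
  rw [hGv v hv, hGv v' hv']
  refine (isOpen_time_image hU.isOpen).is_const_of_deriv_eq_zero (𝕜 := ℝ) hU.time_connected
    (hG.differentiableOn (by simp)) ?_ ⟨v, hv, rfl⟩ ⟨v', hv', rfl⟩
  rintro _ ⟨w, hw, rfl⟩
  rw [(hd w hw).deriv, h0 w hw]; rfl

end

/-- A smooth function without zeros on an interval has a smooth logarithm. -/
theorem exists_smooth_log {J : Set ℝ} (hJ : IsOpen J) (hc : IsPreconnected J) {θ : ℝ → ℂ}
    (hθ : ContDiffOn ℝ ∞ θ J) (h0 : ∀ t ∈ J, θ t ≠ 0) :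
    ∃ L : ℝ → ℂ, ContDiffOn ℝ ∞ L J ∧ ∀ t ∈ J, Complex.exp (L t) = θ t := by
  rcases J.eq_empty_or_nonempty with rfl | ⟨t₀, ht₀⟩
  · exact ⟨0, contDiffOn_empty, by simp⟩
  have hθa : ∀ t ∈ J, ContDiffAt ℝ ∞ θ t := fun t ht => (hθ t ht).contDiffAt (hJ.mem_nhds ht)
  -- Integrating θ'/θ avoids branch cuts; θ e^{−L} then has zero derivative and equals 1 at t₀.
  let r : ℝ → ℂ := fun t => deriv θ t * (θ t)⁻¹
  have hr : ∀ t ∈ J, ContDiffAt ℝ ∞ r t := fun t ht =>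
    (contDiffAt_deriv (hθa t ht)).mul ((hθa t ht).inv (h0 t ht))
  have hrc : ContinuousOn r J := fun t ht => (hr t ht).continuousAt.continuousWithinAt
  have hord : J.OrdConnected := hc.ordConnected
  let L : ℝ → ℂ := fun t => Complex.log (θ t₀) + ∫ s in t₀..t, r s
  have hL : ∀ t ∈ J, HasDerivAt L (r t) t := by
    intro t ht
    have hint : IntervalIntegrable r MeasureTheory.volume t₀ t :=
      (hrc.mono (hord.uIcc_subset ht₀ ht)).intervalIntegrable
    exact (intervalIntegral.integral_hasDerivAt_right hint
      (hrc.stronglyMeasurableAtFilter hJ t ht) (hr t ht).continuousAt).const_add _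
  refine ⟨L, ?_, fun t ht => ?_⟩
  · rw [contDiffOn_infty_iff_deriv_of_isOpen hJ]
    refine ⟨fun t ht => (hL t ht).differentiableAt.differentiableWithinAt, ?_⟩
    have : ContDiffOn ℝ ∞ r J := fun t ht => (hr t ht).contDiffWithinAt
    exact this.congr fun t ht => (hL t ht).deriv
  · have hd : ∀ t ∈ J, HasDerivAt (fun s => θ s * Complex.exp (-L s)) 0 t := by
      intro t ht
      have h := (hasDerivAt_deriv (hθa t ht)).mul (hL t ht).neg.cexp
      refine h.congr_deriv ?_
      have := h0 t ht
      simp only [r, Pi.neg_apply]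
      field_simp
      ring
    have h := hJ.is_const_of_deriv_eq_zero (𝕜 := ℝ) hc
      (f := fun s => θ s * Complex.exp (-L s))
      (fun t ht => (hd t ht).differentiableAt.differentiableWithinAt)
      (fun t ht => (hd t ht).deriv) ht ht₀
    have h1 : L t₀ = Complex.log (θ t₀) := by simp [L]
    simp only [h1, Complex.exp_neg, Complex.exp_log (h0 t₀ ht₀)] at h
    rw [mul_inv_cancel₀ (h0 t₀ ht₀)] at h
    have := Complex.exp_ne_zero (L t)
    field_simp at h
    exact h.symm

end

/-! ### Integrability of the ψ-coefficient and constancy of the orthogonal matrix -/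

section

variable {n : ℕ} {f : Vars n → Vars n} {v : Vars n}

/-- The coefficient of `ψ` in the `ψ`-component. -/
def psiCoef (f : Vars n → Vars n) (v : Vars n) : ℂ := fderiv ℝ (psiComp f) v (0, 1)

theorem contDiffAt_psiCoef (hf : ContDiffAt ℝ ∞ f v) : ContDiffAt ℝ ∞ (psiCoef f) v :=
  contDiffAt_fderiv_apply (contDiffAt_psiComp hf) (0, 1)

theorem fderiv_psiCoef (hf : ContDiffAt ℝ ∞ f v) (z : Vars n) :
    fderiv ℝ (psiCoef f) v z = D2 (psiComp f) v z (0, 1) :=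
  fderiv_fderiv_apply (contDiffAt_psiComp hf) (0, 1) z

/-- The velocity of the new spatial variables, contracted with the Jacobian matrix, over `T_t`. -/
def drift (f : Vars n → Vars n) (a : Fin n) (v : Vars n) : ℝ :=
  (tau f v)⁻¹ * ∑ b, jac f v b a * (fderiv ℝ (baseComp f) v (et, 0)).2 b

/-- The mixed determining equation with c = 1: the logarithmic x-gradient of the ψ-coefficient is
i/2 times the drift. -/
theorem PsiDetermined.fderiv_psiCoef_ex (hf : ContDiffAt ℝ ∞ f v) (hQ : PsiDetermined f v)
    (a : Fin n) :
    fderiv ℝ (psiCoef f) v (ex a, 0) = Complex.I / 2 * (drift f a v : ℂ) * psiCoef f v := by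
  rw [fderiv_psiCoef hf]
  have := hQ.mixed a 1
  rw [drift, psiCoef]
  push_cast at this ⊢
  rw [div_eq_mul_inv] at this
  linear_combination this / 2

theorem fderiv_drift_ex (hB : ∀ᶠ q in 𝓝 v, BaseDetermined f q) (a d : Fin n) :
    HasFDerivAt (drift f a) (fderiv ℝ (drift f a) v) v ∧
    fderiv ℝ (drift f a) v (ex d, 0)
      = (tau f v)⁻¹ * ∑ b, jac f v b a * (D2 (baseComp f) v (ex d, 0) (et, 0)).2 b := by
  have hv := hB.self_of_nhds
  have hsm := contDiffAt_baseComp hv.smooth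
  have h1 : HasFDerivAt (fun q => ∑ b, jac f q b a * (fderiv ℝ (baseComp f) q (et, 0)).2 b) _ v :=
    HasFDerivAt.fun_sum fun b _ => (hasFDerivAt_jac hv.smooth b a).mul
      (hasFDerivAt_fderiv_apply hsm (dxForm b) (et, 0))
  have h2 : HasFDerivAt (fun q => (tau f q)⁻¹) _ v :=
    (hasDerivAt_inv hv.tau_ne).comp_hasFDerivAt v (hasFDerivAt_tau hv.smooth)
  have h3 : HasFDerivAt (drift f a) _ v := h2.mul h1
  refine ⟨h3.differentiableAt.hasFDerivAt, ?_⟩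
  rw [h3.fderiv]
  have e1 : (D2 (baseComp f) v (ex d, 0) (et, 0)).1 = 0 := by
    rw [D2_symm hsm]; exact BaseDetermined.tau_D2_spatial hB _ _ rfl _
  have e2 : D2 (baseComp f) v (ex d, 0) (ex a, 0) = 0 :=
    BaseDetermined.D2_spatial hB _ _ rfl rfl _ _
  simp only [add_apply, smul_apply, sum_apply, ContinuousLinearMap.comp_apply,
    ContinuousLinearMap.flip_apply, dxForm_apply, dtForm_apply, e1, e2, smul_eq_mul]
  simp

theorem psiCoef_ne_zero (hQ : PsiDetermined f v) : psiCoef f v ≠ 0 := fun h =>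
  one_ne_zero (hQ.ne_zero 1 h)

/-- Integrability of the equations for the coefficient of `ψ`. -/
theorem jac_mul_D2_symm (hB : ∀ᶠ q in 𝓝 v, BaseDetermined f q)
    (hQ : ∀ᶠ q in 𝓝 v, PsiDetermined f q) (a d : Fin n) :
    ∑ b, jac f v b a * (D2 (baseComp f) v (ex d, 0) (et, 0)).2 b
      = ∑ b, jac f v b d * (D2 (baseComp f) v (ex a, 0) (et, 0)).2 b := by
  have hv := hB.self_of_nhds
  have hcs := contDiffAt_psiCoef hv.smooth
  have key : ∀ a d, D2 (psiCoef f) v (ex d, 0) (ex a, 0)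
      = Complex.I / 2 * (fderiv ℝ (drift f a) v (ex d, 0) : ℂ) * psiCoef f v
        + Complex.I / 2 * (drift f a v : ℂ)
          * (Complex.I / 2 * (drift f d v : ℂ) * psiCoef f v) := by
    intro a d
    rw [← fderiv_fderiv_apply hcs]
    have h1 : (fun q => fderiv ℝ (psiCoef f) q (ex a, 0)) =ᶠ[𝓝 v]
        fun q => Complex.I / 2 * (drift f a q : ℂ) * psiCoef f q := by
      filter_upwards [hB, hQ] with q h1 h2
      exact h2.fderiv_psiCoef_ex h1.smooth a
    have h2 : HasFDerivAt (fun q => Complex.I / 2 * (drift f a q : ℂ) * psiCoef f q) _ v :=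
      (((Complex.ofRealCLM.hasFDerivAt.comp v (fderiv_drift_ex hB a d).1).const_mul
        (Complex.I / 2)).mul (diffAt hcs).hasFDerivAt)
    rw [h1.fderiv_eq, h2.fderiv]
    simp only [add_apply, smul_apply, ContinuousLinearMap.comp_apply, Complex.ofRealCLM_apply,
      smul_eq_mul, hQ.self_of_nhds.fderiv_psiCoef_ex hv.smooth d, Function.comp_apply]
    ring
  -- Equality of mixed derivatives: the product of the two drifts is symmetric, and the
  -- ψ-coefficient is nonzero, so the x-Jacobian of the drift itself must be symmetric.
  have e := D2_symm hcs (ex d, 0) (ex a, 0)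
  rw [key a d, key d a] at e
  have hc := psiCoef_ne_zero hQ.self_of_nhds
  have e2 : (fderiv ℝ (drift f a) v (ex d, 0) : ℂ) = (fderiv ℝ (drift f d) v (ex a, 0) : ℂ) := by
    have : Complex.I / 2 * psiCoef f v ≠ 0 := mul_ne_zero (by simp) hc
    refine mul_left_cancel₀ this ?_
    linear_combination e
  have e3 : fderiv ℝ (drift f a) v (ex d, 0) = fderiv ℝ (drift f d) v (ex a, 0) := by
    exact_mod_cast e2
  rw [(fderiv_drift_ex hB a d).2, (fderiv_drift_ex hB d a).2] at e3
  exact mul_left_cancel₀ (inv_ne_zero hv.tau_ne) e3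

/-- The Jacobian matrix evolves by scaling. -/
theorem D2_time_spatial (hB : ∀ᶠ q in 𝓝 v, BaseDetermined f q)
    (hQ : ∀ᶠ q in 𝓝 v, PsiDetermined f q) (a b : Fin n) :
    (D2 (baseComp f) v (et, 0) (ex a, 0)).2 b
      = (D2 (baseComp f) v (et, 0) (et, 0)).1 / (2 * tau f v) * jac f v b a := by
  have hv := hB.self_of_nhds
  have hsm := contDiffAt_baseComp hv.smooth
  set N : Fin n → Fin n → ℝ := fun b a => (D2 (baseComp f) v (et, 0) (ex a, 0)).2 b with hN
  set κ := (D2 (baseComp f) v (et, 0) (et, 0)).1 with hκ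
  -- With J the Jacobian matrix and N = J_t, integrability says that JᵀN is symmetric, while the
  -- t-derivative of JᵀJ = |τ| fixes its symmetric part. Hence JᵀN is scalar and N a multiple of J:
  -- the antisymmetric part, an infinitesimal rotation, is excluded.
  have s1 : ∀ a d, ∑ b, jac f v b a * N b d = ∑ b, jac f v b d * N b a := by
    intro a d
    have := jac_mul_D2_symm hB hQ a d
    simpa only [D2_symm hsm (ex _, 0) (et, 0)] using this
  have s2 : ∀ a c, ∑ b, N b a * jac f v b c
      = if a = c then Real.sign (tau f v) * κ / 2 else 0 := by
    intro a c
    have e := BaseDetermined.gram_deriv hB (et, 0) a c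
    rw [Finset.sum_add_distrib] at e
    have e1 : ∑ b, N b a * jac f v b c = ∑ b, jac f v b a * N b c := by
      rw [s1 a c]; exact Finset.sum_congr rfl fun b _ => mul_comm _ _
    change ∑ b, N b a * jac f v b c + ∑ b, jac f v b a * N b c = _ at e
    rw [← e1] at e
    split_ifs at e ⊢ <;> linarith
  have s3 : (fun b => N b a - κ / (2 * tau f v) * jac f v b a) = 0 := by
    refine eq_zero_of_gram (abs_ne_zero.2 hv.tau_ne) hv.gram fun c => ?_
    have : ∑ b, (N b a - κ / (2 * tau f v) * jac f v b a) * jac f v b c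
        = ∑ b, N b a * jac f v b c
          - κ / (2 * tau f v) * ∑ b, jac f v b a * jac f v b c := by
      rw [Finset.mul_sum, ← Finset.sum_sub_distrib]
      exact Finset.sum_congr rfl fun b _ => by ring
    rw [this, s2, hv.gram]
    have ht := hv.tau_ne
    split_ifs
    · rw [abs_eq_sign_mul]; field_simp; ring
    · ring
  have := congrFun s3 b
  simp only [Pi.zero_apply, sub_eq_zero] at this
  exact this

/-- The normalized Jacobian matrix is locally constant. -/
theorem fderiv_normalized_jac (hB : ∀ᶠ q in 𝓝 v, BaseDetermined f q)
    (hQ : ∀ᶠ q in 𝓝 v, PsiDetermined f q) (a b : Fin n) :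
    ContDiffAt ℝ ∞ (fun q => jac f q b a * (√|tau f q|)⁻¹) v ∧
    fderiv ℝ (fun q => jac f q b a * (√|tau f q|)⁻¹) v = 0 := by
  have hv := hB.self_of_nhds
  have hsm := contDiffAt_baseComp hv.smooth
  have hpos : 0 < |tau f v| := abs_pos.2 hv.tau_ne
  have hr := Real.sqrt_pos.2 hpos
  have c1 : ContDiffAt ℝ ∞ (fun q => jac f q b a) v :=
    (dxForm b).contDiff.contDiffAt.comp v (contDiffAt_fderiv_apply hsm (ex a, 0))
  have c2 : ContDiffAt ℝ ∞ (tau f) v :=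
    (dtForm (n := n)).contDiff.contDiffAt.comp v (contDiffAt_fderiv_apply hsm (et, 0))
  refine ⟨c1.mul (((c2.abs hv.tau_ne).sqrt hpos.ne').inv hr.ne'), ?_⟩
  have h1 := (hasFDerivAt_abs_tau hv.smooth hv.tau_ne).sqrt hpos.ne'
  have h2 : HasFDerivAt (fun q => (√|tau f q|)⁻¹) _ v :=
    (hasDerivAt_inv hr.ne').comp_hasFDerivAt v h1
  have h3 := (hasFDerivAt_jac hv.smooth b a).fun_mul h2
  rw [h3.fderiv]
  have key : ∀ z, (D2 (baseComp f) v z (ex a, 0)).2 b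
      = (D2 (baseComp f) v z (et, 0)).1 / (2 * tau f v) * jac f v b a := by
    intro z
    have hz : z = z.1.1 • (et, 0) + (z.1 - z.1.1 • et, z.2) := by
      refine Prod.ext ?_ ?_ <;> simp
    have h0 : (z.1 - z.1.1 • et : Base n).1 = 0 := by simp [et]
    rw [hz]
    simp only [map_add, map_smul, add_apply, smul_apply, Prod.snd_add, Prod.fst_add, Prod.smul_fst,
      Prod.smul_snd, Pi.add_apply, Pi.smul_apply, D2_time_spatial hB hQ]
    rw [BaseDetermined.D2_spatial hB _ _ h0 rfl, D2_symm hsm (z.1 - z.1.1 • et, z.2) (et, 0),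
      BaseDetermined.tau_D2_spatial hB _ _ h0]
    simp only [smul_eq_mul, Prod.snd_zero, Pi.zero_apply]
    ring
  refine ContinuousLinearMap.ext fun z => ?_
  simp only [add_apply, smul_apply, ContinuousLinearMap.comp_apply, ContinuousLinearMap.flip_apply,
    dxForm_apply, dtForm_apply, smul_eq_mul, key, zero_apply]
  have ht := hv.tau_ne
  have hs : √|tau f v| ^ 2 = |tau f v| := Real.sq_sqrt hpos.le
  have hsg : |tau f v| = Real.sign (tau f v) * tau f v := abs_eq_sign_mul _
  have hsg2 := sign_mul_self ht
  generalize √|tau f v| = r at *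
  have hr0 := hr.ne'
  rw [hs, hsg]
  have hsg0 : Real.sign (tau f v) ≠ 0 := by intro h; rw [h] at hsg2; norm_num at hsg2
  field_simp
  ring

end

/-! ### Integration of the determining equations -/

section

variable {n : ℕ} {f : Vars n → Vars n} {U : Set (Vars n)}

theorem fderiv_baseComp_spatial {v : Vars n} (hB : BaseDetermined f v) (w : Base n) (hw : w.1 = 0)
    (c : ℂ) (b : Fin n) : (fderiv ℝ (baseComp f) v (w, c)).2 b = ∑ a, jac f v b a * w.2 a := by
  have e : ((w, c) : Vars n) = ∑ a, w.2 a • ((ex a, 0) : Vars n) + (0, c) := by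
    have := base_eq_sum w
    rw [hw, zero_smul, zero_add] at this
    refine Prod.ext ?_ ?_
    · rw [Prod.fst_add, Prod.fst_sum]; simpa using this
    · simp [Prod.snd_sum]
  rw [e, map_add, map_sum, hB.vertical, add_zero]
  simp only [map_smul, Prod.snd_sum, Finset.sum_apply, Prod.smul_snd, Pi.smul_apply, smul_eq_mul]
  exact Finset.sum_congr rfl fun a _ => mul_comm _ _

/-- Commuting with i up to the sign of T_t means being complex linear or antilinear, so the value at
1 determines the map. -/
theorem fderiv_psiComp_vertical {v : Vars n} (hB : BaseDetermined f v) (hQ : PsiDetermined f v)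
    (z : ℂ) : fderiv ℝ (psiComp f) v (0, z) = psiCoef f v * hat (tau f v) z := by
  have hz : ((0, z) : Vars n) = z.re • (0, 1) + z.im • (0, Complex.I) := by
    exact Prod.ext (by simp) (by simp)
  have h1 := hQ.commute 1
  rw [mul_one] at h1
  have h2 : fderiv ℝ (psiComp f) v (0, Complex.I)
      = Real.sign (tau f v) • (Complex.I * psiCoef f v) := by
    rw [psiCoef, h1, smul_smul, sign_mul_self hB.tau_ne, one_smul]
  rw [hz, map_add, map_smul, map_smul, h2]
  change z.re • psiCoef f v + _ = _
  have h3 : hat (tau f v) z = z.re + z.im * (Real.sign (tau f v) * Complex.I) := by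
    conv_lhs => rw [← Complex.re_add_im z]
    rw [hat_add, hat_mul, hat_ofReal, hat_ofReal, hat_I hB.tau_ne]
  rw [h3]
  simp only [Complex.real_smul]
  ring

/-- The `(t, x)`-components of an admissible transformation and the coefficient of `ψ`. -/
theorem TimeDomain.exists_params (hU : TimeDomain U) (hB : ∀ v ∈ U, BaseDetermined f v)
    (hQ : ∀ v ∈ U, PsiDetermined f v) :
    ∃ P : Params n, P.IsValidOn (varsTime '' U) ∧ ∀ v ∈ U, (f v).1 = P.baseMap v.1 ∧
      ∀ z, fderiv ℝ (psiComp f) v (0, z)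
        = Complex.exp (P.expo v.1) * hat (deriv P.T v.1.1) z := by
  rcases U.eq_empty_or_nonempty with rfl | ⟨v₀, hv₀⟩
  -- On the empty domain all conditions are vacuous except the orthogonality of O, hence the
  -- identity matrix.
  · refine ⟨⟨0, 1, 0, 0, 0⟩, ?_, by simp⟩
    rw [Set.image_empty]
    exact ⟨contDiffOn_empty, by simp, one_mem _, fun _ => contDiffOn_empty, contDiffOn_empty,
      contDiffOn_empty⟩
  set J := varsTime '' U with hJ
  have hJo : IsOpen J := isOpen_time_image hU.isOpen
  have hJm : ∀ v ∈ U, v.1.1 ∈ J := fun v hv => ⟨v, hv, rfl⟩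
  have evB : ∀ v ∈ U, ∀ᶠ q in 𝓝 v, BaseDetermined f q := fun v hv => by
    filter_upwards [hU.isOpen.mem_nhds hv] with q hq using hB q hq
  have evQ : ∀ v ∈ U, ∀ᶠ q in 𝓝 v, PsiDetermined f q := fun v hv => by
    filter_upwards [hU.isOpen.mem_nhds hv] with q hq using hQ q hq
  have hbs : ∀ v ∈ U, ContDiffAt ℝ ∞ (baseComp f) v := fun v hv =>
    contDiffAt_baseComp (hB v hv).smooth
  have hcomp : ∀ (L : Base n →L[ℝ] ℝ), ∀ v ∈ U, ∀ z,
      fderiv ℝ (fun q => L (baseComp f q)) v z = L (fderiv ℝ (baseComp f) v z) := by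
    intro L v hv z
    have : HasFDerivAt (fun q => L (baseComp f q)) (L.comp (fderiv ℝ (baseComp f) v)) v :=
      L.hasFDerivAt.comp v (diffAt (hbs v hv)).hasFDerivAt
    rw [this.fderiv]; rfl
  have hcs : ∀ (L : Base n →L[ℝ] ℝ), ∀ v ∈ U, ContDiffAt ℝ ∞ (fun q => L (baseComp f q)) v :=
    fun L v hv => ContDiffAt.comp (g := L) v L.contDiff.contDiffAt (hbs v hv)
  -- the function `T`
  obtain ⟨T, hTs, hT, hTd⟩ := hU.exists_time_function (g := fun q => dtForm (baseComp f q))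
    (hcs dtForm) (fun v hv w hw c => by
      rw [hcomp _ v hv]; exact (hB v hv).fst_spatial w hw c)
  have hτ : ∀ v ∈ U, deriv T v.1.1 = tau f v := fun v hv => by
    have := (hTd v hv).deriv
    rw [hcomp _ v hv] at this
    exact this
  -- the matrix `O`
  let O : Matrix (Fin n) (Fin n) ℝ := Matrix.of fun b a => jac f v₀ b a * (√|tau f v₀|)⁻¹
  have hO : ∀ v ∈ U, ∀ b a, jac f v b a = √|tau f v| * O b a := by
    intro v hv b a
    have e := hU.eq_of_fderiv_eq_zero
      (fun v hv => (fderiv_normalized_jac (evB v hv) (evQ v hv) a b).1)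
      (fun v hv => (fderiv_normalized_jac (evB v hv) (evQ v hv) a b).2) hv hv₀
    have hr : √|tau f v| ≠ 0 := (Real.sqrt_pos.2 (abs_pos.2 (hB v hv).tau_ne)).ne'
    change jac f v b a * (√|tau f v|)⁻¹ = O b a at e
    rw [← e]; field_simp
  have hOo : O ∈ Matrix.orthogonalGroup (Fin n) ℝ := by
    rw [Matrix.mem_orthogonalGroup_iff']
    ext a c
    rw [Matrix.mul_apply, Matrix.one_apply]
    have e := (hB v₀ hv₀).gram a c
    have hpos := abs_pos.2 (hB v₀ hv₀).tau_ne
    have hr : √|tau f v₀| ≠ 0 := (Real.sqrt_pos.2 hpos).ne'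
    have hrr : √|tau f v₀| * √|tau f v₀| = |tau f v₀| := Real.mul_self_sqrt hpos.le
    simp only [hO v₀ hv₀] at e
    have e2 : ∑ b, √|tau f v₀| * O b a * (√|tau f v₀| * O b c)
        = |tau f v₀| * ∑ b, O b a * O b c := by
      rw [Finset.mul_sum]
      exact Finset.sum_congr rfl fun b _ => by linear_combination O b a * O b c * hrr
    rw [e2] at e
    have e3 : ∑ b, O b a * O b c = if a = c then 1 else 0 := by
      refine mul_left_cancel₀ hpos.ne' ?_
      rw [e]; split_ifs <;> simp
    simpa [Matrix.star_apply] using e3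
  have hTne : ∀ t ∈ J, deriv T t ≠ 0 := by
    rintro _ ⟨v, hv, rfl⟩
    have := hτ v hv
    change deriv T v.1.1 ≠ 0
    rw [this]; exact (hB v hv).tau_ne
  -- the functions `X`
  let P₀ : Params n := ⟨T, O, 0, 0, 0⟩
  have hP₀ : P₀.IsValidOn J := ⟨hTs, hTne, hOo, fun _ => contDiffOn_const, contDiffOn_const,
    contDiffOn_const⟩
  have hX : ∀ b, ∃ X : ℝ → ℝ, ContDiffOn ℝ ∞ X J ∧
      ∀ v ∈ U, (f v).1.2 b = P₀.xMap v.1.1 v.1.2 b + X v.1.1 := by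
    intro b
    have s1 : ∀ v ∈ U, ContDiffAt ℝ ∞ (fun q : Vars n => P₀.xMap q.1.1 q.1.2 b) v := fun v hv =>
      ContDiffAt.comp (g := fun q : Base n => P₀.xMap q.1 q.2 b) v
        (hP₀.contDiffAt_xMap hJo (hJm v hv) v.1.2 b) contDiffAt_fst
    have s2 : ∀ v ∈ U, HasFDerivAt (fun q : Vars n => P₀.xMap q.1.1 q.1.2 b) _ v := fun v hv =>
      HasFDerivAt.comp (g := fun q : Base n => P₀.xMap q.1 q.2 b) v
        (hP₀.hasFDerivAt_xMap hJo (hJm v hv) v.1.2 b) hasFDerivAt_fst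
    obtain ⟨X, hXs, hX, -⟩ := hU.exists_time_function
      (g := fun q => dxForm b (baseComp f q) - P₀.xMap q.1.1 q.1.2 b)
      (fun v hv => (hcs (dxForm b) v hv).sub (s1 v hv)) (fun v hv w hw c => by
        rw [fderiv_fun_sub (diffAt (hcs (dxForm b) v hv)) (s2 v hv).differentiableAt, (s2 v hv).fderiv]
        rw [sub_apply, hcomp (dxForm b) v hv, dxForm_apply,
          fderiv_baseComp_spatial (hB v hv) w hw c]
        simp only [hO v hv, ContinuousLinearMap.comp_apply, ContinuousLinearMap.coe_fst', add_apply, sum_apply,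
          smul_apply, ContinuousLinearMap.smulRight_apply, dtForm_apply, dxForm_apply, hw,
          zero_mul, zero_add, smul_eq_mul]
        have : P₀.scale v.1.1 = √|tau f v| := by rw [Params.scale, ← hτ v hv]
        rw [this, sub_self])
    refine ⟨X, hXs, fun v hv => ?_⟩
    have := hX v hv
    change (f v).1.2 b - P₀.xMap v.1.1 v.1.2 b = X v.1.1 at this
    linarith
  choose X hXs hX using hX
  -- the exponent
  let P₁ : Params n := ⟨T, O, X, 0, 0⟩
  have hP₁ : P₁.IsValidOn J := ⟨hTs, hTne, hOo, hXs, contDiffOn_const, contDiffOn_const⟩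
  have hbase : ∀ v ∈ U, baseComp f v = P₁.baseMap v.1 := by
    intro v hv
    refine Prod.ext (hT v hv) (funext fun b => ?_)
    have e := hX b v hv
    change (f v).1.2 b = _
    rw [e]
    simp [Params.baseMap, Params.xMap, P₀, P₁]
  have hbd : ∀ v ∈ U, ∀ w c, fderiv ℝ (baseComp f) v (w, c) = fderiv ℝ P₁.baseMap v.1 w := by
    intro v hv w c
    have e : baseComp f =ᶠ[𝓝 v] fun q => P₁.baseMap q.1 := by
      filter_upwards [hU.isOpen.mem_nhds hv] with q hq using hbase q hq
    have h : HasFDerivAt (fun q : Vars n => P₁.baseMap q.1) _ v :=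
      HasFDerivAt.comp (g := P₁.baseMap) v
        (diffAt (hP₁.contDiffAt_baseMap hJo (hJm v hv) v.1.2)).hasFDerivAt hasFDerivAt_fst
    rw [e.fderiv_eq, h.fderiv]
    rfl
  -- The drift is twice the gradient of the phase, so the phase factor with Σ = Z = 0 has the same
  -- logarithmic x-gradient as the ψ-coefficient.
  have hdrift : ∀ v ∈ U, ∀ a, drift f a v
      = 2 * (2 * P₁.quadCoef v.1.1 * v.1.2 a + P₁.linCoef a v.1.1) := by
    intro v hv a
    have ht := hJm v hv
    have hne := (hB v hv).tau_ne
    rw [← hP₁.gradient_identity ht v.1.2 a, drift]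
    have e1 : ∀ b, (fderiv ℝ (baseComp f) v (et, 0)).2 b
        = P₁.eps v.1.1 * iteratedDeriv 2 P₁.T v.1.1 / (2 * P₁.scale v.1.1)
          * ∑ a, P₁.O b a * v.1.2 a + deriv (P₁.X b) v.1.1 := by
      intro b
      rw [hbd v hv, hP₁.fderiv_baseMap_snd hJo ht v.1.2 et b]
      simp [et]
    have e2 : √|tau f v| = P₁.scale v.1.1 := by rw [Params.scale, ← hτ v hv]
    have e3 : ∀ b, jac f v b a = P₁.scale v.1.1 * P₁.O b a := fun b => by
      rw [hO v hv, e2]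
    simp only [e1, e3, mul_add, Finset.sum_add_distrib]
    have e4 := hP₁.sum_transpose_mul v.1.2 a
    have e5 : ∑ b, P₁.scale v.1.1 * P₁.O b a * (P₁.eps v.1.1 * iteratedDeriv 2 P₁.T v.1.1
          / (2 * P₁.scale v.1.1) * ∑ a, P₁.O b a * v.1.2 a)
        = P₁.scale v.1.1 * (P₁.eps v.1.1 * iteratedDeriv 2 P₁.T v.1.1
          / (2 * P₁.scale v.1.1) * v.1.2 a) := by
      conv_rhs => rw [← e4]
      rw [Finset.mul_sum, Finset.mul_sum]
      exact Finset.sum_congr rfl fun b _ => by ring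
    have e6 : ∑ b, P₁.scale v.1.1 * P₁.O b a * deriv (P₁.X b) v.1.1
        = P₁.scale v.1.1 * ∑ b, P₁.O b a * deriv (P₁.X b) v.1.1 := by
      rw [Finset.mul_sum]; exact Finset.sum_congr rfl fun b _ => by ring
    rw [e5, e6]
    have hr0 := (hP₁.scale_pos ht).ne'
    have e7 : (tau f v)⁻¹ * P₁.scale v.1.1 = P₁.eps v.1.1 * (P₁.scale v.1.1)⁻¹ := by
      have h1 : P₁.scale v.1.1 * P₁.scale v.1.1 = P₁.eps v.1.1 * tau f v := by
        rw [Params.IsValidOn.scale_sq, abs_eq_sign_mul, ← hτ v hv]; rfl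
      field_simp
      linarith
    linear_combination (P₁.eps v.1.1 * iteratedDeriv 2 P₁.T v.1.1
          / (2 * P₁.scale v.1.1) * v.1.2 a + ∑ b, P₁.O b a * deriv (P₁.X b) v.1.1) * e7
  have hθs : ∀ v ∈ U, ContDiffAt ℝ ∞ (fun q : Vars n => -P₁.expo q.1) v := fun v hv =>
    (ContDiffAt.comp (g := P₁.expo) v
      (hP₁.contDiffAt_expo hJo (hJm v hv) v.1.2) contDiffAt_fst).neg
  have hpc : ∀ v ∈ U, ContDiffAt ℝ ∞ (psiCoef f) v := fun v hv =>
    contDiffAt_psiCoef (hB v hv).smooth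
  -- The quotient of the ψ-coefficient by that phase factor is a function of t alone: x drops out by
  -- `hdrift`, and ψ by the vanishing second ψ-derivatives.
  obtain ⟨θ, hθs', hθ, -⟩ := hU.exists_time_function
    (g := fun q => Complex.exp (-P₁.expo q.1) * psiCoef f q)
    (fun v hv => (hθs v hv).cexp.mul (hpc v hv)) (fun v hv w hw c => by
      have ht := hJm v hv
      rw [fderiv_exp_mul (diffAt (hθs v hv)) (diffAt (hpc v hv))]
      have h1 : HasFDerivAt (fun q : Vars n => -P₁.expo q.1) _ v :=
        (HasFDerivAt.comp (g := P₁.expo) v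
          (diffAt (hP₁.contDiffAt_expo hJo ht v.1.2)).hasFDerivAt hasFDerivAt_fst).neg
      rw [h1.fderiv]
      have e : ((w, c) : Vars n) = ∑ a, w.2 a • ((ex a, 0) : Vars n) + (0, c) := by
        have := base_eq_sum w
        rw [hw, zero_smul, zero_add] at this
        refine Prod.ext ?_ ?_
        · rw [Prod.fst_add, Prod.fst_sum]; simpa using this
        · simp [Prod.snd_sum]
      have e1 : fderiv ℝ (psiCoef f) v (w, c)
          = ∑ a, w.2 a • (Complex.I / 2 * (drift f a v : ℂ) * psiCoef f v) := by
        rw [e, map_add, map_sum, fderiv_psiCoef (hB v hv).smooth (0, c), (hQ v hv).quad, add_zero]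
        simp only [map_smul, (hQ v hv).fderiv_psiCoef_ex (hB v hv).smooth]
      have e2 : fderiv ℝ P₁.expo v.1 w
          = ∑ a, w.2 a • (Complex.I / 2 * (drift f a v : ℂ)) := by
        have := hP₁.fderiv_expo hJo ht v.1.2 w
        rw [hw] at this
        refine Eq.trans this ?_
        simp only [zero_mul, zero_add, Complex.ofReal_zero, add_zero]
        push_cast
        rw [Finset.mul_sum]
        refine Finset.sum_congr rfl fun a _ => ?_
        rw [hdrift v hv, Complex.real_smul]; push_cast; ring
      simp only [neg_apply, ContinuousLinearMap.comp_apply, ContinuousLinearMap.coe_fst']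
      rw [e1, e2, ← mul_zero (Complex.exp (-P₁.expo v.1))]
      congr 1
      simp only [Complex.real_smul]
      rw [mul_neg, Finset.mul_sum, neg_add_eq_zero]
      exact Finset.sum_congr rfl fun a _ => by ring)
  obtain ⟨L, hLs, hL⟩ := exists_smooth_log hJo hU.time_connected hθs' (by
    rintro _ ⟨v, hv, rfl⟩
    rw [← hθ v hv]
    exact mul_ne_zero (Complex.exp_ne_zero _) (psiCoef_ne_zero (hQ v hv)))
  -- The quotient is exp(iΣ + Z), so Σ and Z are the imaginary and real parts of its logarithm.
  let P : Params n := ⟨T, O, X, fun t => (L t).im, fun t => (L t).re⟩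
  refine ⟨P, ⟨hTs, hTne, hOo, hXs, ?_, ?_⟩, fun v hv => ⟨hbase v hv, fun z => ?_⟩⟩
  · exact Complex.imCLM.contDiff.comp_contDiffOn hLs
  · exact Complex.reCLM.contDiff.comp_contDiffOn hLs
  · rw [fderiv_psiComp_vertical (hB v hv) (hQ v hv)]
    have e1 : deriv P.T v.1.1 = tau f v := hτ v hv
    rw [e1]
    congr 1
    have e2 := hL v.1.1 (hJm v hv)
    have e3 := hθ v hv
    change _ = θ v.1.1 at e3
    rw [← e2, Complex.exp_neg] at e3
    have e4 : P.expo v.1 = P₁.expo v.1 + L v.1.1 := by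
      have h1 : P.phase v.1.1 v.1.2 = P₁.phase v.1.1 v.1.2 + (L v.1.1).im := by
        simp [Params.phase, P, P₁, Params.eps]
      rw [Params.expo, h1, Params.expo]
      have h2 := Complex.re_add_im (L v.1.1)
      have h3 : ((P₁.Z v.1.1 : ℝ) : ℂ) = 0 := by simp [P₁]
      have h4 : P.Z v.1.1 = (L v.1.1).re := rfl
      rw [h3, h4]
      push_cast
      linear_combination h2
    rw [e4, Complex.exp_add, ← e3, mul_inv_cancel_left₀ (Complex.exp_ne_zero _)]

end

/-! ### The parametrized transformations as diffeomorphisms -/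

section

/-- A smooth injective map with invertible derivatives is a diffeomorphism onto an open set. -/
theorem exists_openPartialHomeomorph {E : Type*} [NormedAddCommGroup E] [NormedSpace ℝ E]
    [FiniteDimensional ℝ E] {f : E → E} {U : Set E} (hU : IsOpen U)
    (hf : ∀ x ∈ U, ContDiffAt ℝ ∞ f x) (hinj : Set.InjOn f U)
    (hd : ∀ x ∈ U, ∀ z, fderiv ℝ f x z = 0 → z = 0) :
    ∃ φ : OpenPartialHomeomorph E E, φ.source = U ∧ (∀ x, φ x = f x) ∧
      ContDiffOn ℝ ∞ φ φ.source ∧ ContDiffOn ℝ ∞ φ.symm φ.target := by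
  have : CompleteSpace E := FiniteDimensional.complete ℝ E
  have hB : ∀ x ∈ U, ∃ B : E ≃L[ℝ] E, HasFDerivAt f (B : E →L[ℝ] E) x := by
    intro x hx
    have hi : Function.Injective (fderiv ℝ f x : E →ₗ[ℝ] E) := by
      rw [injective_iff_map_eq_zero]; exact hd x hx
    refine ⟨(LinearEquiv.ofInjectiveEndo _ hi).toContinuousLinearEquiv, ?_⟩
    exact (diffAt (hf x hx)).hasFDerivAt.congr_fderiv (by ext; rfl)
  have hopen : ∀ W ⊆ U, IsOpen W → IsOpen (f '' W) := by
    intro W hW hWo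
    rw [isOpen_iff_mem_nhds]
    rintro _ ⟨x, hx, rfl⟩
    obtain ⟨B, hB⟩ := hB x (hW hx)
    have hs := (hf x (hW hx)).hasStrictFDerivAt' hB (by simp)
    rw [← hs.map_nhds_eq_of_equiv]
    exact Filter.image_mem_map (hWo.mem_nhds hx)
  have hcont : ContinuousOn f U := fun x hx => (hf x hx).continuousAt.continuousWithinAt
  let φ : OpenPartialHomeomorph E E := OpenPartialHomeomorph.ofContinuousOpenRestrict
    hinj.toPartialEquiv hcont (by
      intro V hV
      obtain ⟨V', hV', rfl⟩ := isOpen_induced_iff.1 hV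
      have := hopen (U ∩ V') Set.inter_subset_left (hU.inter hV')
      convert this using 1
      ext y
      simp only [Set.mem_image, Set.mem_preimage, Subtype.exists, Set.mem_inter_iff]
      constructor
      · rintro ⟨a, ha, hav, rfl⟩; exact ⟨a, ⟨ha, hav⟩, rfl⟩
      · rintro ⟨a, ⟨ha, hav⟩, rfl⟩; exact ⟨a, ha, hav, rfl⟩) hU
  refine ⟨φ, rfl, fun _ => rfl, fun x hx => (hf x hx).contDiffWithinAt, fun y hy => ?_⟩
  obtain ⟨B, hB⟩ := hB (φ.symm y) (φ.map_target hy)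
  exact (φ.contDiffAt_symm hy hB (hf _ (φ.map_target hy))).contDiffWithinAt

/-- The derivative of a map in a direction in which the map is affine. -/
theorem fderiv_apply_of_affine {E F : Type*} [NormedAddCommGroup E]
    [NormedSpace ℝ E] [NormedAddCommGroup F] [NormedSpace ℝ F] {f : E → F} {x z : E} {c : F}
    (hf : DifferentiableAt ℝ f x) (h : ∀ r : ℝ, f (x + r • z) = f x + r • c) :
    fderiv ℝ f x z = c := by
  have h1 : HasDerivAt (fun r : ℝ => x + r • z) z 0 := by
    simpa using ((hasDerivAt_id (0 : ℝ)).smul_const z).const_add x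
  have h2 : HasDerivAt (fun r : ℝ => f (x + r • z)) (fderiv ℝ f x z) 0 :=
    HasFDerivAt.comp_hasDerivAt (l := f) (0 : ℝ) (by simpa using hf.hasFDerivAt) h1
  have h3 : HasDerivAt (fun r : ℝ => f (x + r • z)) c 0 := by
    simp only [h]
    simpa using ((hasDerivAt_id (0 : ℝ)).smul_const c).const_add (f x)
  exact h2.unique h3

/-- Smoothness of quotients of complex-valued functions of real variables. -/
theorem contDiffAt_div {E : Type*} [NormedAddCommGroup E] [NormedSpace ℝ E] {f g : E → ℂ} {x : E}
    (hf : ContDiffAt ℝ ∞ f x) (hg : ContDiffAt ℝ ∞ g x) (h0 : g x ≠ 0) :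
    ContDiffAt ℝ ∞ (fun y => f y / g y) x := by
  simp only [div_eq_mul_inv]
  exact hf.mul (hg.inv h0)

namespace Params

variable {n : ℕ} {P : Params n} {I : Set ℝ}

/-- The action on `(t, x, ψ)`. -/
def varsMap (P : Params n) (v : Vars n) : Vars n := (P.baseMap v.1, P.psiMap v.1.1 v.1.2 v.2)

theorem map_eq (P : Params n) (w : Joint n) :
    P.map w = (P.varsMap w.1, P.sMap w.1.1.1 w.1.1.2 w.2) := rfl

theorem psiMap_eq (P : Params n) (t : ℝ) (x : Fin n → ℝ) (ψ : ℂ) :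
    P.psiMap t x ψ = Complex.exp (P.expo (t, x)) * hat (deriv P.T t) ψ := rfl

theorem norm_psiMap (P : Params n) (t : ℝ) (x : Fin n → ℝ) (ψ : ℂ) :
    ‖P.psiMap t x ψ‖ = Real.exp (P.Z t) * ‖ψ‖ := by
  rw [psiMap, norm_mul, norm_hat, Complex.norm_exp]
  simp

theorem sMap_eq (P : Params n) (t : ℝ) (x : Fin n → ℝ) (s : ℂ) :
    P.sMap t x s = hat (deriv P.T t) s / (|deriv P.T t| : ℝ) + P.sMap t x 0 := by
  have : hat (deriv P.T t) 0 = 0 := hat_eq_zero.2 rfl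
  simp only [sMap, this]
  ring

theorem psiMap_injective (P : Params n) (t : ℝ) (x : Fin n → ℝ) :
    Function.Injective (P.psiMap t x) := by
  intro a b h
  rw [psiMap_eq, psiMap_eq] at h
  have := mul_left_cancel₀ (Complex.exp_ne_zero _) h
  rw [← hat_hat (deriv P.T t) a, this, hat_hat]

namespace IsValidOn

variable {t : ℝ} (hP : P.IsValidOn I) (hI : IsOpen I)
include hP

theorem sMap_injective (ht : t ∈ I) (x : Fin n → ℝ) : Function.Injective (P.sMap t x) := by
  intro a b h
  rw [P.sMap_eq t x a, P.sMap_eq t x b, add_left_inj] at h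
  have h0 : ((|deriv P.T t| : ℝ) : ℂ) ≠ 0 := by exact_mod_cast (hP.abs_pos ht).ne'
  have := (div_left_inj' h0).1 h
  rw [← hat_hat (deriv P.T t) a, this, hat_hat]

theorem xMap_injective (ht : t ∈ I) : Function.Injective (P.xMap t) := by
  intro x y h
  have e : ∀ b, ∑ a, P.O b a * x a = ∑ a, P.O b a * y a := by
    intro b
    have hb := congrFun h b
    exact mul_left_cancel₀ (hP.scale_pos ht).ne' (add_right_cancel hb)
  funext a
  rw [← hP.sum_transpose_mul x a, ← hP.sum_transpose_mul y a]
  exact Finset.sum_congr rfl fun b _ => by rw [e]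

include hI

/-- Rolle's theorem: a repeated value on an interval would give a zero of T_t. -/
theorem T_injOn (hIc : IsPreconnected I) : Set.InjOn P.T I := by
  have key : ∀ a ∈ I, ∀ b ∈ I, a < b → P.T a ≠ P.T b := by
    intro a ha b hb hab h
    have hsub : Set.Icc a b ⊆ I := hIc.ordConnected.out ha hb
    obtain ⟨c, hc, hc0⟩ := exists_deriv_eq_zero hab
      (fun s hs => (hP.contDiffAt_T hI (hsub hs)).continuousAt.continuousWithinAt) h
    exact hP.deriv_T c (hsub (Set.Ioo_subset_Icc_self hc)) hc0
  intro a ha b hb h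
  rcases lt_trichotomy a b with hab | hab | hab
  · exact (key a ha b hb hab h).elim
  · exact hab
  · exact (key b hb a ha hab h.symm).elim

theorem contDiffAt_psiMap {v : Vars n} (hv : v.1.1 ∈ I) :
    ContDiffAt ℝ ∞ (fun v : Vars n => P.psiMap v.1.1 v.1.2 v.2) v := by
  have h1 : ContDiffAt ℝ ∞ (fun v : Vars n => Complex.exp (P.expo v.1)
      * hatL (deriv P.T v.1.1) v.2) v := by
    have e : (fun q : Vars n => hatL (deriv P.T q.1.1) q.2)
        =ᶠ[𝓝 v] fun q => hatL (deriv P.T v.1.1) q.2 := by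
      have hc : ContinuousAt (fun q : Vars n => q.1.1) v := by fun_prop
      filter_upwards [hc.eventually (hP.eventually_hat hI hv)] with q hq
      rw [hatL_apply, hatL_apply, hq]
    refine (ContDiffAt.comp (g := P.expo) v (hP.contDiffAt_expo hI hv v.1.2) contDiffAt_fst).cexp.mul
      (ContDiffAt.congr_of_eventuallyEq ?_ e)
    exact ContDiffAt.comp (g := hatL (deriv P.T v.1.1)) v
      (hatL (deriv P.T v.1.1)).contDiff.contDiffAt contDiffAt_snd
  simp only [hatL_apply] at h1
  exact h1

theorem contDiffAt_varsMap {v : Vars n} (hv : v.1.1 ∈ I) : ContDiffAt ℝ ∞ P.varsMap v :=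
  (ContDiffAt.comp (g := P.baseMap) v (hP.contDiffAt_baseMap hI hv v.1.2) contDiffAt_fst).prodMk
    (hP.contDiffAt_psiMap hI hv)

theorem contDiffAt_sMap_zero {q : Base n} (hq : q.1 ∈ I) :
    ContDiffAt ℝ ∞ (fun q : Base n => P.sMap q.1 q.2 0) q := by
  have hT := contDiffAt_deriv (hP.contDiffAt_T hI hq)
  have hT2 : ContDiffAt ℝ ∞ (iteratedDeriv 2 P.T) q.1 := by
    simp only [iteratedDeriv_succ, iteratedDeriv_zero]; exact contDiffAt_deriv hT
  have hT3 : ContDiffAt ℝ ∞ (iteratedDeriv 3 P.T) q.1 := by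
    rw [iteratedDeriv_succ]; exact contDiffAt_deriv hT2
  have hne := hP.deriv_T _ hq
  have he : P.eps q.1 ≠ 0 := fun h => by
    have := sign_mul_self hne
    rw [show Real.sign (deriv P.T q.1) = 0 from h] at this
    simp at this
  have hneC : ((deriv P.T q.1 : ℝ) : ℂ) ≠ 0 := by exact_mod_cast hne
  have r1 : ∀ g : ℝ → ℝ, ContDiffAt ℝ ∞ g q.1 → ContDiffAt ℝ ∞ (fun q : Base n => g q.1) q :=
    fun g hg => ContDiffAt.comp (g := g) q hg contDiffAt_fst
  have c1 : ∀ g : Base n → ℝ, ContDiffAt ℝ ∞ g q → ContDiffAt ℝ ∞ (fun q => (g q : ℂ)) q :=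
    fun g hg => ContDiffAt.comp (g := Complex.ofRealCLM) q Complex.ofRealCLM.contDiff.contDiffAt hg
  have h2 : ∀ a, ContDiffAt ℝ ∞ (fun q : Base n => q.2 a) q :=
    fun a => (dxForm a).contDiff.contDiffAt
  have hdiv : ∀ b, ContDiffAt ℝ ∞ (deriv fun r => deriv (P.X b) r / deriv P.T r) q.1 := fun b =>
    contDiffAt_deriv ((contDiffAt_deriv (hP.contDiffAt_X hI hq b)).div hT hne)
  have hz : ∀ τ : ℝ, hat τ 0 = 0 := fun τ => hat_eq_zero.2 rfl
  simp only [sMap, hz, zero_div, zero_add]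
  refine ContDiffAt.sub (ContDiffAt.add (ContDiffAt.add (c1 _ ?_) (c1 _ ?_)) ?_) ?_
  · refine ContDiffAt.mul (r1 (fun t => (2 * iteratedDeriv 3 P.T t * deriv P.T t
      - 3 * iteratedDeriv 2 P.T t ^ 2) / (16 * P.eps t * deriv P.T t ^ 3)) ?_)
      (ContDiffAt.sum fun a _ => (h2 a).mul (h2 a))
    exact (((contDiffAt_const.mul hT3).mul hT).sub (contDiffAt_const.mul (hT2.pow 2))).div
      ((contDiffAt_const.mul (hP.contDiffAt_eps hI hq)).mul (hT.pow 3))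
      (mul_ne_zero (mul_ne_zero (by norm_num) he) (pow_ne_zero _ hne))
  · refine ContDiffAt.mul (r1 (fun t => P.eps t / 2) ((hP.contDiffAt_eps hI hq).div_const 2))
      (ContDiffAt.sum fun b _ => ContDiffAt.sum fun a _ => ?_)
    exact ((r1 _ (hdiv b)).mul (contDiffAt_const.mul (h2 a))).div
      (r1 _ (hP.contDiffAt_scale hI hq)) (hP.scale_pos hq).ne'
  · exact contDiffAt_div ((c1 _ (r1 _ (contDiffAt_deriv (hP.contDiffAt_Sig hI hq)))).sub
      (contDiffAt_const.mul (c1 _ (r1 _ (contDiffAt_deriv (hP.contDiffAt_Z hI hq))))))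
      (c1 _ (r1 _ hT)) hneC
  · refine contDiffAt_div (ContDiffAt.add (c1 _ (ContDiffAt.sum fun a _ => ?_))
      (contDiffAt_const.mul (c1 _ (r1 _ hT2)))) (contDiffAt_const.mul ((c1 _ (r1 _ hT)).pow 2))
      (mul_ne_zero (by norm_num) (pow_ne_zero _ hneC))
    have := r1 _ (contDiffAt_deriv (hP.contDiffAt_X hI hq a))
    exact this.mul this

theorem contDiffAt_sMap {q : Base n × ℂ} (hq : q.1.1 ∈ I) :
    ContDiffAt ℝ ∞ (fun q : Base n × ℂ => P.sMap q.1.1 q.1.2 q.2) q := by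
  have e : (fun q : Base n × ℂ => P.sMap q.1.1 q.1.2 q.2)
      =ᶠ[𝓝 q] fun p => hatL (deriv P.T q.1.1) p.2 / ((|deriv P.T p.1.1| : ℝ) : ℂ)
        + P.sMap p.1.1 p.1.2 0 := by
    have hc : ContinuousAt (fun q : Base n × ℂ => q.1.1) q := by fun_prop
    filter_upwards [hc.eventually (hP.eventually_hat hI hq)] with p hp
    rw [hatL_apply, P.sMap_eq, hp]
  refine ContDiffAt.congr_of_eventuallyEq ?_ e
  refine ContDiffAt.add (contDiffAt_div ?_ ?_ ?_) ?_
  · exact ContDiffAt.comp (g := hatL (deriv P.T q.1.1)) q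
      (hatL (deriv P.T q.1.1)).contDiff.contDiffAt contDiffAt_snd
  · have h1 : ContDiffAt ℝ ∞ (fun p : Base n × ℂ => |deriv P.T p.1.1|) q :=
      ContDiffAt.comp (g := fun s => |deriv P.T s|) q (hP.contDiffAt_abs hI hq)
        (contDiffAt_fst.comp q contDiffAt_fst)
    exact ContDiffAt.comp (g := Complex.ofRealCLM) q Complex.ofRealCLM.contDiff.contDiffAt h1
  · exact_mod_cast (hP.abs_pos hq).ne'
  · exact ContDiffAt.comp (g := fun q : Base n => P.sMap q.1 q.2 0) q
      (hP.contDiffAt_sMap_zero hI hq) contDiffAt_fst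

theorem contDiffAt_map {w : Joint n} (hw : w.1.1.1 ∈ I) : ContDiffAt ℝ ∞ P.map w := by
  have h1 : ContDiffAt ℝ ∞ (fun w : Joint n => P.varsMap w.1) w :=
    ContDiffAt.comp (g := P.varsMap) w (hP.contDiffAt_varsMap hI hw) contDiffAt_fst
  have h2 : ContDiffAt ℝ ∞ (fun w : Joint n => P.sMap w.1.1.1 w.1.1.2 w.2) w :=
    ContDiffAt.comp (g := fun q : Base n × ℂ => P.sMap q.1.1 q.1.2 q.2)
      (f := fun w : Joint n => (w.1.1, w.2)) w
      (hP.contDiffAt_sMap hI (q := (w.1.1, w.2)) hw) (by fun_prop)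
  exact h1.prodMk h2

theorem fderiv_baseMap_injective {q : Base n} (hq : q.1 ∈ I) {z : Base n}
    (hz : fderiv ℝ P.baseMap q z = 0) : z = 0 := by
  have h1 := hP.fderiv_baseMap_fst hI hq q.2 z
  rw [show ((q.1, q.2) : Base n) = q from rfl, hz] at h1
  have hz1 : z.1 = 0 := by
    rcases mul_eq_zero.1 h1.symm with h | h
    · exact h
    · exact (hP.deriv_T _ hq h).elim
  have e : ∀ b, ∑ a, P.O b a * z.2 a = 0 := by
    intro b
    have h2 := hP.fderiv_baseMap_snd hI hq q.2 z b
    rw [show ((q.1, q.2) : Base n) = q from rfl, hz, hz1, zero_mul, zero_add] at h2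
    simp only [mul_assoc, ← Finset.mul_sum] at h2
    exact (mul_eq_zero.1 h2.symm).resolve_left (hP.scale_pos hq).ne'
  refine Prod.ext hz1 (funext fun a => ?_)
  rw [← hP.sum_transpose_mul z.2 a]
  simp [e]

theorem exists_baseHomeo (hIc : IsPreconnected I) :
    ∃ φ : OpenPartialHomeomorph (Base n) (Base n), φ.source = {q | q.1 ∈ I} ∧
      (∀ q, φ q = P.baseMap q) ∧ ContDiffOn ℝ ∞ φ φ.source ∧ ContDiffOn ℝ ∞ φ.symm φ.target := by
  refine exists_openPartialHomeomorph (hI.preimage continuous_fst)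
    (fun q hq => hP.contDiffAt_baseMap hI hq q.2) ?_
    (fun q hq z hz => hP.fderiv_baseMap_injective hI hq hz)
  intro p hp q hq h
  have h1 : p.1 = q.1 := hP.T_injOn hI hIc hp hq (congrArg Prod.fst h)
  refine Prod.ext h1 (hP.xMap_injective hq ?_)
  have := congrArg Prod.snd h
  simpa only [baseMap, h1] using this

theorem fderiv_psiMap_vertical {v : Vars n} (hv : v.1.1 ∈ I) (c : ℂ) :
    fderiv ℝ (fun v : Vars n => P.psiMap v.1.1 v.1.2 v.2) v (0, c)
      = Complex.exp (P.expo v.1) * hat (deriv P.T v.1.1) c := by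
  refine fderiv_apply_of_affine (diffAt (hP.contDiffAt_psiMap hI hv)) fun r => ?_
  simp only [Prod.fst_add, Prod.smul_fst, smul_zero, add_zero, Prod.snd_add, Prod.smul_snd,
    psiMap_eq, hat_add, Complex.real_smul, hat_mul, hat_ofReal]
  ring

theorem fderiv_varsMap_injective {v : Vars n} (hv : v.1.1 ∈ I) {z : Vars n}
    (hz : fderiv ℝ P.varsMap v z = 0) : z = 0 := by
  have hb := diffAt (hP.contDiffAt_baseMap hI hv v.1.2)
  have h1 : HasFDerivAt (fun v : Vars n => P.baseMap v.1) _ v :=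
    HasFDerivAt.comp (g := P.baseMap) v hb.hasFDerivAt hasFDerivAt_fst
  have h2 := (diffAt (hP.contDiffAt_psiMap hI hv)).hasFDerivAt
  have h3 : fderiv ℝ P.varsMap v = _ := (h1.prodMk h2).fderiv
  rw [h3] at hz
  have hz1 : z.1 = 0 := hP.fderiv_baseMap_injective hI hv (congrArg Prod.fst hz)
  have hz2 := congrArg Prod.snd hz
  obtain ⟨z1, c⟩ := z
  simp only at hz1
  subst hz1
  change fderiv ℝ (fun v : Vars n => P.psiMap v.1.1 v.1.2 v.2) v (0, c) = 0 at hz2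
  rw [hP.fderiv_psiMap_vertical hI hv] at hz2
  rw [hat_eq_zero.1 ((mul_eq_zero.1 hz2).resolve_left (Complex.exp_ne_zero _))]
  rfl

theorem varsMap_injOn (hIc : IsPreconnected I) : Set.InjOn P.varsMap {v | v.1.1 ∈ I} := by
  intro p hp q hq h
  obtain ⟨φ, hs, he, -, -⟩ := hP.exists_baseHomeo hI hIc
  have h1 : p.1 = q.1 := by
    have := φ.injOn (x₁ := p.1) (x₂ := q.1)
    rw [hs, he, he] at this
    exact this hp hq (congrArg Prod.fst h)
  refine Prod.ext h1 (P.psiMap_injective q.1.1 q.1.2 ?_)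
  have := congrArg Prod.snd h
  simpa only [varsMap, h1] using this

theorem exists_varsHomeo (hIc : IsPreconnected I) {W : Set (Vars n)} (hW : IsOpen W)
    (hWI : ∀ v ∈ W, v.1.1 ∈ I) :
    ∃ φ : OpenPartialHomeomorph (Vars n) (Vars n), φ.source = W ∧
      (∀ v, φ v = P.varsMap v) ∧ ContDiffOn ℝ ∞ φ φ.source ∧ ContDiffOn ℝ ∞ φ.symm φ.target :=
  exists_openPartialHomeomorph hW (fun v hv => hP.contDiffAt_varsMap hI (hWI v hv))
    ((hP.varsMap_injOn hI hIc).mono hWI)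
    (fun v hv _ hz => hP.fderiv_varsMap_injective hI (hWI v hv) hz)

theorem exists_jointHomeo (hIc : IsPreconnected I) {W : Set (Joint n)} (hW : IsOpen W)
    (hWI : ∀ w ∈ W, w.1.1.1 ∈ I) :
    ∃ φ : OpenPartialHomeomorph (Joint n) (Joint n), φ.source = W ∧
      (∀ v, φ v = P.map v) ∧ ContDiffOn ℝ ∞ φ φ.source ∧ ContDiffOn ℝ ∞ φ.symm φ.target := by
  refine exists_openPartialHomeomorph hW (fun w hw => hP.contDiffAt_map hI (hWI w hw)) ?_ ?_
  · intro p hp q hq h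
    have h1 : p.1 = q.1 := hP.varsMap_injOn hI hIc (hWI p hp) (hWI q hq) (congrArg Prod.fst h)
    refine Prod.ext h1 (hP.sMap_injective (hWI q hq) q.1.1.2 ?_)
    have := congrArg Prod.snd h
    simpa only [map, h1] using this
  · intro w hw z hz
    have hmap := diffAt (hP.contDiffAt_map hI (hWI w hw))
    have h1 : HasFDerivAt (fun w : Joint n => P.varsMap w.1) _ w :=
      HasFDerivAt.comp (g := P.varsMap) w
        (diffAt (hP.contDiffAt_varsMap hI (hWI w hw))).hasFDerivAt hasFDerivAt_fst
    have h1' : HasFDerivAt (fun w : Joint n => P.varsMap w.1) _ w :=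
      HasFDerivAt.comp (g := Prod.fst) w hasFDerivAt_fst hmap.hasFDerivAt
    have hz1 : z.1 = 0 := by
      refine hP.fderiv_varsMap_injective hI (hWI w hw) ?_
      have := congrArg (fun L => L z) (h1.unique h1')
      simp only [ContinuousLinearMap.comp_apply, hz, map_zero] at this
      exact this
    obtain ⟨z1, c⟩ := z
    simp only at hz1
    subst hz1
    have h3 : fderiv ℝ P.map w (0, c)
        = (0, hat (deriv P.T w.1.1.1) c / ((|deriv P.T w.1.1.1| : ℝ) : ℂ)) := by
      refine fderiv_apply_of_affine hmap fun r => ?_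
      rw [map_eq, map_eq]
      refine Prod.ext ?_ ?_
      · simp
      · simp only [Prod.fst_add, Prod.smul_fst, smul_zero, add_zero, Prod.snd_add, Prod.smul_snd]
        rw [P.sMap_eq _ _ (w.2 + r • c), P.sMap_eq _ _ w.2, hat_add, Complex.real_smul, hat_mul,
          hat_ofReal, Complex.real_smul]
        ring
    rw [h3] at hz
    have hz2 : hat (deriv P.T w.1.1.1) c / ((|deriv P.T w.1.1.1| : ℝ) : ℂ) = 0 :=
      congrArg Prod.snd hz
    have h0 : ((|deriv P.T w.1.1.1| : ℝ) : ℂ) ≠ 0 := by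
      exact_mod_cast (hP.abs_pos (hWI w hw)).ne'
    rw [hat_eq_zero.1 ((div_eq_zero_iff.1 hz2).resolve_right h0)]
    rfl

end IsValidOn

end Params

end

/-! ### The additive term vanishes; the new arbitrary element -/

section

/-- Differentiate along the circle ζ = (w − d)e^{iθ} at θ = 0. On it |ζ| is constant, so no
regularity of F is needed; then F is eliminated by means of the equation itself. The right-hand side
that remains depends on w only through |w|. -/
theorem rotation_derivative {F G : ℝ → ℂ} {w d γ : ℂ} (hw : w ≠ 0)
    (hG : DifferentiableAt ℝ G ‖w‖)
    (h : ∀ᶠ ζ in 𝓝 (w - d), G ‖ζ + d‖ * (ζ + d) = F ‖ζ‖ * ζ + γ) :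
    deriv G ‖w‖ * (((conj w * d).im : ℝ) : ℂ) * w = ‖w‖ * Complex.I * (G ‖w‖ * d - γ) := by
  have hw0 : ‖w‖ ≠ 0 := norm_ne_zero_iff.2 hw
  have hr : HasDerivAt (fun θ : ℝ => (w - d) * Complex.exp (θ * Complex.I))
      ((w - d) * Complex.I) 0 := by
    have h1 : HasDerivAt (fun θ : ℝ => (θ : ℂ) * Complex.I) Complex.I 0 := by
      simpa using (Complex.ofRealCLM.hasDerivAt (x := (0 : ℝ))).mul_const Complex.I
    simpa using h1.cexp.const_mul (w - d)
  have hrd := hr.add_const d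
  have hn : HasDerivAt (fun θ : ℝ => ‖(w - d) * Complex.exp (θ * Complex.I) + d‖)
      ((conj w * d).im / ‖w‖) 0 := by
    have h1 := hrd.norm_sq.sqrt (by simpa using hw)
    simp only [Real.sqrt_sq (norm_nonneg _)] at h1
    refine h1.congr_deriv ?_
    simp only [Complex.ofReal_zero, zero_mul, Complex.exp_zero, mul_one, sub_add_cancel,
      Complex.inner]
    have : ((w - d) * Complex.I * conj w).re = (conj w * d).im := by
      simp [Complex.mul_re, Complex.mul_im]; ring
    rw [this]
    field_simp
  have hl : HasDerivAt (fun θ : ℝ => G ‖(w - d) * Complex.exp (θ * Complex.I) + d‖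
      * ((w - d) * Complex.exp (θ * Complex.I) + d))
      ((((conj w * d).im / ‖w‖) • deriv G ‖w‖) * w + G ‖w‖ * ((w - d) * Complex.I)) 0 := by
    have h1 : HasDerivAt (fun θ : ℝ => G ‖(w - d) * Complex.exp (θ * Complex.I) + d‖)
        (((conj w * d).im / ‖w‖) • deriv G ‖w‖) 0 :=
      HasDerivAt.scomp (g₁ := G) (h := fun θ : ℝ => ‖(w - d) * Complex.exp (θ * Complex.I) + d‖)
        (0 : ℝ) (by simpa using hG.hasDerivAt) hn
    have h2 := h1.mul hrd
    simp only [Complex.ofReal_zero, zero_mul, Complex.exp_zero, mul_one, sub_add_cancel] at h2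
    exact h2
  have hR : HasDerivAt (fun θ : ℝ => F ‖w - d‖ * ((w - d) * Complex.exp (θ * Complex.I)) + γ)
      (F ‖w - d‖ * ((w - d) * Complex.I)) 0 := (hr.const_mul _).add_const _
  have hev : (fun θ : ℝ => G ‖(w - d) * Complex.exp (θ * Complex.I) + d‖
      * ((w - d) * Complex.exp (θ * Complex.I) + d))
      =ᶠ[𝓝 0] fun θ : ℝ => F ‖w - d‖ * ((w - d) * Complex.exp (θ * Complex.I)) + γ := by
    have ht : Filter.Tendsto (fun θ : ℝ => (w - d) * Complex.exp (θ * Complex.I)) (𝓝 0)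
        (𝓝 (w - d)) := by simpa [ContinuousAt] using hr.continuousAt
    filter_upwards [ht.eventually h] with θ hθ
    rw [hθ, norm_mul, Complex.norm_exp_ofReal_mul_I, mul_one]
  have e1 := hl.unique (hR.congr_of_eventuallyEq hev)
  have e2 := h.self_of_nhds
  rw [sub_add_cancel] at e2
  rw [Complex.real_smul, Complex.ofReal_div] at e1
  have hw1 : ((‖w‖ : ℝ) : ℂ) ≠ 0 := by exact_mod_cast hw0
  field_simp at e1
  linear_combination e1 - Complex.I * ‖w‖ * e2

/-- An equation `G(|ζ + d|) (ζ + d) = F(|ζ|) ζ + γ` on an open set with `G' ≠ 0` forces `d = 0`. -/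
theorem eq_zero_of_rotation {F G : ℝ → ℂ} {ζ₀ d γ : ℂ} (hw : ζ₀ + d ≠ 0)
    (hG : DifferentiableAt ℝ G ‖ζ₀ + d‖) (hG' : deriv G ‖ζ₀ + d‖ ≠ 0)
    (h : ∀ᶠ ζ in 𝓝 ζ₀, G ‖ζ + d‖ * (ζ + d) = F ‖ζ‖ * ζ + γ) : d = 0 := by
  set w := ζ₀ + d with hwd
  have hζ : ζ₀ = w - d := by rw [hwd]; ring
  rw [hζ] at h
  have ht : Filter.Tendsto (fun θ : ℝ => w * Complex.exp (θ * Complex.I) - d) (𝓝 0)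
      (𝓝 (w - d)) := by
    have : Continuous fun θ : ℝ => w * Complex.exp (θ * Complex.I) - d := by fun_prop
    simpa using this.tendsto 0
  -- A rotation of w itself, small enough to keep the equation valid and with sin θ ≠ 0. It
  -- preserves |w|, so both instances of `rotation_derivative` have equal right-hand sides.
  obtain ⟨θ, hθ, hθ0, hθ1⟩ : ∃ θ : ℝ, (∀ᶠ ζ in 𝓝 (w * Complex.exp (θ * Complex.I) - d),
      G ‖ζ + d‖ * (ζ + d) = F ‖ζ‖ * ζ + γ) ∧ 0 < θ ∧ θ < Real.pi := by
    have h1 := (ht.eventually h.eventually_nhds).filter_mono (nhdsWithin_le_nhds (s := Set.Ioi 0))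
    have h2 : ∀ᶠ θ : ℝ in 𝓝[>] 0, θ ∈ Set.Ioo 0 Real.pi := Ioo_mem_nhdsGT Real.pi_pos
    obtain ⟨θ, h3, h4⟩ := (h1.and h2).exists
    exact ⟨θ, h3, h4.1, h4.2⟩
  set e := Complex.exp (θ * Complex.I) with he
  have hen : ‖w * e‖ = ‖w‖ := by rw [norm_mul, he, Complex.norm_exp_ofReal_mul_I, mul_one]
  have hee : e = Real.cos θ + Real.sin θ * Complex.I := by
    rw [he, Complex.exp_mul_I, Complex.ofReal_cos, Complex.ofReal_sin]
  have hs : Real.sin θ ≠ 0 := (Real.sin_pos_of_pos_of_lt_pi hθ0 hθ1).ne'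
  have e0 := rotation_derivative hw hG h
  have e1 := rotation_derivative (mul_ne_zero hw (Complex.exp_ne_zero _)) (by rwa [← he, hen]) hθ
  rw [← he, hen, ← e0] at e1
  -- Here G' ≠ 0 is cancelled. A real multiple of the nonreal number e is real, so both imaginary
  -- parts vanish; they determine conj w · d, which is therefore zero.
  have e2 : (((conj (w * e) * d).im : ℝ) : ℂ) * e = ((conj w * d).im : ℝ) := by
    refine mul_left_cancel₀ (mul_ne_zero hG' hw) ?_
    linear_combination e1
  set k := (conj (w * e) * d).im with hk
  have e3 := congrArg Complex.im e2
  rw [hee, Complex.ofReal_im, Complex.im_ofReal_mul] at e3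
  have hk0 : k = 0 := by
    have : k * Real.sin θ = 0 := by simpa [Complex.sin_ofReal_re] using e3
    exact (mul_eq_zero.1 this).resolve_right hs
  have hk1 : (conj w * d).im = 0 := by
    rw [hk0, Complex.ofReal_zero, zero_mul] at e2
    exact_mod_cast e2.symm
  have hk2 : (conj w * d).re = 0 := by
    have e4 : conj (w * e) * d = conj e * (conj w * d) := by rw [map_mul]; ring
    rw [hk, e4, Complex.mul_im, hk1, mul_zero, zero_add, hee] at hk0
    have : Real.sin θ * (conj w * d).re = 0 := by
      simpa [Complex.sin_ofReal_re] using hk0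
    exact (mul_eq_zero.1 this).resolve_left hs
  have hz : conj w * d = 0 := Complex.ext hk2 hk1
  exact (mul_eq_zero.1 hz).resolve_left ((map_ne_zero _).2 hw)

variable {n : ℕ} {S S' : ArbitraryElement n} {φ : OpenPartialHomeomorph (Vars n) (Vars n)}
  {P : Params n} {I : Set ℝ}

/-- The relation between the arbitrary elements when the `ψ`-component is affine in `ψ`. -/
theorem IsAdmissible.relation (h : IsAdmissible S φ S') (hP : P.IsValidOn I) (hI : IsOpen I)
    (hIc : IsPreconnected I) {v : Vars n} (hv : v ∈ φ.source) (hvI : v.1.1 ∈ I) {D : Base n → ℂ}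
    (hD : ContDiffAt ℝ ∞ D (P.baseMap v.1))
    (hφ : ∀ᶠ q in 𝓝 v, φ q = (P.baseMap q.1, P.psiMap q.1.1 q.1.2 q.2 + D (P.baseMap q.1))) :
    S'.val (modPoint (φ v)) * (φ v).2
      = P.sMap v.1.1 v.1.2 (S.val (modPoint v)) * P.psiMap v.1.1 v.1.2 v.2
        - (Complex.I * dt D (P.baseMap v.1) + ∑ a, dx a (dx a D) (P.baseMap v.1)) := by
  obtain ⟨p, c⟩ := v
  obtain ⟨β, hβs, hβ, -, hβ'⟩ := hP.exists_baseHomeo hI hIc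
  have hpβ : p ∈ β.source := by rw [hβs]; exact hvI
  have hβp : β.symm (P.baseMap p) = p := by rw [← hβ]; exact β.left_inv hpβ
  have hbt : P.baseMap p ∈ β.target := by rw [← hβ]; exact β.map_source hpβ
  set s := S.val (modPoint (p, c)) with hs
  -- The simplest function through `(p, c)` solving the equation at p: i u_t = −s c, with no
  -- dependence on x.
  let u : Base n → ℂ := fun q => c + (q.1 - p.1) • (Complex.I * s * c)
  have hu : ContDiff ℝ ∞ u := by fun_prop
  have hup : u p = c := by simp [u]
  have hud : ∀ q, HasFDerivAt u (dtForm.smulRight (Complex.I * s * c)) q := by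
    intro q
    have h1 : HasDerivAt (fun r : ℝ => c + (r - p.1) • (Complex.I * s * c))
        (Complex.I * s * c) q.1 := by
      simpa using (((hasDerivAt_id q.1).sub_const p.1).smul_const (Complex.I * s * c)).const_add c
    exact hasFDerivAt_time h1
  have hdx : ∀ a, dx a u = fun _ => 0 := by
    intro a; funext q
    rw [dx, (hud q).fderiv]; simp
  have hdt : dt u p = Complex.I * s * c := by
    rw [dt, (hud p).fderiv]; simp
  have hsum : ∑ a, dx a (dx a u) p = 0 := by
    refine Finset.sum_eq_zero fun a _ => ?_
    rw [hdx a, dx, fderiv_fun_const]; rfl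
  have hzero : Complex.I * dt u p + ∑ a, dx a (dx a u) p + s * u p = 0 := by
    rw [hdt, hsum, hup]
    linear_combination s * c * Complex.I_mul_I
  let u₁ : Base n → ℂ := fun y => P.psiMap (β.symm y).1 (β.symm y).2 (u (β.symm y))
  have hβc : ContDiffAt ℝ ∞ β.symm (P.baseMap p) :=
    (hβ' _ hbt).contDiffAt (β.open_target.mem_nhds hbt)
  have hu₁ : ContDiffAt ℝ ∞ u₁ (P.baseMap p) := by
    refine ContDiffAt.comp (g := fun v : Vars n => P.psiMap v.1.1 v.1.2 v.2)
      (f := fun y => (β.symm y, u (β.symm y))) (P.baseMap p) ?_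
      (hβc.prodMk (hu.contDiffAt.comp _ hβc))
    refine hP.contDiffAt_psiMap hI ?_
    change (β.symm (P.baseMap p)).1 ∈ I
    rw [hβp]; exact hvI
  have hevI : ∀ᶠ q in 𝓝 p, q ∈ β.source := β.open_source.mem_nhds hpβ
  have hu₁e : ∀ᶠ q in 𝓝 p, u₁ (P.baseMap q) = P.psiMap q.1 q.2 (u q) := by
    filter_upwards [hevI] with q hq
    have : β.symm (P.baseMap q) = q := by rw [← hβ]; exact β.left_inv hq
    simp only [u₁, this]
  have hφ0 : φ (p, c) = (P.baseMap p, P.psiMap p.1 p.2 c + D (P.baseMap p)) := hφ.self_of_nhds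
  have hmaps : MapsGraph φ u (fun y => u₁ y + D y) p := by
    have hc : Filter.Tendsto (fun q => (q, u q)) (𝓝 p) (𝓝 (p, c)) := by
      have : Continuous fun q => (q, u q) := continuous_id.prodMk hu.continuous
      simpa [hup] using this.tendsto p
    filter_upwards [hc.eventually hφ, hu₁e] with q hq1 hq2
    rw [hq1, hq2]
  have hsol := (h.maps_equation u (fun y => u₁ y + D y) p (by rwa [hup]) hu.contDiffAt
    (by rw [hup, hφ0]; exact hu₁.add hD) hmaps).1 (by
      have e : S.val (p, ‖u p‖) = s := by rw [hup]; rfl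
      rw [SolvesAt, e]; exact hzero)
  have htr := hP.transform_identity hI hvI (x := p.2) hu.contDiffAt hu₁ hu₁e s
  rw [show ((p.1, p.2) : Base n) = p from rfl] at htr
  have hu₁p : u₁ (P.baseMap p) = P.psiMap p.1 p.2 c := by rw [hu₁e.self_of_nhds, hup]
  rw [hzero, show hat (deriv P.T p.1) 0 = 0 from hat_eq_zero.2 rfl, mul_zero, hu₁p] at htr
  have h0 : ((|deriv P.T p.1| : ℝ) : ℂ) ≠ 0 := by exact_mod_cast (hP.abs_pos hvI).ne'
  have htr' := (mul_eq_zero.1 htr).resolve_left h0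
  rw [hup, hφ0, SolvesAt] at hsol
  have e1 : dt (fun y => u₁ y + D y) (P.baseMap p) = dt u₁ (P.baseMap p) + dt D (P.baseMap p) := by
    simp only [dt]
    rw [fderiv_fun_add (diffAt hu₁) (diffAt hD)]; rfl
  have e2 : ∀ a, dx a (dx a fun y => u₁ y + D y) (P.baseMap p)
      = dx a (dx a u₁) (P.baseMap p) + dx a (dx a D) (P.baseMap p) := by
    intro a
    rw [dx_dx_eq a (hu₁.add hD), dx_dx_eq a hu₁, dx_dx_eq a hD, D2_add hu₁ hD]; rfl
  simp only [e1, e2, Finset.sum_add_distrib, hu₁p] at hsol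
  rw [hφ0]
  change S'.val (P.baseMap p, ‖P.psiMap p.1 p.2 c + D (P.baseMap p)‖)
    * (P.psiMap p.1 p.2 c + D (P.baseMap p)) = P.sMap p.1 p.2 s * P.psiMap p.1 p.2 c - _
  linear_combination hsol - htr'

/-- The difference between the ψ-component and `P.psiMap` has zero ψ-derivative, so on a product of
balls it depends on (t, x) only; the inverse of `P.baseMap` expresses it in the new variables. -/
theorem exists_affine_of_fderiv_vertical (hP : P.IsValidOn I) (hI : IsOpen I)
    (hIc : IsPreconnected I) {f : Vars n → Vars n} {v₀ : Vars n} (hf : ContDiffAt ℝ ∞ f v₀)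
    (hvI : v₀.1.1 ∈ I)
    (hφ : ∀ᶠ v in 𝓝 v₀, (f v).1 = P.baseMap v.1 ∧ ∀ z, fderiv ℝ (psiComp f) v (0, z)
      = Complex.exp (P.expo v.1) * hat (deriv P.T v.1.1) z) :
    ∃ D : Base n → ℂ, ContDiffAt ℝ ∞ D (P.baseMap v₀.1) ∧
      ∀ᶠ v in 𝓝 v₀, f v = (P.baseMap v.1, P.psiMap v.1.1 v.1.2 v.2 + D (P.baseMap v.1)) := by
  obtain ⟨p₀, c₀⟩ := v₀
  obtain ⟨β, hβs, hβ, -, hβ'⟩ := hP.exists_baseHomeo hI hIc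
  have hpβ : p₀ ∈ β.source := by rw [hβs]; exact hvI
  have hβp : β.symm (P.baseMap p₀) = p₀ := by rw [← hβ]; exact β.left_inv hpβ
  have hbt : P.baseMap p₀ ∈ β.target := by rw [← hβ]; exact β.map_source hpβ
  have hβc : ContDiffAt ℝ ∞ β.symm (P.baseMap p₀) :=
    (hβ' _ hbt).contDiffAt (β.open_target.mem_nhds hbt)
  let δ : Vars n → ℂ := fun v => psiComp f v - P.psiMap v.1.1 v.1.2 v.2
  have hδ : ContDiffAt ℝ ∞ δ (p₀, c₀) :=
    (contDiffAt_psiComp hf).sub (hP.contDiffAt_psiMap hI hvI)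
  have hIev : ∀ᶠ v : Vars n in 𝓝 (p₀, c₀), v.1.1 ∈ I :=
    (show ContinuousAt (fun v : Vars n => v.1.1) (p₀, c₀) by fun_prop).eventually (hI.mem_nhds hvI)
  obtain ⟨ε, hε, hball⟩ := Metric.eventually_nhds_iff_ball.1 (hφ.and (hIev.and
    (eventually_differentiableAt (contDiffAt_psiComp hf))))
  have hpair : ∀ {p : Base n} {c : ℂ}, p ∈ Metric.ball p₀ ε → c ∈ Metric.ball c₀ ε →
      ((p, c) : Vars n) ∈ Metric.ball ((p₀, c₀) : Vars n) ε := by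
    intro p c hp hc
    rw [← ball_prod_same]; exact ⟨hp, hc⟩
  have hconst : ∀ p ∈ Metric.ball p₀ ε, ∀ c ∈ Metric.ball c₀ ε, δ (p, c) = δ (p, c₀) := by
    intro p hp c hc
    have hd : ∀ c ∈ Metric.ball c₀ ε, HasFDerivAt (fun c => δ (p, c))
        ((fderiv ℝ δ (p, c)).comp (ContinuousLinearMap.inr ℝ (Base n) ℂ)) c := by
      intro c hc
      obtain ⟨-, h2, h3⟩ := hball _ (hpair hp hc)
      exact HasFDerivAt.comp (g := δ) c
        (h3.sub (diffAt (hP.contDiffAt_psiMap hI h2))).hasFDerivAt (hasFDerivAt_prodMk_right p c)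
    refine Metric.isOpen_ball.is_const_of_fderiv_eq_zero (𝕜 := ℝ)
      (convex_ball c₀ ε).isPreconnected
      (fun c hc => (hd c hc).differentiableAt.differentiableWithinAt) (fun c hc => ?_) hc
      (Metric.mem_ball_self hε)
    obtain ⟨⟨-, h1⟩, h2, h3⟩ := hball _ (hpair hp hc)
    rw [(hd c hc).fderiv]
    refine ContinuousLinearMap.ext fun z => ?_
    have e : fderiv ℝ δ (p, c) = _ := fderiv_fun_sub h3 (diffAt (hP.contDiffAt_psiMap hI h2))
    rw [ContinuousLinearMap.comp_apply, ContinuousLinearMap.inr_apply, e, sub_apply, h1,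
      hP.fderiv_psiMap_vertical hI h2, sub_self]
    rfl
  refine ⟨fun y => δ (β.symm y, c₀), ?_, ?_⟩
  · exact ContDiffAt.comp (g := δ) (f := fun y => (β.symm y, c₀)) (P.baseMap p₀) (by rwa [hβp])
      (hβc.prodMk contDiffAt_const)
  · filter_upwards [Metric.ball_mem_nhds ((p₀, c₀) : Vars n) hε] with v hv
    obtain ⟨⟨h1, -⟩, h2, -⟩ := hball v hv
    rw [← ball_prod_same] at hv
    have e : β.symm (P.baseMap v.1) = v.1 := by
      rw [← hβ]; exact β.left_inv (by rw [hβs]; exact h2)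
    refine Prod.ext h1 ?_
    simp only [e]
    rw [← hconst v.1 hv.1 v.2 hv.2]
    change (f v).2 = P.psiMap v.1.1 v.1.2 v.2 + ((f v).2 - P.psiMap v.1.1 v.1.2 v.2)
    ring

theorem IsAdmissible.ne_zero (h : IsAdmissible S φ S') {v : Vars n} (hv : v ∈ φ.source) :
    v.2 ≠ 0 := norm_pos_iff.1 (S.pos _ (h.source_subset v hv))

theorem IsAdmissible.map_ne_zero (h : IsAdmissible S φ S') {v : Vars n} (hv : v ∈ φ.source) :
    (φ v).2 ≠ 0 := norm_pos_iff.1 (S'.pos _ (h.target_subset _ (φ.map_source hv)))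

/-- Near v₀ the transformation equals the parametrized one up to a summand D. Fixing (t, x) and
varying ψ in `IsAdmissible.relation` gives the functional equation of `eq_zero_of_rotation`, and
S'_ρ ≠ 0 excludes D ≠ 0. -/
theorem IsAdmissible.eq_varsMap (h : IsAdmissible S φ S') (hP : P.IsValidOn I) (hI : IsOpen I)
    (hIc : IsPreconnected I) {v₀ : Vars n} (hv : v₀ ∈ φ.source) (hvI : v₀.1.1 ∈ I)
    (hφ : ∀ᶠ v in 𝓝 v₀, (φ v).1 = P.baseMap v.1 ∧ ∀ z, fderiv ℝ (psiComp φ) v (0, z)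
      = Complex.exp (P.expo v.1) * hat (deriv P.T v.1.1) z) :
    φ v₀ = P.varsMap v₀ := by
  obtain ⟨D, hD, hφD⟩ := exists_affine_of_fderiv_vertical hP hI hIc (h.contDiffAt hv) hvI hφ
  obtain ⟨p, c₀⟩ := v₀
  have hφ0 : φ (p, c₀) = (P.baseMap p, P.psiMap p.1 p.2 c₀ + D (P.baseMap p)) := hφD.self_of_nhds
  set τ := deriv P.T p.1 with hτ
  have hw := h.map_ne_zero hv
  have hmem := h.target_subset _ (φ.map_source hv)
  rw [hφ0] at hw hmem
  -- The inverse of the ψ-component over p. It scales moduli by e^{−Z}, so S at the original point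
  -- becomes a function of |ζ|.
  let σ : ℂ → ℂ := fun ζ => hatL τ (Complex.exp (-P.expo p) * ζ)
  have hσ : Continuous σ := (hatL τ).continuous.comp (continuous_const.mul continuous_id)
  have hσr : ∀ ζ, P.psiMap p.1 p.2 (σ ζ) = ζ := by
    intro ζ
    rw [Params.psiMap_eq]
    simp only [σ, hatL_apply, ← hτ, hat_hat]
    rw [← mul_assoc, ← Complex.exp_add, add_neg_cancel, Complex.exp_zero, one_mul]
  have hσl : σ (P.psiMap p.1 p.2 c₀) = c₀ := P.psiMap_injective p.1 p.2 (hσr _)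
  have hσn : ∀ ζ, ‖σ ζ‖ = Real.exp (-P.Z p.1) * ‖ζ‖ := by
    intro ζ
    have := P.norm_psiMap p.1 p.2 (σ ζ)
    rw [hσr] at this
    rw [this, ← mul_assoc, ← Real.exp_add, neg_add_cancel, Real.exp_zero, one_mul]
  have ht : Filter.Tendsto (fun ζ => ((p, σ ζ) : Vars n)) (𝓝 (P.psiMap p.1 p.2 c₀))
      (𝓝 (p, c₀)) := by
    have : Continuous fun ζ => ((p, σ ζ) : Vars n) := continuous_const.prodMk hσ
    simpa only [hσl] using this.tendsto (P.psiMap p.1 p.2 c₀)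
  have key : D (P.baseMap p) = 0 := by
    refine eq_zero_of_rotation (ζ₀ := P.psiMap p.1 p.2 c₀)
      (G := fun r => S'.val (P.baseMap p, r))
      (F := fun r => P.sMap p.1 p.2 (S.val (p, Real.exp (-P.Z p.1) * r)))
      (γ := -(Complex.I * dt D (P.baseMap p) + ∑ a, dx a (dx a D) (P.baseMap p))) hw ?_
      (S'.deriv_ne_zero _ hmem) ?_
    · have h1 := (S'.smooth _ hmem).contDiffAt (S'.isOpen_dom.mem_nhds hmem)
      exact DifferentiableAt.comp (g := S'.val) (f := fun r => (P.baseMap p, r)) _ (diffAt h1)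
        (by fun_prop)
    · filter_upwards [ht.eventually hφD.eventually_nhds,
        ht.eventually (φ.open_source.mem_nhds hv)] with ζ h1 h2
      have e := h.relation hP hI hIc h2 hvI hD h1
      have e2 : φ (p, σ ζ) = _ := h1.self_of_nhds
      rw [e2] at e
      simp only [hσr, modPoint, hσn] at e
      linear_combination e
  rw [hφ0, key, add_zero]
  rfl

/-- `IsAdmissible.relation` with D = 0, divided by the new ψ, which is nonzero because the class
lives over ρ > 0. -/
theorem IsAdmissible.eq_sMap (h : IsAdmissible S φ S') (hP : P.IsValidOn I) (hI : IsOpen I)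
    (hIc : IsPreconnected I) {v₀ : Vars n} (hv : v₀ ∈ φ.source) (hvI : v₀.1.1 ∈ I)
    (hφ : ∀ᶠ v in 𝓝 v₀, φ v = P.varsMap v) :
    S'.val (modPoint (φ v₀)) = P.sMap v₀.1.1 v₀.1.2 (S.val (modPoint v₀)) := by
  have e := h.relation hP hI hIc hv hvI (D := fun _ => 0) contDiffAt_const (by
    filter_upwards [hφ] with v hv
    rw [hv, add_zero]; rfl)
  have hz : ∀ a, dx a (fun _ : Base n => (0 : ℂ)) = fun _ => 0 := by
    intro a; funext q; rw [dx, fderiv_fun_const]; rfl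
  have hz' : dt (fun _ : Base n => (0 : ℂ)) (P.baseMap v₀.1) = 0 := by
    rw [dt, fderiv_fun_const]; rfl
  simp only [hz, hz', Finset.sum_const_zero, mul_zero, add_zero, sub_zero] at e
  have e2 : (φ v₀).2 = P.psiMap v₀.1.1 v₀.1.2 v₀.2 := congrArg Prod.snd hφ.self_of_nhds
  rw [← e2] at e
  exact mul_right_cancel₀ (h.map_ne_zero hv) e

end

/-! ### Equivalence transformations and normalization -/

section

variable {n : ℕ} {P : Params n} {I : Set ℝ}

theorem BaseDetermined.congr {f g : Vars n → Vars n} {v : Vars n} (h : BaseDetermined f v)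
    (e : f =ᶠ[𝓝 v] g) : BaseDetermined g v := by
  have eb : baseComp f =ᶠ[𝓝 v] baseComp g := e.fun_comp Prod.fst
  have eτ : tau f v = tau g v := by rw [tau, eb.fderiv_eq]; rfl
  have ej : ∀ b a, jac f v b a = jac g v b a := fun b a => by rw [jac, eb.fderiv_eq]; rfl
  refine ⟨h.smooth.congr_of_eventuallyEq e.symm, fun w hw c => ?_, eτ ▸ h.tau_ne, fun c => ?_,
    fun a c => ?_⟩
  · rw [← eb.fderiv_eq]; exact h.fst_spatial w hw c
  · rw [← eb.fderiv_eq]; exact h.vertical c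
  · simp only [← ej, ← eτ]; exact h.gram a c

theorem PsiDetermined.congr {f g : Vars n → Vars n} {v : Vars n} (h : PsiDetermined f v)
    (e : f =ᶠ[𝓝 v] g) : PsiDetermined g v := by
  have eb : baseComp f =ᶠ[𝓝 v] baseComp g := e.fun_comp Prod.fst
  have ep : psiComp f =ᶠ[𝓝 v] psiComp g := e.fun_comp Prod.snd
  have eτ : tau f v = tau g v := by rw [tau, eb.fderiv_eq]; rfl
  have ej : ∀ b a, jac f v b a = jac g v b a := fun b a => by rw [jac, eb.fderiv_eq]; rfl
  refine ⟨fun z => ?_, fun c => ?_, fun a c => ?_, fun c c' => ?_⟩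
  · rw [← ep.fderiv_eq, ← eτ]; exact h.commute z
  · rw [← ep.fderiv_eq]; exact h.ne_zero c
  · simp only [← ep.fderiv_eq, ← D2_congr ep, ← eb.fderiv_eq, ← eτ, ← ej]; exact h.mixed a c
  · rw [← D2_congr ep]; exact h.quad c c'

theorem IsPointTransformation.timeDomain {φ : OpenPartialHomeomorph (Vars n) (Vars n)}
    (h : IsPointTransformation varsTime φ) : TimeDomain φ.source :=
  ⟨φ.open_source, h.time_connected, h.slice_connected⟩

/-- Admissible transformations have the form given by the parameters. -/
theorem IsAdmissible.exists_params {S S' : ArbitraryElement n}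
    {φ : OpenPartialHomeomorph (Vars n) (Vars n)} (hn : 1 ≤ n) (h : IsAdmissible S φ S') :
    ∃ P : Params n, P.IsValidOn (varsTime '' φ.source) ∧ ∀ v ∈ φ.source,
      φ v = P.varsMap v ∧ S'.val (modPoint (φ v)) = P.sMap v.1.1 v.1.2 (S.val (modPoint v)) := by
  have hU := h.pointTransformation.timeDomain
  obtain ⟨P, hP, hf⟩ := hU.exists_params (f := φ) (fun v hv => h.baseDetermined hn hv)
    (fun v hv => h.psiDetermined hn hv)
  have hI := isOpen_time_image hU.isOpen
  have hvars : ∀ v ∈ φ.source, φ v = P.varsMap v := fun v hv =>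
    h.eq_varsMap hP hI hU.time_connected hv ⟨v, hv, rfl⟩ (by
      filter_upwards [φ.open_source.mem_nhds hv] with q hq using hf q hq)
  refine ⟨P, hP, fun v hv => ⟨hvars v hv, ?_⟩⟩
  refine h.eq_sMap hP hI hU.time_connected hv ⟨v, hv, rfl⟩ ?_
  filter_upwards [φ.open_source.mem_nhds hv] with q hq using hvars q hq

/-- The arbitrary element `s + ρ - ρ₀`. -/
def linearElement (n : ℕ) (s : ℂ) (ρ₀ : ℝ) : ArbitraryElement n where
  dom := {q | 0 < q.2}
  val q := s + ((q.2 - ρ₀ : ℝ) : ℂ)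
  isOpen_dom := isOpen_lt continuous_const continuous_snd
  pos _ h := h
  smooth := by
    have h1 : ContDiff ℝ ∞ fun q : Base n × ℝ => q.2 - ρ₀ := by fun_prop
    exact (contDiff_const.add (Complex.ofRealCLM.contDiff.comp h1)).contDiffOn
  deriv_ne_zero q _ := by
    have h1 : HasDerivAt (fun r : ℝ => s + ((r - ρ₀ : ℝ) : ℂ)) 1 q.2 := by
      simpa using (((hasDerivAt_id q.2).sub_const ρ₀).ofReal_comp).const_add s
    rw [h1.deriv]
    exact one_ne_zero

theorem timeDomain_fst_image {Φ : OpenPartialHomeomorph (Joint n) (Joint n)}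
    (h : IsPointTransformation jointTime Φ) : TimeDomain (Prod.fst '' Φ.source) := by
  refine ⟨isOpenMap_fst _ Φ.open_source, ?_, fun t => ?_⟩
  · rw [Set.image_image]; exact h.time_connected
  · have e : Prod.fst '' Φ.source ∩ varsTime ⁻¹' {t}
        = Prod.fst '' (Φ.source ∩ jointTime ⁻¹' {t}) := by
      ext v
      constructor
      · rintro ⟨⟨w, hw, rfl⟩, ht⟩; exact ⟨w, ⟨hw, ht⟩, rfl⟩
      · rintro ⟨w, ⟨hw, ht⟩, rfl⟩; exact ⟨⟨w, hw, rfl⟩, ht⟩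
    rw [e]
    exact (h.slice_connected t).image _ continuous_fst.continuousOn

/-- For a point (v, s) the `linearElement` taking the value s at v is mapped by Φ to another
equation, and the induced admissible germ has the same (t,x,ψ)-components as Φ. Thus these
components satisfy the determining equations throughout, which integrate to one set of parameters;
varying s then yields the S-component. -/
theorem IsEquivalence.exists_params {Φ : OpenPartialHomeomorph (Joint n) (Joint n)} (hn : 1 ≤ n)
    (h : IsEquivalence Φ) :
    ∃ P : Params n, P.IsValidOn (jointTime '' Φ.source) ∧ ∀ w ∈ Φ.source, Φ w = P.map w := by
  have hU := timeDomain_fst_image h.pointTransformation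
  obtain ⟨f, hf⟩ := h.projectable
  have hadm : ∀ w ∈ Φ.source, ∃ (S S' : ArbitraryElement n)
      (φ : OpenPartialHomeomorph (Vars n) (Vars n)), IsAdmissible S φ S' ∧ w.1 ∈ φ.source ∧
        φ =ᶠ[𝓝 w.1] f ∧ S.val (modPoint w.1) = w.2 ∧ Φ w = (φ w.1, S'.val (modPoint (φ w.1))) := by
    rintro ⟨v, s⟩ hw
    have hv : v.2 ≠ 0 := h.ne_zero _ hw
    have hval : (linearElement n s ‖v.2‖).val (modPoint v) = s := by
      simp [linearElement, modPoint]
    obtain ⟨φ, S', hvφ, hind, hA⟩ := h.maps_class (linearElement n s ‖v.2‖) v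
      (norm_pos_iff.2 hv) (by rw [hval]; exact hw)
    refine ⟨_, S', φ, hA, hvφ, ?_, hval, ?_⟩
    · filter_upwards [φ.open_source.mem_nhds hvφ] with q hq
      obtain ⟨h1, h2⟩ := hind q hq
      have h3 := hf _ h1
      rw [h2] at h3
      exact h3
    · have := (hind v hvφ).2
      rwa [hval] at this
  obtain ⟨P, hP, hPf⟩ := hU.exists_params (f := f)
    (by
      rintro _ ⟨w, hw, rfl⟩
      obtain ⟨S, S', φ, hA, hwφ, hev, -, -⟩ := hadm w hw
      exact (hA.baseDetermined hn hwφ).congr hev)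
    (by
      rintro _ ⟨w, hw, rfl⟩
      obtain ⟨S, S', φ, hA, hwφ, hev, -, -⟩ := hadm w hw
      exact (hA.psiDetermined hn hwφ).congr hev)
  have hI := isOpen_time_image hU.isOpen
  have hfv : ∀ w ∈ Φ.source, f w.1 = P.varsMap w.1 := by
    intro w hw
    obtain ⟨S, S', φ, hA, hwφ, hev, -, -⟩ := hadm w hw
    rw [← hev.self_of_nhds]
    refine hA.eq_varsMap hP hI hU.time_connected hwφ ⟨_, ⟨w, hw, rfl⟩, rfl⟩ ?_
    filter_upwards [hev.eventually_nhds, hU.isOpen.mem_nhds ⟨w, hw, rfl⟩] with v h1 h2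
    have e : psiComp φ =ᶠ[𝓝 v] psiComp f := Filter.EventuallyEq.fun_comp h1 Prod.snd
    rw [e.fderiv_eq, h1.self_of_nhds]
    exact hPf v h2
  refine ⟨P, ?_, fun w hw => ?_⟩
  · rw [Set.image_image] at hP; exact hP
  · obtain ⟨S, S', φ, hA, hwφ, hev, hval, hΦ⟩ := hadm w hw
    have e := hA.eq_sMap hP hI hU.time_connected hwφ ⟨_, ⟨w, hw, rfl⟩, rfl⟩ (by
      filter_upwards [hev, hU.isOpen.mem_nhds ⟨w, hw, rfl⟩] with v h1 h2
      obtain ⟨w', hw', rfl⟩ := h2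
      rw [h1, hfv w' hw'])
    rw [hΦ, e, hval, hev.self_of_nhds, hfv w hw]
    rfl

/-- The image of an arbitrary element under the transformation with parameters `P`. -/
theorem Params.IsValidOn.exists_image (hP : P.IsValidOn I) (hI : IsOpen I) (hIc : IsPreconnected I)
    (S : ArbitraryElement n) : ∃ S' : ArbitraryElement n, ∀ v : Vars n, v.1.1 ∈ I →
      modPoint v ∈ S.dom → modPoint (P.varsMap v) ∈ S'.dom ∧
        S'.val (modPoint (P.varsMap v)) = P.sMap v.1.1 v.1.2 (S.val (modPoint v)) := by
  obtain ⟨β, hβs, hβ, -, hβ'⟩ := hP.exists_baseHomeo hI hIc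
  have hβI : ∀ y ∈ β.target, (β.symm y).1 ∈ I := fun y hy => by
    have := β.map_target hy
    rwa [hβs] at this
  -- The inverse action on (t, x, ρ): moduli are multiplied by e^Z under the transformation, so they
  -- are multiplied by e^{−Z} here.
  let g : Base n × ℝ → Base n × ℝ := fun q =>
    (β.symm q.1, Real.exp (-P.Z (β.symm q.1).1) * q.2)
  have hg : ∀ q : Base n × ℝ, q.1 ∈ β.target → ContDiffAt ℝ ∞ g q := by
    intro q hq
    have h1 : ContDiffAt ℝ ∞ (fun q : Base n × ℝ => β.symm q.1) q :=
      ContDiffAt.comp (g := β.symm) q ((hβ' _ hq).contDiffAt (β.open_target.mem_nhds hq))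
        contDiffAt_fst
    have h2 : ContDiffAt ℝ ∞ (fun q : Base n × ℝ => P.Z (β.symm q.1).1) q :=
      ContDiffAt.comp (g := P.Z) (f := fun q : Base n × ℝ => (β.symm q.1).1) q
        (hP.contDiffAt_Z hI (hβI _ hq)) (contDiffAt_fst.comp q h1)
    exact h1.prodMk (h2.neg.exp.mul contDiffAt_snd)
  let dom : Set (Base n × ℝ) := {q | 0 < q.2 ∧ q.1 ∈ β.target ∧ g q ∈ S.dom}
  have hval : ∀ q ∈ dom, ContDiffAt ℝ ∞
      (fun q => P.sMap (g q).1.1 (g q).1.2 (S.val (g q))) q := by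
    intro q hq
    have h1 : ContDiffAt ℝ ∞ (fun q => S.val (g q)) q :=
      ContDiffAt.comp (g := S.val) q
        ((S.smooth _ hq.2.2).contDiffAt (S.isOpen_dom.mem_nhds hq.2.2)) (hg q hq.2.1)
    exact ContDiffAt.comp (g := fun q : Base n × ℂ => P.sMap q.1.1 q.1.2 q.2)
      (f := fun q => ((g q).1, S.val (g q))) q
      (hP.contDiffAt_sMap hI (q := ((g q).1, S.val (g q))) (hβI _ hq.2.1))
      ((contDiffAt_fst.comp q (hg q hq.2.1)).prodMk h1)
  let S' : ArbitraryElement n :=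
    { dom := dom
      val := fun q => P.sMap (g q).1.1 (g q).1.2 (S.val (g q))
      isOpen_dom := by
        rw [isOpen_iff_mem_nhds]
        intro q hq
        filter_upwards [continuousAt_snd.eventually (lt_mem_nhds hq.1),
          continuousAt_fst.eventually (β.open_target.mem_nhds hq.2.1),
          (hg q hq.2.1).continuousAt.eventually (S.isOpen_dom.mem_nhds hq.2.2)] with p h1 h2 h3
        exact ⟨h1, h2, h3⟩
      pos := fun _ h => h.1
      smooth := fun q hq => (hval q hq).contDiffWithinAt
      deriv_ne_zero := by
        intro q hq
        set p := β.symm q.1 with hp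
        set κ := Real.exp (-P.Z p.1) with hκ
        have hd : DifferentiableAt ℝ (fun r => S.val (p, r)) (κ * q.2) :=
          DifferentiableAt.comp (g := S.val) (f := fun r => (p, r)) _
            (diffAt ((S.smooth _ hq.2.2).contDiffAt (S.isOpen_dom.mem_nhds hq.2.2))) (by fun_prop)
        have h1 : HasDerivAt (fun r : ℝ => S.val (p, κ * r))
            (κ • deriv (fun r => S.val (p, r)) (κ * q.2)) q.2 :=
          HasDerivAt.scomp (g₁ := fun r => S.val (p, r)) (h := fun r => κ * r) q.2 hd.hasDerivAt
            (by simpa using (hasDerivAt_id q.2).const_mul κ)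
        have h2 := (((hatL (deriv P.T p.1)).hasFDerivAt.comp_hasDerivAt q.2 h1).div_const
          ((|deriv P.T p.1| : ℝ) : ℂ)).add_const (P.sMap p.1 p.2 0)
        have e : (fun r : ℝ => P.sMap (g (q.1, r)).1.1 (g (q.1, r)).1.2 (S.val (g (q.1, r))))
            = fun r => (hatL (deriv P.T p.1) ∘ fun r => S.val (p, κ * r)) r
              / ((|deriv P.T p.1| : ℝ) : ℂ) + P.sMap p.1 p.2 0 := by
          funext r
          change P.sMap p.1 p.2 (S.val (p, κ * r)) = _
          rw [P.sMap_eq, Function.comp_apply, hatL_apply]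
        rw [e, h2.deriv, hatL_apply]
        have h0 : ((|deriv P.T p.1| : ℝ) : ℂ) ≠ 0 := by
          exact_mod_cast (hP.abs_pos (hβI _ hq.2.1)).ne'
        refine div_ne_zero (fun h => ?_) h0
        have := hat_eq_zero.1 h
        rcases smul_eq_zero.1 this with h | h
        · exact (Real.exp_pos _).ne' h
        · exact S.deriv_ne_zero _ hq.2.2 h }
  refine ⟨S', fun v hvI hv => ?_⟩
  have hvβ : v.1 ∈ β.source := by rw [hβs]; exact hvI
  have e1 : β.symm (P.baseMap v.1) = v.1 := by rw [← hβ]; exact β.left_inv hvβ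
  have e2 : g (modPoint (P.varsMap v)) = modPoint v := by
    simp only [g, modPoint, Params.varsMap, e1, Params.norm_psiMap]
    rw [← mul_assoc, ← Real.exp_add, neg_add_cancel, Real.exp_zero, one_mul]
  refine ⟨⟨?_, ?_, ?_⟩, ?_⟩
  · have := S.pos _ hv
    change 0 < ‖P.psiMap v.1.1 v.1.2 v.2‖
    rw [Params.norm_psiMap]
    exact mul_pos (Real.exp_pos _) this
  · change P.baseMap v.1 ∈ β.target
    rw [← hβ]; exact β.map_source hvβ
  · rw [e2]; exact hv
  · change P.sMap (g _).1.1 (g _).1.2 (S.val (g _)) = _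
    rw [e2]; rfl

/-- Both factors relating the two equations in `Params.IsValidOn.transform_identity` are nonzero,
and conjugation preserves zero, so either equation implies the other. -/
theorem Params.IsValidOn.isAdmissible (hP : P.IsValidOn I) (hI : IsOpen I)
    {S S' : ArbitraryElement n} {φ : OpenPartialHomeomorph (Vars n) (Vars n)}
    (hpt : IsPointTransformation varsTime φ) (hφ : ∀ v, φ v = P.varsMap v)
    (hφI : ∀ v ∈ φ.source, v.1.1 ∈ I) (hS : ∀ v ∈ φ.source, modPoint v ∈ S.dom)
    (hS' : ∀ v ∈ φ.source, modPoint (φ v) ∈ S'.dom ∧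
        S'.val (modPoint (φ v)) = P.sMap v.1.1 v.1.2 (S.val (modPoint v))) :
    IsAdmissible S φ S' := by
  refine ⟨hpt, hS, fun v hv => ?_, fun u u' p hp hu hu' hmaps => ?_⟩
  · have := (hS' _ (φ.map_target hv)).1
    rwa [φ.right_inv hv] at this
  · have hpI := hφI _ hp
    have hb : (φ (p, u p)).1 = P.baseMap p := by rw [hφ]; rfl
    have hev : ∀ᶠ q in 𝓝 p, u' (P.baseMap q) = P.psiMap q.1 q.2 (u q) := by
      filter_upwards [hmaps] with q hq
      rw [hφ] at hq
      exact hq.symm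
    rw [hb] at hu' ⊢
    have htr := hP.transform_identity hI hpI (x := p.2) hu hu' hev (S.val (p, ‖u p‖))
    rw [show ((p.1, p.2) : Base n) = p from rfl] at htr
    have e : S'.val (P.baseMap p, ‖u' (P.baseMap p)‖) = P.sMap p.1 p.2 (S.val (p, ‖u p‖)) := by
      have := (hS' _ hp).2
      rw [hφ] at this
      rw [hev.self_of_nhds]
      exact this
    have h0 : ((|deriv P.T p.1| : ℝ) : ℂ) ≠ 0 := by exact_mod_cast (hP.abs_pos hpI).ne'
    rw [SolvesAt, SolvesAt, e]
    constructor
    · intro h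
      rw [h, hat_eq_zero.2 rfl, mul_zero] at htr
      exact (mul_eq_zero.1 htr).resolve_left h0
    · intro h
      rw [h, mul_zero] at htr
      exact hat_eq_zero.1 ((mul_eq_zero.1 htr.symm).resolve_left (Complex.exp_ne_zero _))

theorem isOpen_jointTime_image {W : Set (Joint n)} (hW : IsOpen W) : IsOpen (jointTime '' W) := by
  have e : jointTime '' W = varsTime '' (Prod.fst '' W) := by rw [Set.image_image]; rfl
  rw [e]
  exact isOpen_time_image (isOpenMap_fst _ hW)

/-- Transformations of the given form are equivalence transformations. -/
theorem Params.IsValidOn.isEquivalence {Φ : OpenPartialHomeomorph (Joint n) (Joint n)}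
    (hpt : IsPointTransformation jointTime Φ) (hne : ∀ w ∈ Φ.source, w.1.2 ≠ 0)
    (hP : P.IsValidOn (jointTime '' Φ.source)) (hΦ : ∀ w ∈ Φ.source, Φ w = P.map w) :
    IsEquivalence Φ := by
  refine ⟨hpt, hne, ⟨P.varsMap, fun w hw => by rw [hΦ w hw]; rfl⟩, fun S v hv hw => ?_⟩
  have hI := isOpen_jointTime_image Φ.open_source
  have hIc := hpt.time_connected
  obtain ⟨S', hS'⟩ := hP.exists_image hI hIc S
  have hmod : Continuous fun v : Vars n => modPoint v :=
    continuous_fst.prodMk continuous_snd.norm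
  have hSc : ContinuousAt S.val (modPoint v) :=
    ((S.smooth _ hv).contDiffAt (S.isOpen_dom.mem_nhds hv)).continuousAt
  have hev : ∀ᶠ q in 𝓝 v, modPoint q ∈ S.dom ∧ (q, S.val (modPoint q)) ∈ Φ.source := by
    refine (hmod.continuousAt.eventually (S.isOpen_dom.mem_nhds hv)).and ?_
    have hc : ContinuousAt (fun q : Vars n => (q, S.val (modPoint q))) v :=
      continuousAt_id.prodMk (ContinuousAt.comp (g := S.val) hSc hmod.continuousAt)
    exact hc.eventually (Φ.open_source.mem_nhds hw)
  -- Only a germ at v is needed. A ball on which the graph of S stays in the source of Φ is convex,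
  -- which gives the required connectedness of its times and slices.
  obtain ⟨ε, hε, hball⟩ := Metric.eventually_nhds_iff_ball.1 hev
  have hWI : ∀ q ∈ Metric.ball v ε, q.1.1 ∈ jointTime '' Φ.source := fun q hq =>
    ⟨_, (hball q hq).2, rfl⟩
  obtain ⟨φ, hφs, hφ, hφc, hφc'⟩ := hP.exists_varsHomeo hI hIc Metric.isOpen_ball hWI
  have hconv : Convex ℝ (Metric.ball v ε) := convex_ball v ε
  have hlin : IsLinearMap ℝ (varsTime (n := n)) := ⟨fun _ _ => rfl, fun _ _ => rfl⟩
  have hφpt : IsPointTransformation varsTime φ := by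
    refine ⟨hφc, hφc', ?_, fun t => ?_⟩
    · rw [hφs]
      exact (hconv.is_linear_image hlin).isPreconnected
    · rw [hφs]
      exact (hconv.inter ((convex_singleton t).is_linear_preimage hlin)).isPreconnected
  refine ⟨φ, S', by rw [hφs]; exact Metric.mem_ball_self hε, fun q hq => ?_, ?_⟩
  · rw [hφs] at hq
    refine ⟨(hball q hq).2, ?_⟩
    rw [hΦ _ (hball q hq).2, hφ, (hS' q (hWI q hq) (hball q hq).1).2]
    rfl
  · refine hP.isAdmissible hI hφpt hφ ?_ ?_ ?_
    · rw [hφs]; exact hWI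
    · rw [hφs]; exact fun q hq => (hball q hq).1
    · rw [hφs]
      intro q hq
      rw [hφ]
      exact hS' q (hWI q hq) (hball q hq).1

/-- Every admissible transformation is induced by an equivalence transformation. -/
theorem isNormalized (hn : 1 ≤ n) : IsNormalized n := by
  intro S φ S' h
  obtain ⟨P, hP, hφ⟩ := h.exists_params hn
  have hU := h.pointTransformation.timeDomain
  have hI := isOpen_time_image hU.isOpen
  -- The formulas make sense for every value of S, so Φ is taken on the full cylinder over the
  -- source of φ; its slices inherit connectedness.
  let W : Set (Joint n) := {w | w.1 ∈ φ.source}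
  have hfst : Prod.fst '' W = φ.source := by
    ext v
    constructor
    · rintro ⟨w, hw, rfl⟩; exact hw
    · exact fun hv => ⟨(v, 0), hv, rfl⟩
  have htime : jointTime '' W = varsTime '' φ.source := by
    rw [← hfst, Set.image_image]; rfl
  obtain ⟨Φ, hΦs, hΦ, hΦc, hΦc'⟩ := hP.exists_jointHomeo hI hU.time_connected (W := W)
    (φ.open_source.preimage continuous_fst) (fun w hw => ⟨w.1, hw, rfl⟩)
  have hpt : IsPointTransformation jointTime Φ := by
    refine ⟨hΦc, hΦc', ?_, fun t => ?_⟩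
    · rw [hΦs, htime]; exact hU.time_connected
    · have e : Φ.source ∩ jointTime ⁻¹' {t} = (φ.source ∩ varsTime ⁻¹' {t}) ×ˢ Set.univ := by
        rw [hΦs]
        ext w
        simp [W, jointTime, varsTime]
      rw [e]
      exact (hU.slice_connected t).prod isPreconnected_univ
  refine ⟨Φ, Params.IsValidOn.isEquivalence (P := P) hpt ?_ ?_ fun w _ => hΦ w, ?_, ?_, ?_⟩
  · rw [hΦs]; exact fun w hw => h.ne_zero hw
  · rw [hΦs, htime]; exact hP
  · rw [hΦs]; exact hfst
  · rw [hΦs]; intro w hw; rw [hΦ, (hφ _ hw).1]; rfl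
  · intro v hv
    refine ⟨by rw [hΦs]; exact hv, ?_⟩
    rw [hΦ, (hφ v hv).2, (hφ v hv).1]
    rfl

theorem Params.IsValidOn.exists_equivalence (hI : IsOpen I) (hIc : IsPreconnected I)
    (hP : P.IsValidOn I) : ∃ Φ : OpenPartialHomeomorph (Joint n) (Joint n), IsEquivalence Φ ∧
      Φ.source = {w | jointTime w ∈ I ∧ w.1.2 ≠ 0} ∧ ∀ w ∈ Φ.source, Φ w = P.map w := by
  let W : Set (Joint n) := {w | jointTime w ∈ I ∧ w.1.2 ≠ 0}
  have hcont : Continuous (jointTime (n := n)) :=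
    continuous_fst.comp (continuous_fst.comp continuous_fst)
  have hcont2 : Continuous fun w : Joint n => w.1.2 := continuous_snd.comp continuous_fst
  have hW : IsOpen W := (hI.preimage hcont).inter (isOpen_ne.preimage hcont2)
  have htime : jointTime '' W = I := by
    ext t
    constructor
    · rintro ⟨w, hw, rfl⟩; exact hw.1
    · exact fun ht => ⟨(((t, 0), 1), 0), ⟨ht, one_ne_zero⟩, rfl⟩
  obtain ⟨Φ, hΦs, hΦ, hΦc, hΦc'⟩ := hP.exists_jointHomeo hI hIc hW (fun w hw => hw.1)
  have hpt : IsPointTransformation jointTime Φ := by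
    refine ⟨hΦc, hΦc', ?_, fun t => ?_⟩
    · rw [hΦs, htime]; exact hIc
    · by_cases ht : t ∈ I
      · have e : Φ.source ∩ jointTime ⁻¹' {t}
            = ((({t} : Set ℝ) ×ˢ (Set.univ : Set (Fin n → ℝ))) ×ˢ ({0}ᶜ : Set ℂ)) ×ˢ
              (Set.univ : Set ℂ) := by
          rw [hΦs]
          ext w
          simp only [W, jointTime, Set.mem_inter_iff, Set.mem_ofPred_eq, Set.mem_preimage,
            Set.mem_singleton_iff, Set.mem_prod, Set.mem_univ, and_true, Set.mem_compl_iff]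
          constructor
          · rintro ⟨⟨-, h⟩, h'⟩; exact ⟨h', h⟩
          · rintro ⟨h', h⟩; exact ⟨⟨h' ▸ ht, h⟩, h'⟩
        rw [e]
        refine ((isPreconnected_singleton.prod isPreconnected_univ).prod ?_).prod
          isPreconnected_univ
        -- Removing ψ = 0 keeps the slice connected because ℂ has real dimension two.
        exact (isConnected_compl_singleton_of_one_lt_rank (by simp) 0).isPreconnected
      · have e : Φ.source ∩ jointTime ⁻¹' {t} = ∅ := by
          rw [hΦs]
          ext w
          simp only [Set.mem_inter_iff, Set.mem_preimage, Set.mem_singleton_iff,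
            Set.mem_empty_iff_false, iff_false]
          rintro ⟨h, h'⟩
          exact ht (h' ▸ h.1)
        rw [e]
        exact isPreconnected_empty
  refine ⟨Φ, Params.IsValidOn.isEquivalence (P := P) hpt ?_ ?_ fun w _ => hΦ w, hΦs,
    fun w _ => hΦ w⟩
  · rw [hΦs]; exact fun w hw => hw.2
  · rw [hΦs, htime]; exact hP

end

end ModularSchrodinger

end

theorem mainTheorem4 (n : ℕ) (hn : 1 ≤ n) :
    ModularSchrodinger.IsNormalized n ∧
    (∀ Φ : OpenPartialHomeomorph (ModularSchrodinger.Joint n) (ModularSchrodinger.Joint n),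
      ModularSchrodinger.IsEquivalence Φ ↔
        (ModularSchrodinger.IsPointTransformation ModularSchrodinger.jointTime Φ ∧
          (∀ w ∈ Φ.source, w.1.2 ≠ 0) ∧
          ∃ P : ModularSchrodinger.Params n,
            P.IsValidOn (ModularSchrodinger.jointTime '' Φ.source) ∧
              ∀ w ∈ Φ.source, Φ w = P.map w)) ∧
    (∀ (I : Set ℝ) (P : ModularSchrodinger.Params n),
      IsOpen I → IsPreconnected I → P.IsValidOn I →
        ∃ Φ : OpenPartialHomeomorph (ModularSchrodinger.Joint n) (ModularSchrodinger.Joint n),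
          ModularSchrodinger.IsEquivalence Φ ∧
          Φ.source = {w | ModularSchrodinger.jointTime w ∈ I ∧ w.1.2 ≠ 0} ∧
          ∀ w ∈ Φ.source, Φ w = P.map w) := by
  refine ⟨ModularSchrodinger.isNormalized hn, fun Φ => ⟨fun h => ?_, ?_⟩,
    fun I P hI hIc hP => hP.exists_equivalence hI hIc⟩
  · exact ⟨h.pointTransformation, h.ne_zero, h.exists_params hn⟩
  · rintro ⟨hpt, hne, P, hP, hΦ⟩
    exact hP.isEquivalence hpt hne hΦ
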